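/- Let $n\ge 1$ and $r\ge 0$ be integers and let $\mathbf d=(d_1,\dots,d_r)$ be a tuple of non-negative integers. There is a constant $C$ depending only on $n$ and $\mathbf d$ such that the following holds. Let $p$ be a prime with $p\nmid d_i(d_i-1)$ for all $i$, and let $G_1,\dots,G_r\in\mathbb Z[x_1,\dots,x_n]$ be homogeneous polynomials of degrees $d_1,\dots,d_r$. Let $K$ be an algebraically closed field of characteristic $p$ (for example $\overline{\mathbb F}_p$); evaluate the $G_i$ and their derivatives in $K$ via reduction mod $p$, and identify varieties with their sets of $K$-points. Put $\dim\emptyset=-1$, and let codimension in $\mathbb P^{n-1}$ mean $n-1-\dim$. Suppose that the variety $Z=\{\mathbf x\in\mathbb P^{n-1} : G_1(\mathbf x)=\dots=G_r(\mathbf x)=0\}$ has codimension $r$ and is non-singular, that is, there is no $\mathbf x\in Z$ at which the Jacobian matrix with rows $\nabla G_1(\mathbf x),\dots,\nabla G_r(\mathbf x)$ has rank less than $r$. Define $$S=\{(\mathbf x,\mathbf y)\in\mathbb P^{n-1}\times\mathbb P^{n-1} : \mathbf y\cdot\nabla G_i(\mathbf x)=0\ (1\le i\le r),\ \operatorname{rank}(\mathbf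 y\cdot\nabla^2G_i(\mathbf x))_{1\le i\le r}<r\},$$ where $\nabla^2 G_i$ is the Hessian matrix and $(\mathbf y\cdot\nabla^2G_i(\mathbf x))_{1\le i\le r}$ is the $r\times n$ matrix with these rows; let $S_{\mathbf y}=\{\mathbf x\in\mathbb P^{n-1} : (\mathbf x,\mathbf y)\in S\}$ for $\mathbf y\in\mathbb P^{n-1}$, and, for integers $-1\le s\le n-1$, let $T_s=\{\mathbf y\in\mathbb P^{n-1} : \dim S_{\mathbf y}\ge s\}$. Then $S$ is Zariski closed and defined by bihomogeneous equations over $\mathbb F_p$, each $S_{\mathbf y}$ is Zariski closed, and each $T_s$ is Zariski closed and defined by homogeneous equations over $\mathbb F_p$. Moreover: (i) $\dim S\le n-2$; (ii) $\dim T_s\le n-s-2$ for $-1\le s\le n-1$; (iii) for $-1\le s\le n-1$, $T_s$ has finitely many irreducible components $T_s^{(1)},T_s^{(2)},\dots$, and $\sum_j\deg(T_s^{(j)})\le C$, where the degree of an irreducible closed set $X\subseteq\mathbb P^{n-1}$ is the largest number of points in a finite intersection of $X$ with a linear subspace of codimension $\dim X$. -/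

import Mathlib

open MvPolynomial

namespace ProjGeom

noncomputable section

/-! Classical projective geometry over a field `K` (algebraically closed in the theorem). -/

/-- The set of `K`-points of projective space of dimension `n - 1`; it carries the Zariski
topology (below). -/
def ProjSpace (K : Type*) [Field K] (n : ℕ) : Type _ := Projectivization K (Fin n → K)

/-- A vector of homogeneous coordinates of a point. All conditions imposed on it below are
invariant under scaling. -/
def ProjSpace.coords {K : Type*} [Field K] {n : ℕ} (x : ProjSpace K n) : Fin n → K :=
  Projectivization.rep x

/-- The set of `K`-points of the product of two copies of projective space of dimension `n - 1`.
It is a structure of its own because its Zariski topology is not the product topology. -/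
@[ext] structure BiProjSpace (K : Type*) [Field K] (n : ℕ) where
  fst : ProjSpace K n
  snd : ProjSpace K n

/-- The coordinates `(x, y)` of a point of the product, as values of `n + n` variables. -/
def BiProjSpace.coords {K : Type*} [Field K] {n : ℕ} (z : BiProjSpace K n) :
    Fin n ⊕ Fin n → K :=
  Sum.elim z.fst.coords z.snd.coords

/-- `f(x, y)` is bihomogeneous of bidegree `(a, b)`: every monomial has total degree `a` in the
variables `x` and total degree `b` in the variables `y`. -/
def IsBihomogeneous {k : Type*} [CommSemiring k] {n : ℕ}
    (f : MvPolynomial (Fin n ⊕ Fin n) k) (a b : ℕ) : Prop :=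
  IsWeightedHomogeneous (Sum.elim (fun _ => 1) (fun _ => 0) : Fin n ⊕ Fin n → ℕ) f a ∧
  IsWeightedHomogeneous (Sum.elim (fun _ => 0) (fun _ => 1) : Fin n ⊕ Fin n → ℕ) f b

/-- `T` is the set of common zeros of a family of homogeneous polynomials with coefficients
in `k`, i.e. `T` comes from a closed subset of projective space over `k`. -/
def IsClosedOver (k : Type*) {K : Type*} [CommRing k] [Field K] [Algebra k K] {n : ℕ}
    (T : Set (ProjSpace K n)) : Prop :=
  ∃ A : Set (MvPolynomial (Fin n) k), (∀ f ∈ A, ∃ m, f.IsHomogeneous m) ∧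
    T = {x | ∀ f ∈ A, aeval x.coords f = 0}

/-- `T` is the set of common zeros of a family of bihomogeneous polynomials with coefficients
in `k`. -/
def IsBiClosedOver (k : Type*) {K : Type*} [CommRing k] [Field K] [Algebra k K] {n : ℕ}
    (T : Set (BiProjSpace K n)) : Prop :=
  ∃ A : Set (MvPolynomial (Fin n ⊕ Fin n) k), (∀ f ∈ A, ∃ a b, IsBihomogeneous f a b) ∧
    T = {z | ∀ f ∈ A, aeval z.coords f = 0}

/-- The Zariski topology: the closed sets are the common zero sets of homogeneous polynomials. -/
instance {K : Type*} [Field K] {n : ℕ} : TopologicalSpace (ProjSpace K n) :=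
  TopologicalSpace.ofClosed {T | IsClosedOver K T}
    ⟨{1}, by simpa using ⟨0, isHomogeneous_one _ _⟩, by simp⟩
    (by
      intro F hF
      refine ⟨{f | (∃ m, f.IsHomogeneous m) ∧ ∃ T ∈ F, ∀ x ∈ T, aeval x.coords f = 0},
        fun f hf => hf.1, ?_⟩
      ext x
      constructor
      · rintro hx f ⟨-, T, hT, h⟩
        exact h x (hx T hT)
      · intro hx T hT
        obtain ⟨A, hA, rfl⟩ := hF hT
        exact fun f hf => hx f ⟨hA f hf, _, hT, fun y hy => hy f hf⟩)
    (by
      rintro _ ⟨A, hA, rfl⟩ _ ⟨B, hB, rfl⟩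
      refine ⟨{h | ∃ f ∈ A, ∃ g ∈ B, h = f * g}, ?_, ?_⟩
      · rintro _ ⟨f, hf, g, hg, rfl⟩
        obtain ⟨a, ha⟩ := hA f hf
        obtain ⟨b, hb⟩ := hB g hg
        exact ⟨a + b, ha.mul hb⟩
      · ext x
        constructor
        · rintro (hx | hx) _ ⟨f, hf, g, hg, rfl⟩
          · rw [map_mul, hx f hf, zero_mul]
          · rw [map_mul, hx g hg, mul_zero]
        · intro hx
          by_contra hcon
          simp only [Set.mem_union, Set.mem_ofPred_eq, not_or, not_forall] at hcon
          obtain ⟨⟨f, hf, h1⟩, ⟨g, hg, h2⟩⟩ := hcon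
          have := hx _ ⟨f, hf, g, hg, rfl⟩
          rw [map_mul] at this
          exact (mul_ne_zero h1 h2) this)

/-- The Zariski topology on the product: the closed sets are the common zero sets of
bihomogeneous polynomials. -/
instance {K : Type*} [Field K] {n : ℕ} : TopologicalSpace (BiProjSpace K n) :=
  TopologicalSpace.ofClosed {T | IsBiClosedOver K T}
    ⟨{1}, by simpa using ⟨0, 0, isWeightedHomogeneous_one _ _, isWeightedHomogeneous_one _ _⟩,
      by simp⟩
    (by
      intro F hF
      refine ⟨{f | (∃ a b, IsBihomogeneous f a b) ∧ ∃ T ∈ F, ∀ x ∈ T, aeval x.coords f = 0},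
        fun f hf => hf.1, ?_⟩
      ext x
      constructor
      · rintro hx f ⟨-, T, hT, h⟩
        exact h x (hx T hT)
      · intro hx T hT
        obtain ⟨A, hA, rfl⟩ := hF hT
        exact fun f hf => hx f ⟨hA f hf, _, hT, fun y hy => hy f hf⟩)
    (by
      rintro _ ⟨A, hA, rfl⟩ _ ⟨B, hB, rfl⟩
      refine ⟨{h | ∃ f ∈ A, ∃ g ∈ B, h = f * g}, ?_, ?_⟩
      · rintro _ ⟨f, hf, g, hg, rfl⟩
        obtain ⟨a, b, ha⟩ := hA f hf
        obtain ⟨a', b', hb⟩ := hB g hg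
        exact ⟨a + a', b + b', ha.1.mul hb.1, ha.2.mul hb.2⟩
      · ext x
        constructor
        · rintro (hx | hx) _ ⟨f, hf, g, hg, rfl⟩
          · rw [map_mul, hx f hf, zero_mul]
          · rw [map_mul, hx g hg, mul_zero]
        · intro hx
          by_contra hcon
          simp only [Set.mem_union, Set.mem_ofPred_eq, not_or, not_forall] at hcon
          obtain ⟨⟨f, hf, h1⟩, ⟨g, hg, h2⟩⟩ := hcon
          have := hx _ ⟨f, hf, g, hg, rfl⟩
          rw [map_mul] at this
          exact (mul_ne_zero h1 h2) this)

/-- The (topological Krull) dimension of a subset of a topological space, with the convention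
that the empty set has dimension `-1`. -/
def dimension {X : Type*} [TopologicalSpace X] (T : Set X) : WithTop ℤ :=
  WithBot.recBotCoe (C := fun _ => WithTop ℤ) (-1 : ℤ)
    (fun m : ℕ∞ => WithTop.map (fun k : ℕ => (k : ℤ)) m) (topologicalKrullDim T)

/-- `T` has codimension `c` in projective space of dimension `n - 1`, in the sense
`dim T + c = n - 1`; thus the empty set has codimension `n`. -/
def HasCodim {K : Type*} [Field K] {n : ℕ} (T : Set (ProjSpace K n)) (c : ℕ) : Prop :=
  dimension T + (c : ℤ) = ((n : ℤ) - 1 : ℤ)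

/-- The irreducible components of a subset (with its subspace topology), as subsets of the
ambient space. -/
def components {X : Type*} [TopologicalSpace X] (T : Set X) : Set (Set X) :=
  (fun Z : Set T => Subtype.val '' Z) '' irreducibleComponents T

/-- The part of `X` on the linear subspace of projective space given by the vector subspace `W`. -/
def linearSection {K : Type*} [Field K] {n : ℕ} (X : Set (ProjSpace K n))
    (W : Submodule K (Fin n → K)) : Set (ProjSpace K n) :=
  {x ∈ X | x.coords ∈ W}

/-- The degree of an irreducible closed subset `X` of projective space over an algebraically
closed field: the largest number of points in which `X` meets a linear subspace whose
codimension is `dim X`, among those linear subspaces that meet `X` in finitely many points. -/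
def degree {K : Type*} [Field K] {n : ℕ} (X : Set (ProjSpace K n)) : ℕ∞ :=
  ⨆ (W : Submodule K (Fin n → K))
    (_ : dimension X + (Module.finrank K W : ℤ) = (n : ℤ))
    (_ : (linearSection X W).Finite), (linearSection X W).encard

/-- The gradient of an integral polynomial at a point with coordinates in `K`. -/
def gradient {K : Type*} [Field K] {n : ℕ} (G : MvPolynomial (Fin n) ℤ) (x : Fin n → K) :
    Fin n → K :=
  fun j => aeval x (pderiv j G)

/-- The Hessian matrix of an integral polynomial at a point with coordinates in `K`. -/
def hessian {K : Type*} [Field K] {n : ℕ} (G : MvPolynomial (Fin n) ℤ) (x : Fin n → K) :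
    Matrix (Fin n) (Fin n) K :=
  Matrix.of fun j k => aeval x (pderiv j (pderiv k G))

/-- The projective variety `G₁ = ⋯ = G_r = 0` over `K`. -/
def variety (K : Type*) [Field K] {n r : ℕ} (G : Fin r → MvPolynomial (Fin n) ℤ) :
    Set (ProjSpace K n) :=
  {x | ∀ i, aeval x.coords (G i) = 0}

/-- The singular locus of `G₁ = ⋯ = G_r = 0` (of codimension `r`): the points of the variety
at which the Jacobian matrix with rows `∇Gᵢ(x)` has rank less than `r`. -/
def singularLocus (K : Type*) [Field K] {n r : ℕ} (G : Fin r → MvPolynomial (Fin n) ℤ) :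
    Set (ProjSpace K n) :=
  {x | x ∈ variety K G ∧ (Matrix.of fun i => gradient (G i) x.coords).rank < r}

/-- The condition on `(x, y)` that defines both `S` and its fibres: `y · ∇Gᵢ(x) = 0` for all `i`
and the `r × n` matrix with rows `y · ∇²Gᵢ(x)` has rank less than `r`. -/
def IsDegenerate {K : Type*} [Field K] {n r : ℕ} (G : Fin r → MvPolynomial (Fin n) ℤ)
    (x y : ProjSpace K n) : Prop :=
  (∀ i, y.coords ⬝ᵥ gradient (G i) x.coords = 0) ∧
    (Matrix.of fun i => Matrix.vecMul y.coords (hessian (G i) x.coords)).rank < r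

/-- The locus `S` of pairs `(x, y)`. -/
def locusS (K : Type*) [Field K] {n r : ℕ} (G : Fin r → MvPolynomial (Fin n) ℤ) :
    Set (BiProjSpace K n) :=
  {z | IsDegenerate G z.fst z.snd}

/-- The fibre `S_y`. -/
def fibreS {K : Type*} [Field K] {n r : ℕ} (G : Fin r → MvPolynomial (Fin n) ℤ)
    (y : ProjSpace K n) : Set (ProjSpace K n) :=
  {x | IsDegenerate G x y}

/-- The set `T_s` of all `y` with `dim S_y ≥ s`. -/
def locusT (K : Type*) [Field K] {n r : ℕ} (G : Fin r → MvPolynomial (Fin n) ℤ) (s : ℤ) :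
    Set (ProjSpace K n) :=
  {y | (s : WithTop ℤ) ≤ dimension (fibreS G y)}

end

end ProjGeom

/-! The heart of the matter is the diagonal. If `(x, x)` lies in `S`, Euler's identity turns `x ·
∇Gᵢ(x) = 0` into `dᵢ Gᵢ(x) = 0` and the rows `x · ∇²Gᵢ(x)` into `(dᵢ - 1) ∇Gᵢ(x)`. Since `p` does
not divide `dᵢ (dᵢ - 1)`, such an `x` is a singular point of `Z`
(`mem_singularLocus_of_isDegenerate`), so `S` misses the diagonal. A closed set of dimension at
least `n - 1` in the product cannot do so: its bicone has dimension at least `n + 1`, and the `n`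
equations `xᵢ = yᵢ` leave more than the origin (`HasChain.exists_mem_diagonal`). This gives (i).

For (ii), cut the part of `S` over `T_s` by `s` general hyperplanes in `x`. Every fibre over `T_s`
still has a point, so the cut set maps onto `T_s` and has at least its dimension, while each
hyperplane has lowered the dimension. Hence `dim T_s + s ≤ dim S` (`HasChain.locusS_of_locusT`).

For (iii), `dim S_y ≥ s` means that `S_y` meets every linear subspace of codimension `s`.
Eliminating `x` from these conditions with indeterminate coefficients over `ℤ`, and then demanding
that the eliminants vanish identically in the coefficients of the linear forms, gives finitely many
universal equations for `T_s`. Their degree in `y` depends on `n`, `r`, `s` and the `dᵢ` only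
(`exists_elimination`, `exists_degree_locusT`). It remains to prove a Bezout bound for a set `T`
defined in degree `D` (`sum_degree_components_le`), which is done by comparing Hilbert functions. An
irreducible set of dimension `k` with a linear section of `m` points has Hilbert function growing at
least like `m` linear spaces of dimension `k` (`card_mul_pow_le_hilbert`), and these contributions
add up over components. On the other hand the components of `T` of dimension `k` lie in a set
obtained from `n - 1 - k` forms of degree `D`, each of which lowers the order of growth by one at a
controlled cost (`exists_selectedUnion_bound`).

Throughout, dimension is handled as existence of chains of irreducible closed sets. Such chains
become chains of prime ideals of cones in a polynomial ring, where Krull's height theorem and the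
Nullstellensatz apply. Projective space and the product are treated together by grading the
variables in one block or two. -/

namespace ProjGeom

noncomputable section

/-! ### Multihomogeneous vanishing ideals and torus orbits -/

section Blocks

variable {σ τ K : Type*} [Field K]

/-- The orbit map `t ↦ f (t_{b i} v_i)` of a polynomial `f`, as a polynomial in the scaling
parameters. -/
def blockExpand (k : Type*) [CommRing k] [Algebra k K] (b : σ → τ) (v : σ → K) :
    MvPolynomial σ k →ₐ[k] MvPolynomial τ K :=
  aeval fun i => C (v i) * X (b i)

/-- The part of `f` of multidegree `e` with respect to the blocks of variables given by `b`. -/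
def blockComponent (k : Type*) [CommRing k] (b : σ → τ) (e : τ →₀ ℕ) :
    MvPolynomial σ k →ₗ[k] MvPolynomial σ k :=
  weightedHomogeneousComponent (fun i => Finsupp.single (b i) 1) e

/-- The substitution multiplies the value of each monomial by the monomial in the scaling parameters
that records its multidegree. This links vanishing along an orbit with vanishing of all
multihomogeneous parts at one point. -/
theorem coeff_blockExpand {k : Type*} [CommRing k] [Algebra k K] (b : σ → τ) (v : σ → K)
    (f : MvPolynomial σ k) (e : τ →₀ ℕ) :
    coeff e (blockExpand k b v f) = aeval v (blockComponent k b e f) := by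
  classical
  induction f using MvPolynomial.induction_on' with
  | add p q hp hq => simp [hp, hq]
  | monomial m r =>
    have h1 : blockExpand k b v (monomial m r) =
        monomial (Finsupp.weight (fun i => Finsupp.single (b i) 1) m) (aeval v (monomial m r)) := by
      rw [blockExpand, aeval_monomial, aeval_monomial, monomial_eq (R := K)]
      simp only [mul_pow, Finsupp.prod_mul, Finsupp.weight_apply]
      rw [map_mul, ← mul_assoc]
      congr 1
      · congr 1
        simp [Finsupp.prod, map_prod]
      · have : ∀ s : Finset σ, (∏ i ∈ s, X (b i) ^ m i : MvPolynomial τ K) =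
            monomial (∑ i ∈ s, m i • Finsupp.single (b i) 1) 1 := by
          intro s
          induction s using Finset.induction_on with
          | empty => simp
          | insert a s ha ih =>
            rw [Finset.prod_insert ha, Finset.sum_insert ha, ih, X_pow_eq_monomial, monomial_mul]
            simp
        rw [Finsupp.prod, this, monomial_eq]
        simp [Finsupp.sum]
    rw [h1, coeff_monomial, blockComponent, weightedHomogeneousComponent_apply]
    split_ifs with h
    · by_cases hr : r = 0
      · simp [hr]
      · simp [support_monomial, hr, Finset.filter_singleton, h]
    · by_cases hr : r = 0
      · simp [hr]
      · simp [support_monomial, hr, Finset.filter_singleton, h]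

theorem eval_blockExpand {k : Type*} [CommRing k] [Algebra k K] (b : σ → τ) (v : σ → K)
    (f : MvPolynomial σ k) (t : τ → K) :
    eval t (blockExpand k b v f) = aeval (fun i => t (b i) * v i) f := by
  have : ((aeval t : MvPolynomial τ K →ₐ[K] K).restrictScalars k).comp (blockExpand k b v) =
      aeval (fun i => t (b i) * v i) := by
    ext i
    simp [blockExpand, mul_comm]
  simpa using DFunLike.congr_fun this f

theorem blockExpand_eq_zero_iff [Infinite K] {k : Type*} [CommRing k] [Algebra k K] (b : σ → τ)
    (v : σ → K) (f : MvPolynomial σ k) :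
    blockExpand k b v f = 0 ↔ ∀ t : τ → K, aeval (fun i => t (b i) * v i) f = 0 := by
  refine ⟨fun h t => by rw [← eval_blockExpand, h, map_zero], fun h => ?_⟩
  exact MvPolynomial.funext fun t => by rw [eval_blockExpand, h, map_zero]

theorem blockExpand_eq_zero_iff_component {k : Type*} [CommRing k] [Algebra k K] (b : σ → τ)
    (v : σ → K) (f : MvPolynomial σ k) :
    blockExpand k b v f = 0 ↔ ∀ e, aeval v (blockComponent k b e f) = 0 := by
  simp_rw [← coeff_blockExpand, MvPolynomial.eq_zero_iff]

/-- The vanishing ideal of the torus orbit of `v`. -/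
def orbitIdeal (b : σ → τ) (v : σ → K) : Ideal (MvPolynomial σ K) :=
  RingHom.ker (blockExpand K b v)

theorem mem_orbitIdeal {b : σ → τ} {v : σ → K} {f : MvPolynomial σ K} :
    f ∈ orbitIdeal b v ↔ blockExpand K b v f = 0 := Iff.rfl

instance orbitIdeal_isPrime (b : σ → τ) (v : σ → K) : (orbitIdeal b v).IsPrime :=
  RingHom.ker_isPrime _

/-- The orbit of the origin is the origin, so this is the maximal ideal of the vertex of the cone.
-/
theorem mem_orbitIdeal_zero {b : σ → τ} {f : MvPolynomial σ K} :
    f ∈ orbitIdeal b (0 : σ → K) ↔ aeval (0 : σ → K) f = 0 := by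
  have h : ∀ f : MvPolynomial σ K, blockExpand K b 0 f = C (aeval (0 : σ → K) f) := by
    intro f
    rw [blockExpand, ← algebraMap_eq, ← aeval_algebraMap_apply]
    congr 2
    ext i
    simp
  rw [mem_orbitIdeal, h, C_eq_zero]

theorem orbitIdeal_le_scale [Infinite K] (b : σ → τ) (v : σ → K) (t : τ → K) :
    orbitIdeal b v ≤ orbitIdeal b (fun i => t (b i) * v i) := by
  intro f hf
  rw [mem_orbitIdeal, blockExpand_eq_zero_iff] at hf ⊢
  intro u
  simpa [mul_assoc] using hf (u * t)

theorem X_mem_orbitIdeal {b : σ → τ} {v : σ → K} {i : σ} : X i ∈ orbitIdeal b v ↔ v i = 0 := by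
  simp [mem_orbitIdeal, blockExpand]

/-- The vanishing ideal of the union of the torus orbits of the points of `T`. -/
def coneIdeal {P : Type*} (b : σ → τ) (c : P → σ → K) (T : Set P) : Ideal (MvPolynomial σ K) :=
  ⨅ x ∈ T, orbitIdeal b (c x)

theorem mem_coneIdeal {P : Type*} {b : σ → τ} {c : P → σ → K} {T : Set P} {f : MvPolynomial σ K} :
    f ∈ coneIdeal b c T ↔ ∀ x ∈ T, blockExpand K b (c x) f = 0 := by
  simp [coneIdeal, mem_orbitIdeal]

theorem coneIdeal_anti {P : Type*} {b : σ → τ} {c : P → σ → K} {S T : Set P} (h : S ⊆ T) :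
    coneIdeal b c T ≤ coneIdeal b c S := by
  intro f hf
  rw [mem_coneIdeal] at *
  exact fun x hx => hf x (h hx)

/-- A cone ideal contains the multihomogeneous parts of its members, so vanishing at `v` propagates
to the whole orbit of `v`. -/
theorem coneIdeal_le_orbitIdeal {P : Type*} {b : σ → τ} {c : P → σ → K} {T : Set P} {v : σ → K}
    (hv : ∀ f ∈ coneIdeal b c T, aeval v f = 0) : coneIdeal b c T ≤ orbitIdeal b v := by
  intro f hf
  rw [mem_orbitIdeal, blockExpand_eq_zero_iff_component]
  intro e
  apply hv
  rw [mem_coneIdeal] at *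
  intro x hx
  rw [blockExpand_eq_zero_iff_component]
  intro e'
  classical
  rw [blockComponent, blockComponent, weightedHomogeneousComponent_of_mem (n := e)
    (weightedHomogeneousComponent_mem _ f e)]
  split_ifs with h
  · exact (blockExpand_eq_zero_iff_component b _ f).1 (hf x hx) e
  · simp

/-- The map `c` gives multihomogeneous coordinates on the topological space `P`: its closed sets
are the zero sets of multihomogeneous polynomials. -/
structure IsConeCoords {P : Type*} [TopologicalSpace P] (b : σ → τ) (c : P → σ → K) : Prop where
  isClosed_zeros : ∀ f : MvPolynomial σ K, IsClosed {x | blockExpand K b (c x) f = 0}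
  exists_separating : ∀ T : Set P, IsClosed T → ∀ x ∉ T,
    ∃ f ∈ coneIdeal b c T, f ∉ orbitIdeal b (c x)

namespace IsConeCoords

variable {P : Type*} [TopologicalSpace P] {b : σ → τ} {c : P → σ → K}

theorem mem_of_le (h : IsConeCoords b c) {T : Set P} (hT : IsClosed T) {x : P}
    (hx : coneIdeal b c T ≤ orbitIdeal b (c x)) : x ∈ T := by
  by_contra hxT
  obtain ⟨f, hf, hf'⟩ := h.exists_separating T hT x hxT
  exact hf' (hx hf)

theorem le_of_coneIdeal_le (h : IsConeCoords b c) {S T : Set P} (hT : IsClosed T)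
    (hST : coneIdeal b c T ≤ coneIdeal b c S) : S ⊆ T := fun _ hx =>
  h.mem_of_le hT (hST.trans (iInf₂_le _ hx))

theorem isPrime_coneIdeal (h : IsConeCoords b c) {Z : Set P} (hZ : IsIrreducible Z) :
    (coneIdeal b c Z).IsPrime := by
  constructor
  · rw [Ideal.ne_top_iff_one, mem_coneIdeal]
    obtain ⟨x, hx⟩ := hZ.1
    intro h1
    simpa using h1 x hx
  · intro f g hfg
    simp only [mem_coneIdeal] at hfg ⊢
    exact isPreirreducible_iff_isClosed_union_isClosed.1 hZ.2 _ _ (h.isClosed_zeros f)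
      (h.isClosed_zeros g) fun x hx => mul_eq_zero.1 ((map_mul _ f g).symm.trans (hfg x hx))

theorem coneIdeal_lt (h : IsConeCoords b c) {S T : Set P} (hS : IsClosed S) (hST : S ⊂ T) :
    coneIdeal b c T < coneIdeal b c S :=
  lt_of_le_not_ge (coneIdeal_anti hST.1) fun hle => hST.2 (h.le_of_coneIdeal_le hS hle)

/-- Closed sets embed with reversed order into the ideals of a polynomial ring in finitely many
variables. -/
theorem noetherianSpace [Finite σ] (h : IsConeCoords b c) :
    TopologicalSpace.NoetherianSpace P := by
  have : WellFoundedLT (TopologicalSpace.Closeds P) := by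
    refine ⟨Subrelation.wf (r := InvImage (· > ·)
      fun T : TopologicalSpace.Closeds P => coneIdeal b c (T : Set P)) ?_
      (InvImage.wf _ wellFounded_gt)⟩
    intro S T hST
    exact h.coneIdeal_lt S.2 hST
  exact Iff.mpr ((TopologicalSpace.noetherianSpace_TFAE P).out 0 1) this

end IsConeCoords

/-- `Z` is irreducible and closed, and the top of a chain of `s + 1` irreducible closed sets. -/
def IsChainTop {P : Type*} [TopologicalSpace P] : ℕ → Set P → Prop
  | 0, Z => IsIrreducible Z ∧ IsClosed Z
  | s + 1, Z => IsIrreducible Z ∧ IsClosed Z ∧ ∃ Y, Y ⊂ Z ∧ IsChainTop s Y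

theorem IsChainTop.isIrreducible {P : Type*} [TopologicalSpace P] {s : ℕ} {Z : Set P}
    (h : IsChainTop s Z) : IsIrreducible Z := by
  cases s <;> exact h.1

theorem IsChainTop.isClosed {P : Type*} [TopologicalSpace P] {s : ℕ} {Z : Set P}
    (h : IsChainTop s Z) : IsClosed Z := by
  cases s
  · exact h.2
  · exact h.2.1

end Blocks

/-! ### Heights relative to an ideal -/

section Krull

variable {R : Type*} [CommRing R]

/-- The height of `J` in `R ⧸ I`. -/
def relHeight (I J : Ideal R) : ℕ∞ := (J.map (Ideal.Quotient.mk I)).height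

theorem isPrime_map_quotient {I J : Ideal R} [hJ : J.IsPrime] (h : I ≤ J) :
    (J.map (Ideal.Quotient.mk I)).IsPrime :=
  Ideal.map_isPrime_of_surjective Ideal.Quotient.mk_surjective (by simpa using h)

theorem comap_map_quotient {I J : Ideal R} (h : I ≤ J) :
    (J.map (Ideal.Quotient.mk I)).comap (Ideal.Quotient.mk I) = J := by
  rw [Ideal.comap_map_of_surjective _ Ideal.Quotient.mk_surjective, ← RingHom.ker_eq_comap_bot,
    Ideal.mk_ker, sup_eq_left.2 h]

theorem relHeight_mono {I J J' : Ideal R} (h : J ≤ J') : relHeight I J ≤ relHeight I J' :=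
  Ideal.height_mono (Ideal.map_mono h)

theorem relHeight_add_one_le {I J J' : Ideal R} [J.IsPrime] [J'.IsPrime] (hI : I ≤ J)
    (h : J < J') : relHeight I J + 1 ≤ relHeight I J' := by
  have := isPrime_map_quotient hI
  have := isPrime_map_quotient (hI.trans h.le)
  refine Ideal.height_add_one_le_of_lt_of_isPrime (lt_of_le_not_ge (Ideal.map_mono h.le) ?_)
  intro hle
  have := Ideal.comap_mono (f := Ideal.Quotient.mk I) hle
  rw [comap_map_quotient hI, comap_map_quotient (hI.trans h.le)] at this
  exact h.not_ge this

/-- **Krull's height theorem** relative to an ideal. -/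
theorem relHeight_le_card [IsNoetherianRing R] {I J : Ideal R} [J.IsPrime] (hI : I ≤ J)
    (F : Finset R) (hF : ∀ f ∈ F, f ∈ J)
    (hmin : ∀ Q : Ideal R, Q.IsPrime → I ≤ Q → (∀ f ∈ F, f ∈ Q) → Q ≤ J → J ≤ Q) :
    relHeight I J ≤ F.card := by
  classical
  have := isPrime_map_quotient hI
  have hmem : J.map (Ideal.Quotient.mk I) ∈
      (Ideal.span ((F.image (Ideal.Quotient.mk I) : Finset (R ⧸ I)) : Set (R ⧸ I))).minimalPrimes := by
    refine ⟨⟨this, ?_⟩, ?_⟩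
    · rw [Ideal.span_le]
      intro x hx
      simp only [Finset.coe_image, Set.mem_image] at hx
      obtain ⟨f, hf, rfl⟩ := hx
      exact Ideal.mem_map_of_mem _ (hF f hf)
    · rintro Q ⟨hQ, hQF⟩ hQJ
      rw [Ideal.map_le_iff_le_comap]
      have := hQ.comap (Ideal.Quotient.mk I)
      refine hmin _ this ?_ ?_ ?_
      · intro x hx
        rw [Ideal.mem_comap, Ideal.Quotient.eq_zero_iff_mem.2 hx]
        exact Q.zero_mem
      · intro f hf
        exact hQF (Ideal.subset_span (by simpa using ⟨f, hf, rfl⟩))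
      · refine (Ideal.comap_mono hQJ).trans ?_
        rw [comap_map_quotient hI]
  exact (Ideal.height_le_card_of_mem_minimalPrimes_span_finset hmem).trans
    (by exact_mod_cast Finset.card_image_le)

end Krull

/-! ### Chains of closed sets and heights of cone ideals -/

section Blocks

variable {σ τ K : Type*} [Field K] {P : Type*} [TopologicalSpace P] {b : σ → τ} {c : P → σ → K}

/-- Shrinking an irreducible closed set strictly enlarges its prime cone ideal, so each step of the
chain adds one to the height. The point `x` is taken in the smallest member of the chain. -/
theorem IsConeCoords.relHeight_chain (h : IsConeCoords b c) {I : Ideal (MvPolynomial σ K)} :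
    ∀ {s : ℕ} {Z : Set P}, IsChainTop s Z → I ≤ coneIdeal b c Z →
      ∃ x ∈ Z, relHeight I (coneIdeal b c Z) + s ≤ relHeight I (orbitIdeal b (c x))
  | 0, Z, hZ, _ => by
    obtain ⟨x, hx⟩ := hZ.1.1
    exact ⟨x, hx, by simpa [coneIdeal] using relHeight_mono (iInf₂_le x hx)⟩
  | s + 1, Z, hZ, hI => by
    obtain ⟨hirr, hcl, Y, hYZ, hY⟩ := hZ
    have hlt := h.coneIdeal_lt hY.isClosed hYZ
    have := h.isPrime_coneIdeal hirr
    have := h.isPrime_coneIdeal hY.isIrreducible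
    obtain ⟨x, hx, hle⟩ := h.relHeight_chain hY (hI.trans hlt.le)
    refine ⟨x, hYZ.1 hx, le_trans ?_ hle⟩
    push_cast
    rw [add_comm (s : ℕ∞) 1, ← add_assoc]
    gcongr
    exact relHeight_add_one_le hI hlt

/-- If the origin were the only common zero of `I` and `F`, the Nullstellensatz would make its ideal
minimal over them, and Krull's theorem would bound its height over `I` by the number of equations.
-/
theorem exists_common_zero [Finite σ] [IsAlgClosed K] {I : Ideal (MvPolynomial σ K)}
    (hI : I ≤ orbitIdeal b (0 : σ → K)) (F : Finset (MvPolynomial σ K))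
    (hF : ∀ f ∈ F, f ∈ orbitIdeal b (0 : σ → K))
    (hlt : (F.card : ℕ∞) < relHeight I (orbitIdeal b (0 : σ → K))) :
    ∃ v : σ → K, v ≠ 0 ∧ (∀ f ∈ I, aeval v f = 0) ∧ ∀ f ∈ F, aeval v f = 0 := by
  by_contra! hcon
  refine hlt.not_ge (relHeight_le_card hI F hF ?_)
  intro Q hQ hIQ hFQ _
  rw [← IsPrime.vanishingIdeal_zeroLocus (K := K) Q]
  intro f hf v hv
  by_cases hv0 : v = 0
  · subst hv0
    exact mem_orbitIdeal_zero.1 hf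
  · obtain ⟨g, hg, hne⟩ := hcon v hv0 fun f hf => hv f (hIQ hf)
    exact absurd (hv g (hFQ g hg)) hne

end Blocks

/-! ### Krull dimension through chains of irreducible closed sets -/

section Chains

variable {P Q : Type*} [TopologicalSpace P] [TopologicalSpace Q]

/-- `C` contains a chain of `s + 1` irreducible closed sets. -/
def HasChain (s : ℕ) (C : Set P) : Prop := ∃ Z ⊆ C, IsChainTop s Z

theorem HasChain.mono {s : ℕ} {C D : Set P} (h : HasChain s C) (hCD : C ⊆ D) : HasChain s D :=
  let ⟨Z, hZ, hs⟩ := h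
  ⟨Z, hZ.trans hCD, hs⟩

theorem IsChainTop.exists_lt {s : ℕ} {Z : Set P} (h : IsChainTop (s + 1) Z) :
    IsChainTop s Z := by
  induction s generalizing Z with
  | zero => exact ⟨h.1, h.2.1⟩
  | succ s ih =>
    obtain ⟨h1, h2, Y, hY, h3⟩ := h
    exact ⟨h1, h2, Y, hY, ih h3⟩

theorem IsChainTop.of_le {s t : ℕ} (hst : s ≤ t) {Z : Set P} (h : IsChainTop t Z) :
    IsChainTop s Z := by
  induction hst with
  | refl => exact h
  | step _ ih => exact ih h.exists_lt

theorem HasChain.of_le {s t : ℕ} (hst : s ≤ t) {C : Set P} (h : HasChain t C) : HasChain s C :=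
  let ⟨Z, hZ, hs⟩ := h
  ⟨Z, hZ, hs.of_le hst⟩

theorem IsIrreducible.isChainTop_closure {Z : Set P} (h : IsIrreducible Z) :
    IsChainTop 0 (closure Z) := ⟨isIrreducible_iff_closure.2 h, isClosed_closure⟩

theorem hasChain_zero_iff {C : Set P} (hC : IsClosed C) : HasChain 0 C ↔ C.Nonempty := by
  constructor
  · rintro ⟨Z, hZ, h⟩
    exact h.1.1.mono hZ
  · rintro ⟨x, hx⟩
    exact ⟨closure {x}, closure_minimal (by simpa using hx) hC,
      IsIrreducible.isChainTop_closure isIrreducible_singleton⟩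

theorem isChainTop_image_val {C : Set P} (hC : IsClosed C) {s : ℕ} {Z : Set C}
    (h : IsChainTop s Z) : IsChainTop s (Subtype.val '' Z) := by
  have h1 : ∀ {Z : Set C}, IsIrreducible Z → IsIrreducible (Subtype.val '' Z) := fun h =>
    h.image _ continuous_subtype_val.continuousOn
  have h2 : ∀ {Z : Set C}, IsClosed Z → IsClosed (Subtype.val '' Z) := fun h =>
    hC.isClosedEmbedding_subtypeVal.isClosedMap _ h
  induction s generalizing Z with
  | zero => exact ⟨h1 h.1, h2 h.2⟩
  | succ s ih =>
    obtain ⟨h3, h4, Y, hY, h5⟩ := h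
    exact ⟨h1 h3, h2 h4, _, (Subtype.val_injective.injOn.image_ssubset_image_iff
      (Set.subset_univ _) (Set.subset_univ _)).2 hY, ih h5⟩

theorem isIrreducible_preimage_val {C Z : Set P} (hZ : Z ⊆ C) (h : IsIrreducible Z) :
    IsIrreducible (Subtype.val ⁻¹' Z : Set C) := by
  refine ⟨?_, ?_⟩
  · obtain ⟨x, hx⟩ := h.1
    exact ⟨⟨x, hZ hx⟩, hx⟩
  · rintro u v hu hv ⟨x, hx, hxu⟩ ⟨y, hy, hyv⟩
    obtain ⟨u', hu', rfl⟩ := isOpen_induced_iff.1 hu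
    obtain ⟨v', hv', rfl⟩ := isOpen_induced_iff.1 hv
    obtain ⟨z, hz, hz'⟩ := h.2 u' v' hu' hv' ⟨x, hx, hxu⟩ ⟨y, hy, hyv⟩
    exact ⟨⟨z, hZ hz⟩, hz, hz'⟩

theorem isChainTop_preimage_val {C : Set P} {s : ℕ} {Z : Set P} (hZ : Z ⊆ C)
    (h : IsChainTop s Z) : IsChainTop s (Subtype.val ⁻¹' Z : Set C) := by
  have h2 : ∀ {Z : Set P}, IsClosed Z → IsClosed (Subtype.val ⁻¹' Z : Set C) := fun h =>
    h.preimage continuous_subtype_val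
  induction s generalizing Z with
  | zero => exact ⟨isIrreducible_preimage_val hZ h.1, h2 h.2⟩
  | succ s ih =>
    obtain ⟨h3, h4, Y, hY, h5⟩ := h
    refine ⟨isIrreducible_preimage_val hZ h3, h2 h4, _,
      ⟨Set.preimage_mono hY.1, fun hle => hY.2 fun x hx => ?_⟩,
      ih (hY.1.trans hZ) h5⟩
    exact hle (show (⟨x, hZ hx⟩ : C) ∈ _ from hx)

theorem isChainTop_iff_ltSeries {s : ℕ} {Z : TopologicalSpace.IrreducibleCloseds P} :
    IsChainTop s (Z : Set P) ↔
      ∃ l : LTSeries (TopologicalSpace.IrreducibleCloseds P), l.length = s ∧ l.last = Z := by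
  constructor
  · induction s generalizing Z with
    | zero => exact fun _ => ⟨RelSeries.singleton _ Z, rfl, rfl⟩
    | succ s ih =>
      rintro ⟨_, _, Y, hY, h⟩
      obtain ⟨l, hl, hlast⟩ := ih (Z := ⟨Y, h.isIrreducible, h.isClosed⟩) h
      refine ⟨l.snoc Z ?_, ?_, ?_⟩
      · rw [hlast]
        exact hY
      · simp [hl]
      · simp
  · rintro ⟨l, rfl, rfl⟩
    have : ∀ i (hi : i < l.length + 1), IsChainTop i (l ⟨i, hi⟩ : Set P) := by
      intro i
      induction i with
      | zero => exact fun hi => ⟨(l ⟨0, hi⟩).2, (l ⟨0, hi⟩).3⟩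
      | succ i ih =>
        intro hi
        refine ⟨(l ⟨i + 1, hi⟩).2, (l ⟨i + 1, hi⟩).3, _, ?_, ih (by omega)⟩
        exact l.strictMono (by simp)
    exact this l.length _

theorem natCast_le_topologicalKrullDim_iff {C : Set P} (hC : IsClosed C) (s : ℕ) :
    (s : WithBot ℕ∞) ≤ topologicalKrullDim C ↔ HasChain s C := by
  rw [topologicalKrullDim, Order.le_krullDim_iff]
  constructor
  · rintro ⟨l, hl⟩
    exact ⟨_, by simp, isChainTop_image_val hC (isChainTop_iff_ltSeries.2 ⟨l, hl, rfl⟩)⟩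
  · rintro ⟨Z, hZ, h⟩
    have := isChainTop_preimage_val hZ h
    obtain ⟨l, hl, -⟩ := isChainTop_iff_ltSeries
      (Z := ⟨Subtype.val ⁻¹' Z, this.isIrreducible, this.isClosed⟩).1 this
    exact ⟨l, hl⟩

theorem topologicalKrullDim_cases (C : Set P) :
    (topologicalKrullDim C = ⊥ ∧ dimension C = ((-1 : ℤ) : WithTop ℤ)) ∨
      (topologicalKrullDim C = ⊤ ∧ dimension C = ⊤) ∨
      ∃ m : ℕ, topologicalKrullDim C = (m : WithBot ℕ∞) ∧ dimension C = ((m : ℤ) : WithTop ℤ) := by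
  rw [dimension]
  generalize topologicalKrullDim C = d
  match d with
  | ⊥ => exact Or.inl ⟨rfl, rfl⟩
  | (⊤ : ℕ∞) => exact Or.inr (Or.inl ⟨rfl, rfl⟩)
  | ((m : ℕ) : ℕ∞) => exact Or.inr (Or.inr ⟨m, rfl, rfl⟩)

theorem natCast_le_dimension_iff {C : Set P} (hC : IsClosed C) (s : ℕ) :
    ((s : ℤ) : WithTop ℤ) ≤ dimension C ↔ HasChain s C := by
  rw [← natCast_le_topologicalKrullDim_iff hC]
  rcases topologicalKrullDim_cases C with ⟨h1, h2⟩ | ⟨h1, h2⟩ | ⟨m, h1, h2⟩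
  · rw [h1, h2, WithTop.coe_le_coe, le_bot_iff]
    exact ⟨fun h => by omega, fun h => absurd h (WithBot.natCast_ne_bot s)⟩
  · simp [h1, h2]
  · rw [h1, h2, WithTop.coe_le_coe]
    norm_cast

theorem neg_one_le_dimension (C : Set P) : ((-1 : ℤ) : WithTop ℤ) ≤ dimension C := by
  rcases topologicalKrullDim_cases C with ⟨h1, h2⟩ | ⟨h1, h2⟩ | ⟨m, h1, h2⟩
  · rw [h2]
  · simp [h2]
  · rw [h2, WithTop.coe_le_coe]
    omega

theorem eq_empty_of_dimension_eq_neg_one {C : Set P} (h : dimension C = (-1 : ℤ)) : C = ∅ := by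
  by_contra hne
  have : Nonempty (TopologicalSpace.IrreducibleCloseds C) := by
    obtain ⟨x, hx⟩ := Set.nonempty_iff_ne_empty.2 hne
    exact ⟨⟨closure {⟨x, hx⟩}, isIrreducible_iff_closure.2 isIrreducible_singleton,
      isClosed_closure⟩⟩
  rcases topologicalKrullDim_cases C with ⟨h1, h2⟩ | ⟨h1, h2⟩ | ⟨m, h1, h2⟩
  · exact (Order.krullDim_ne_bot_iff.2 this) h1
  · exact absurd (h2.symm.trans h) (WithTop.top_ne_coe)
  · rw [h2, WithTop.coe_inj] at h
    omega

theorem dimension_lt_natCast_iff {C : Set P} (hC : IsClosed C) (s : ℕ) :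
    dimension C ≤ (((s : ℤ) - 1 : ℤ) : WithTop ℤ) ↔ ¬ HasChain s C := by
  rw [← natCast_le_dimension_iff hC, not_le]
  induction dimension C using WithTop.recTopCoe with
  | top => simp
  | coe m =>
    rw [WithTop.coe_le_coe, WithTop.coe_lt_coe]
    omega

theorem dimension_eq_natCast {C : Set P} (hC : IsClosed C) {s : ℕ} (h : HasChain s C)
    (h' : ¬ HasChain (s + 1) C) : dimension C = ((s : ℤ) : WithTop ℤ) := by
  apply le_antisymm
  · rw [← dimension_lt_natCast_iff hC] at h'
    simpa using h'
  · exact (natCast_le_dimension_iff hC s).2 h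

theorem exists_irreducible_superset [TopologicalSpace.NoetherianSpace P] {C : Set P}
    (hC : IsClosed C) : ∃ S : Set (Set P), S.Finite ∧ (∀ Z ∈ S, IsClosed Z) ∧
      (∀ Z ∈ S, IsIrreducible Z) ∧ (∀ Z ∈ S, Z ⊆ C) ∧
      ∀ Y, IsIrreducible Y → Y ⊆ C → ∃ Z ∈ S, Y ⊆ Z := by
  obtain ⟨S, hfin, hcl, hirr, rfl⟩ :=
    TopologicalSpace.NoetherianSpace.exists_finite_set_isClosed_irreducible hC
  refine ⟨S, hfin, hcl, hirr, fun Z hZ => Set.subset_sUnion_of_mem hZ, fun Y hY hYS => ?_⟩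
  lift S to Finset (Set P) using hfin
  exact isIrreducible_iff_sUnion_isClosed.1 hY S hcl hYS

/-- An irreducible closed set in the image is covered by the closed images of finitely many
irreducible pieces of its preimage, so one piece maps onto it. The next member of the chain is then
lifted inside that piece, which keeps the lifts nested. -/
theorem exists_chain_lift [TopologicalSpace.NoetherianSpace P] {f : P → Q} (hf : Continuous f)
    (hf' : IsClosedMap f) : ∀ {s : ℕ} {Z : Set Q} {C : Set P}, IsChainTop s Z → IsClosed C →
      Z ⊆ f '' C → ∃ Y ⊆ C, IsChainTop s Y ∧ f '' Y = Z := by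
  have key : ∀ {Z : Set Q} {C : Set P}, IsIrreducible Z → IsClosed Z → IsClosed C →
      Z ⊆ f '' C → ∃ Y ⊆ C, IsIrreducible Y ∧ IsClosed Y ∧ f '' Y = Z := by
    intro Z C hZ hZc hC hZC
    obtain ⟨S, hfin, hcl, hirr, hsub, hsup⟩ :=
      exists_irreducible_superset (hC.inter (hZc.preimage hf))
    lift S to Finset (Set P) using hfin
    classical
    obtain ⟨W, hW, hZW⟩ := isIrreducible_iff_sUnion_isClosed.1 hZ (S.image (f '' ·))
      (by
        intro W hW
        obtain ⟨Y, hY, rfl⟩ := Finset.mem_image.1 hW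
        exact hf' _ (hcl Y hY))
      (by
        intro z hz
        obtain ⟨x, hx, rfl⟩ := hZC hz
        obtain ⟨Y, hY, hxY⟩ := hsup {x} isIrreducible_singleton (by simpa using ⟨hx, hz⟩)
        exact ⟨f '' Y, by simpa using ⟨Y, hY, rfl⟩, x, hxY rfl, rfl⟩)
    obtain ⟨Y, hY, rfl⟩ := Finset.mem_image.1 hW
    refine ⟨Y, fun y hy => (hsub Y hY hy).1, hirr Y hY, hcl Y hY, subset_antisymm ?_ hZW⟩
    rintro _ ⟨y, hy, rfl⟩
    exact (hsub Y hY hy).2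
  intro s
  induction s with
  | zero =>
    intro Z C hZ hC hZC
    obtain ⟨Y, hYC, h1, h2, h3⟩ := key hZ.1 hZ.2 hC hZC
    exact ⟨Y, hYC, ⟨h1, h2⟩, h3⟩
  | succ s ih =>
    intro Z C hZ hC hZC
    obtain ⟨hZ1, hZ2, Z', hZ', hch⟩ := hZ
    obtain ⟨Y, hYC, h1, h2, h3⟩ := key hZ1 hZ2 hC hZC
    obtain ⟨Y', hY', h4, h5⟩ := ih hch h2 (h3 ▸ hZ'.1)
    refine ⟨Y, hYC, ⟨h1, h2, Y', ⟨hY', fun hle => hZ'.2 ?_⟩, h4⟩, h3⟩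
    rw [← h3, ← h5]
    exact Set.image_mono hle

/-- A closed set that contains none of the components of `C` cuts `C` down. -/
theorem HasChain.of_inter {S : Set (Set P)} {C H : Set P}
    (hirr : ∀ Z ∈ S, IsIrreducible Z) (hcl : ∀ Z ∈ S, IsClosed Z) (hsub : ∀ Z ∈ S, Z ⊆ C)
    (hsup : ∀ Y, IsIrreducible Y → Y ⊆ C → ∃ Z ∈ S, Y ⊆ Z) (hH : ∀ Z ∈ S, ¬ Z ⊆ H) {s : ℕ}
    (h : HasChain s (C ∩ H)) : HasChain (s + 1) C := by
  obtain ⟨Y, hY, hs⟩ := h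
  obtain ⟨Z, hZ, hYZ⟩ := hsup Y hs.isIrreducible fun y hy => (hY hy).1
  exact ⟨Z, hsub Z hZ, hirr Z hZ, hcl Z hZ, Y,
    ⟨hYZ, fun hle => hH Z hZ fun z hz => (hY (hle hz)).2⟩, hs⟩

end Chains

/-! ### The Zariski topologies in multihomogeneous coordinates -/

section Coordinates

variable {K : Type*} [Field K] {n : ℕ}

theorem isClosed_iff_isClosedOver {T : Set (ProjSpace K n)} : IsClosed T ↔ IsClosedOver K T := by
  rw [← isOpen_compl_iff]
  change Tᶜᶜ ∈ {T | IsClosedOver K T} ↔ _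
  rw [compl_compl]
  rfl

theorem isClosed_iff_isBiClosedOver {T : Set (BiProjSpace K n)} :
    IsClosed T ↔ IsBiClosedOver K T := by
  rw [← isOpen_compl_iff]
  change Tᶜᶜ ∈ {T | IsBiClosedOver K T} ↔ _
  rw [compl_compl]
  rfl

/-- All variables form one block. -/
def projBlock (n : ℕ) : Fin n → Unit := fun _ => ()

/-- The variables of the two factors form two blocks. -/
def biBlock (n : ℕ) : Fin n ⊕ Fin n → Bool := Sum.elim (fun _ => false) (fun _ => true)

theorem blockExpand_eq_zero_iff_of_homogeneous {σ τ : Type*} {k : Type*} [CommRing k]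
    [Algebra k K] {b : σ → τ} {v : σ → K} {f : MvPolynomial σ k} {e : τ →₀ ℕ}
    (hf : IsWeightedHomogeneous (fun i => Finsupp.single (b i) 1 : σ → τ →₀ ℕ) f e) :
    blockExpand k b v f = 0 ↔ aeval v f = 0 := by
  classical
  rw [blockExpand_eq_zero_iff_component]
  constructor
  · intro h
    simpa [blockComponent, weightedHomogeneousComponent_of_mem (m := e) (n := e) hf] using h e
  · intro h e'
    rw [blockComponent, weightedHomogeneousComponent_of_mem (m := e') (n := e) hf]
    split_ifs
    · exact h
    · simp

theorem blockExpand_scale_eq_zero_iff [Infinite K] {σ τ : Type*} {k : Type*} [CommRing k]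
    [Algebra k K] {b : σ → τ} {v w : σ → K} {t : τ → K} (ht : ∀ j, t j ≠ 0)
    (h : ∀ i, w i = t (b i) * v i) (f : MvPolynomial σ k) :
    blockExpand k b w f = 0 ↔ blockExpand k b v f = 0 := by
  rw [blockExpand_eq_zero_iff, blockExpand_eq_zero_iff]
  constructor
  · intro hf u
    have := hf (fun j => u j * (t j)⁻¹)
    simpa [h, ht, mul_assoc] using this
  · intro hf u
    have := hf (u * t)
    simpa [h, mul_assoc] using this

theorem weight_projBlock (d : Fin n →₀ ℕ) :
    Finsupp.weight (fun i => Finsupp.single (projBlock n i) 1 : Fin n → Unit →₀ ℕ) d =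
      Finsupp.single () d.degree := by
  rw [Finsupp.weight_apply]
  ext
  simp [Finsupp.sum, Finsupp.degree_apply, projBlock]

theorem isWeightedHomogeneous_projBlock {k : Type*} [CommRing k] {f : MvPolynomial (Fin n) k}
    {m : ℕ} : IsWeightedHomogeneous
      (fun i => Finsupp.single (projBlock n i) 1 : Fin n → Unit →₀ ℕ) f (Finsupp.single () m) ↔
      f.IsHomogeneous m := by
  refine forall_congr' fun d => imp_congr_right fun _ => ?_
  rw [weight_projBlock, Finsupp.degree_eq_weight_one]
  exact (Finsupp.single_injective ()).eq_iff

theorem isWeightedHomogeneous_biBlock {k : Type*} [CommRing k]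
    {f : MvPolynomial (Fin n ⊕ Fin n) k} {e : Bool →₀ ℕ} : IsWeightedHomogeneous
      (fun i => Finsupp.single (biBlock n i) 1 : Fin n ⊕ Fin n → Bool →₀ ℕ) f e ↔
      IsBihomogeneous f (e false) (e true) := by
  have hw : ∀ d : Fin n ⊕ Fin n →₀ ℕ,
      Finsupp.weight (fun i => Finsupp.single (biBlock n i) 1 : Fin n ⊕ Fin n → Bool →₀ ℕ) d = e ↔
        Finsupp.weight (Sum.elim (fun _ => 1) (fun _ => 0) : Fin n ⊕ Fin n → ℕ) d = e false ∧
        Finsupp.weight (Sum.elim (fun _ => 0) (fun _ => 1) : Fin n ⊕ Fin n → ℕ) d = e true := by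
    intro d
    rw [Finsupp.ext_iff, Bool.forall_bool]
    simp only [Finsupp.weight_apply, Finsupp.sum_fintype, zero_smul, implies_true]
    simp [biBlock]
  constructor
  · intro h
    exact ⟨fun d hd => ((hw d).1 (h hd)).1, fun d hd => ((hw d).1 (h hd)).2⟩
  · intro h d hd
    exact (hw d).2 ⟨h.1 hd, h.2 hd⟩

/-- `T` is the zero set of homogeneous polynomials over `k` of degrees at most `D`. -/
def IsZeroSetOfDegree (k : Type*) [CommRing k] [Algebra k K] (D : ℕ) (T : Set (ProjSpace K n)) :
    Prop :=
  ∃ A : Set (MvPolynomial (Fin n) k), (∀ f ∈ A, ∃ m ≤ D, f.IsHomogeneous m) ∧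
    T = {x | ∀ f ∈ A, aeval x.coords f = 0}

theorem IsZeroSetOfDegree.isClosedOver {k : Type*} [CommRing k] [Algebra k K] {D : ℕ}
    {T : Set (ProjSpace K n)} (h : IsZeroSetOfDegree k D T) : IsClosedOver k T := by
  obtain ⟨A, hA, rfl⟩ := h
  exact ⟨A, fun f hf => let ⟨m, _, hm⟩ := hA f hf; ⟨m, hm⟩, rfl⟩

theorem IsZeroSetOfDegree.baseChange {k : Type*} [CommRing k] [Algebra k K] {D : ℕ}
    {T : Set (ProjSpace K n)} (h : IsZeroSetOfDegree k D T) : IsZeroSetOfDegree K D T := by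
  obtain ⟨A, hA, rfl⟩ := h
  refine ⟨MvPolynomial.map (algebraMap k K) '' A, ?_, ?_⟩
  · rintro _ ⟨f, hf, rfl⟩
    obtain ⟨m, hm, h⟩ := hA f hf
    exact ⟨m, hm, h.map _⟩
  · ext x
    simp only [Set.mem_ofPred_eq, Set.forall_mem_image, aeval_map_algebraMap]

theorem isHomogeneous_blockComponent {k : Type*} [CommRing k] (e : Unit →₀ ℕ)
    (f : MvPolynomial (Fin n) k) :
    (blockComponent k (projBlock n) e f).IsHomogeneous (e ()) := by
  rw [← isWeightedHomogeneous_projBlock]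
  have : Finsupp.single () (e ()) = e := by ext; simp
  rw [this]
  exact weightedHomogeneousComponent_isWeightedHomogeneous e f

theorem isZeroSetOfDegree_blockExpand {k : Type*} [CommRing k] [Algebra k K] {D : ℕ}
    (A : Set (MvPolynomial (Fin n) k)) (hA : ∀ f ∈ A, f.totalDegree ≤ D) :
    IsZeroSetOfDegree k D
      {x : ProjSpace K n | ∀ f ∈ A, blockExpand k (projBlock n) x.coords f = 0} := by
  refine ⟨{g | ∃ f ∈ A, ∃ e, g = blockComponent k (projBlock n) e f}, ?_, ?_⟩
  · rintro _ ⟨f, hf, e, rfl⟩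
    by_cases h0 : blockComponent k (projBlock n) e f = 0
    · exact ⟨0, Nat.zero_le _, by rw [h0]; exact isHomogeneous_zero _ _ _⟩
    · refine ⟨e (), ?_, isHomogeneous_blockComponent e f⟩
      classical
      obtain ⟨d, hd⟩ := ne_zero_iff.1 h0
      rw [blockComponent, coeff_weightedHomogeneousComponent, weight_projBlock] at hd
      split_ifs at hd with h1
      · rw [← h1]
        refine le_trans ?_ (hA f hf)
        simpa [Finsupp.degree_apply, Finsupp.sum] using le_totalDegree (mem_support_iff.2 hd)
      · exact absurd rfl hd
  · ext x
    simp only [Set.mem_ofPred_eq, blockExpand_eq_zero_iff_component]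
    constructor
    · rintro h _ ⟨f, hf, e, rfl⟩
      exact h f hf e
    · intro h f hf e
      exact h _ ⟨f, hf, e, rfl⟩

/-- Vanishing along whole orbits is vanishing of all homogeneous parts, so arbitrary polynomials
over `k` may be used to show that a set is closed over `k`. -/
theorem isClosedOver_blockExpand {k : Type*} [CommRing k] [Algebra k K]
    (A : Set (MvPolynomial (Fin n) k)) :
    IsClosedOver k {x : ProjSpace K n | ∀ f ∈ A, blockExpand k (projBlock n) x.coords f = 0} := by
  refine ⟨{g | ∃ f ∈ A, ∃ e, g = blockComponent k (projBlock n) e f}, ?_, ?_⟩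
  · rintro _ ⟨f, hf, e, rfl⟩
    exact ⟨_, isHomogeneous_blockComponent e f⟩
  · ext x
    simp only [Set.mem_ofPred_eq, blockExpand_eq_zero_iff_component]
    constructor
    · rintro h _ ⟨f, hf, e, rfl⟩
      exact h f hf e
    · intro h f hf e
      exact h _ ⟨f, hf, e, rfl⟩

theorem isBiClosedOver_blockExpand {k : Type*} [CommRing k] [Algebra k K]
    (A : Set (MvPolynomial (Fin n ⊕ Fin n) k)) :
    IsBiClosedOver k {z : BiProjSpace K n | ∀ f ∈ A, blockExpand k (biBlock n) z.coords f = 0} := by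
  refine ⟨{g | ∃ f ∈ A, ∃ e, g = blockComponent k (biBlock n) e f}, ?_, ?_⟩
  · rintro _ ⟨f, hf, e, rfl⟩
    exact ⟨_, _, isWeightedHomogeneous_biBlock.1
      (weightedHomogeneousComponent_isWeightedHomogeneous e f)⟩
  · ext x
    simp only [Set.mem_ofPred_eq, blockExpand_eq_zero_iff_component]
    constructor
    · rintro h _ ⟨f, hf, e, rfl⟩
      exact h f hf e
    · intro h f hf e
      exact h _ ⟨f, hf, e, rfl⟩

theorem isConeCoords_proj : IsConeCoords (projBlock n) (ProjSpace.coords (K := K) (n := n)) where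
  isClosed_zeros f := by
    rw [isClosed_iff_isClosedOver]
    simpa using isClosedOver_blockExpand (K := K) {f}
  exists_separating T hT x hx := by
    obtain ⟨A, hA, rfl⟩ := isClosed_iff_isClosedOver.1 hT
    simp only [Set.mem_ofPred_eq, not_forall] at hx
    obtain ⟨f, hf, hfx⟩ := hx
    obtain ⟨m, hm⟩ := hA f hf
    have := isWeightedHomogeneous_projBlock.2 hm
    refine ⟨f, ?_, ?_⟩
    · rw [mem_coneIdeal]
      intro y hy
      exact (blockExpand_eq_zero_iff_of_homogeneous this).2 (hy f hf)
    · rwa [mem_orbitIdeal, blockExpand_eq_zero_iff_of_homogeneous this]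

theorem isConeCoords_biProj :
    IsConeCoords (biBlock n) (BiProjSpace.coords (K := K) (n := n)) where
  isClosed_zeros f := by
    rw [isClosed_iff_isBiClosedOver]
    simpa using isBiClosedOver_blockExpand (K := K) {f}
  exists_separating T hT x hx := by
    obtain ⟨A, hA, rfl⟩ := isClosed_iff_isBiClosedOver.1 hT
    simp only [Set.mem_ofPred_eq, not_forall] at hx
    obtain ⟨f, hf, hfx⟩ := hx
    obtain ⟨a, b, hab⟩ := hA f hf
    have : IsWeightedHomogeneous
        (fun i => Finsupp.single (biBlock n i) 1 : Fin n ⊕ Fin n → Bool →₀ ℕ) f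
        (Finsupp.single false a + Finsupp.single true b) := by
      rw [isWeightedHomogeneous_biBlock]
      simpa using hab
    refine ⟨f, ?_, ?_⟩
    · rw [mem_coneIdeal]
      intro y hy
      exact (blockExpand_eq_zero_iff_of_homogeneous this).2 (hy f hf)
    · rwa [mem_orbitIdeal, blockExpand_eq_zero_iff_of_homogeneous this]

instance : TopologicalSpace.NoetherianSpace (ProjSpace K n) :=
  isConeCoords_proj.noetherianSpace

instance : TopologicalSpace.NoetherianSpace (BiProjSpace K n) :=
  isConeCoords_biProj.noetherianSpace

theorem ProjSpace.coords_ne_zero (x : ProjSpace K n) : x.coords ≠ 0 := Projectivization.rep_nonzero x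

/-- The point with given homogeneous coordinates. -/
def projPoint (v : Fin n → K) (hv : v ≠ 0) : ProjSpace K n := Projectivization.mk K v hv

theorem exists_coords_projPoint (v : Fin n → K) (hv : v ≠ 0) :
    ∃ a : K, a ≠ 0 ∧ (projPoint v hv).coords = a • v := by
  obtain ⟨a, ha⟩ := Projectivization.exists_smul_eq_mk_rep K v hv
  exact ⟨a, a.ne_zero, ha.symm⟩

theorem ProjSpace.eq_of_coords {x y : ProjSpace K n} {a : K} (h : x.coords = a • y.coords) :
    x = y := by
  have := (Projectivization.mk_eq_mk_iff' K _ _ (Projectivization.rep_nonzero (K := K) x)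
    (Projectivization.rep_nonzero (K := K) y)).2 ⟨a, h.symm⟩
  exact (Projectivization.mk_rep x).symm.trans (this.trans (Projectivization.mk_rep y))

theorem continuous_fst [Infinite K] : Continuous (BiProjSpace.fst (K := K) (n := n)) := by
  rw [continuous_iff_isClosed]
  intro T hT
  obtain ⟨A, hA, rfl⟩ := isClosed_iff_isClosedOver.1 hT
  rw [isClosed_iff_isBiClosedOver]
  convert isBiClosedOver_blockExpand (K := K) (n := n) (rename Sum.inl '' A) using 1
  ext z
  simp only [Set.mem_preimage, Set.mem_ofPred_eq, Set.forall_mem_image]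
  refine forall₂_congr fun f hf => ?_
  obtain ⟨m, hm⟩ := hA f hf
  rw [← blockExpand_eq_zero_iff_of_homogeneous (isWeightedHomogeneous_projBlock.2 hm),
    blockExpand_eq_zero_iff, blockExpand_eq_zero_iff]
  simp only [aeval_rename]
  constructor
  · exact fun h t => h (fun _ => t false)
  · exact fun h t => h (fun _ => t ())

theorem continuous_snd [Infinite K] : Continuous (BiProjSpace.snd (K := K) (n := n)) := by
  rw [continuous_iff_isClosed]
  intro T hT
  obtain ⟨A, hA, rfl⟩ := isClosed_iff_isClosedOver.1 hT
  rw [isClosed_iff_isBiClosedOver]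
  convert isBiClosedOver_blockExpand (K := K) (n := n) (rename Sum.inr '' A) using 1
  ext z
  simp only [Set.mem_preimage, Set.mem_ofPred_eq, Set.forall_mem_image]
  refine forall₂_congr fun f hf => ?_
  obtain ⟨m, hm⟩ := hA f hf
  rw [← blockExpand_eq_zero_iff_of_homogeneous (isWeightedHomogeneous_projBlock.2 hm),
    blockExpand_eq_zero_iff, blockExpand_eq_zero_iff]
  simp only [aeval_rename]
  constructor
  · exact fun h t => h (fun _ => t true)
  · exact fun h t => h (fun _ => t ())

end Coordinates

/-! ### Hyperplane sections, the dimension theorem and the diagonal -/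

section Sections

variable {K : Type*} [Field K] {n : ℕ}

/-- The linear form with coefficient vector `a`. -/
def linForm (a : Fin n → K) : MvPolynomial (Fin n) K := ∑ i, C (a i) * X i

@[simp]
theorem aeval_linForm (a v : Fin n → K) : aeval v (linForm a) = a ⬝ᵥ v := by
  simp [linForm, dotProduct]

theorem isHomogeneous_linForm (a : Fin n → K) : (linForm a).IsHomogeneous 1 :=
  IsHomogeneous.sum _ _ _ fun i _ => isHomogeneous_C_mul_X _ i

theorem isClosed_zeros_of_isHomogeneous {f : MvPolynomial (Fin n) K} {m : ℕ}
    (hf : f.IsHomogeneous m) : IsClosed {x : ProjSpace K n | aeval x.coords f = 0} := by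
  rw [isClosed_iff_isClosedOver]
  exact ⟨{f}, by simpa using ⟨m, hf⟩, by simp⟩

theorem isClosed_hyperplane (a : Fin n → K) :
    IsClosed {x : ProjSpace K n | a ⬝ᵥ x.coords = 0} := by
  simpa using isClosed_zeros_of_isHomogeneous (isHomogeneous_linForm a)

theorem exists_forall_dotProduct_ne_zero [Infinite K] {ι : Type*} [Finite ι] (v : ι → Fin n → K)
    (hv : ∀ i, v i ≠ 0) : ∃ a : Fin n → K, ∀ i, a ⬝ᵥ v i ≠ 0 := by
  obtain ⟨f, hf⟩ := Module.exists_dual_forall_apply_ne_zero (K := K) v hv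
  refine ⟨fun j => f (Pi.single j 1), fun i => ?_⟩
  convert hf i using 1
  conv_rhs => rw [← Finset.univ_sum_single (v i), map_sum]
  refine Finset.sum_congr rfl fun j _ => ?_
  have : (Pi.single j (v i j) : Fin n → K) = v i j • Pi.single j 1 := by
    rw [← Pi.single_smul, smul_eq_mul, mul_one]
  rw [this, map_smul, smul_eq_mul, mul_comm]

section Cut

variable [Infinite K] {P : Type*} [TopologicalSpace P] [TopologicalSpace.NoetherianSpace P]

/-- The hyperplane is chosen to avoid the image of one point on each of finitely many irreducible
pieces of the `C i`. It then contains none of the pieces, and each chain in the section extends by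
the piece above it. -/
theorem exists_hyperplane {ι : Type*} [Finite ι] (π : P → ProjSpace K n) (C : ι → Set P)
    (hC : ∀ i, IsClosed (C i)) : ∃ a : Fin n → K, ∀ i s,
      HasChain s (C i ∩ {z | a ⬝ᵥ (π z).coords = 0}) → HasChain (s + 1) (C i) := by
  choose S hfin hcl hirr hsub hsup using fun i => exists_irreducible_superset (hC i)
  have : ∀ i, Finite (S i) := fun i => (hfin i).to_subtype
  have hne : ∀ z : Σ i, S i, ∃ x, x ∈ (z.2 : Set P) := fun z => (hirr z.1 _ z.2.2).1
  choose p hp using hne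
  obtain ⟨a, ha⟩ := exists_forall_dotProduct_ne_zero
    (fun z : Σ i, S i => (π (p z)).coords) fun z => (π (p z)).coords_ne_zero
  exact ⟨a, fun i s h => HasChain.of_inter (hirr i) (hcl i) (hsub i) (hsup i)
    (fun Z hZ hle => ha ⟨i, Z, hZ⟩ (hle (hp ⟨i, Z, hZ⟩))) h⟩

theorem exists_hyperplanes {ι : Type*} [Finite ι] {π : P → ProjSpace K n} (hπ : Continuous π)
    (k : ℕ) : ∀ (C : ι → Set P), (∀ i, IsClosed (C i)) → ∃ a : Fin k → Fin n → K, ∀ i s,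
      HasChain s (C i ∩ {z | ∀ j, a j ⬝ᵥ (π z).coords = 0}) → HasChain (s + k) (C i) := by
  induction k with
  | zero =>
    intro C _
    exact ⟨Fin.elim0, fun i s h => h.mono Set.inter_subset_left⟩
  | succ k ih =>
    intro C hC
    obtain ⟨a, ha⟩ := exists_hyperplane π C hC
    obtain ⟨a', ha'⟩ := ih (fun i => C i ∩ {z | a ⬝ᵥ (π z).coords = 0})
      fun i => (hC i).inter ((isClosed_hyperplane a).preimage hπ)
    refine ⟨Fin.cons a a', fun i s h => ha i _ (ha' i s (h.mono ?_))⟩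
    rintro z ⟨hz, hz'⟩
    exact ⟨⟨hz, hz' 0⟩, fun j => hz' j.succ⟩

end Cut

/-- Degenerating the scaling parameters shrinks the orbit closure, and the variable `X i` witnesses
that it does so strictly. With some parameters set to zero this supplies the steps from a point to
the vertex of the cone. -/
theorem orbitIdeal_lt_of_scale [Infinite K] {σ τ : Type*} {b : σ → τ} {v w : σ → K} {t : τ → K}
    (h : ∀ i, w i = t (b i) * v i) {i : σ} (hi : v i ≠ 0) (hi' : w i = 0) :
    orbitIdeal b v < orbitIdeal b w := by
  obtain rfl : w = fun i => t (b i) * v i := funext h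
  exact lt_of_le_not_ge (orbitIdeal_le_scale b v t) fun hle =>
    hi (X_mem_orbitIdeal.1 (hle (X_mem_orbitIdeal.2 hi')))

theorem projPoint_mem [Infinite K] {Z : Set (ProjSpace K n)} (hZ : IsClosed Z) {v : Fin n → K}
    (hv : v ≠ 0)
    (h : ∀ f ∈ coneIdeal (projBlock n) (ProjSpace.coords (K := K)) Z, aeval v f = 0) :
    projPoint v hv ∈ Z := by
  obtain ⟨a, -, ha⟩ := exists_coords_projPoint v hv
  refine isConeCoords_proj.mem_of_le hZ ((coneIdeal_le_orbitIdeal h).trans ?_)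
  rw [ha]
  exact orbitIdeal_le_scale (projBlock n) v fun _ => a

/-- The dimension theorem for intersections with hypersurfaces. -/
theorem HasChain.exists_common_zero [IsAlgClosed K] {C : Set (ProjSpace K n)}
    {s : ℕ} (h : HasChain s C) (F : Finset (MvPolynomial (Fin n) K))
    (hF : ∀ f ∈ F, aeval (0 : Fin n → K) f = 0) (hs : F.card ≤ s) :
    ∃ (v : Fin n → K) (hv : v ≠ 0), projPoint v hv ∈ C ∧ ∀ f ∈ F, aeval v f = 0 := by
  have : Infinite K := IsAlgClosed.instInfinite
  obtain ⟨Z, hZC, hZ⟩ := h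
  set I := coneIdeal (projBlock n) (ProjSpace.coords (K := K)) Z with hI
  obtain ⟨x, hx, hle⟩ := isConeCoords_proj.relHeight_chain hZ (I := I) le_rfl
  have hxI : I ≤ orbitIdeal (projBlock n) x.coords := iInf₂_le x hx
  obtain ⟨i, hi⟩ : ∃ i, x.coords i ≠ 0 := Function.ne_iff.1 x.coords_ne_zero
  have hlt : orbitIdeal (projBlock n) x.coords < orbitIdeal (projBlock n) (0 : Fin n → K) :=
    orbitIdeal_lt_of_scale (t := 0) (by simp) hi rfl
  -- The vertex adds one step to the chain, so its height over `I` is at least `s + 1`, more than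
  -- the number of equations.
  have h1 := relHeight_add_one_le hxI hlt
  obtain ⟨v, hv, hvI, hvF⟩ := ProjGeom.exists_common_zero (b := projBlock n) (hxI.trans hlt.le) F
    (fun f hf => mem_orbitIdeal_zero.2 (hF f hf)) (by
      refine lt_of_lt_of_le ?_ h1
      refine (ENat.add_one_le_iff (ENat.natCast_ne_top _)).1 (add_le_add_left ?_ 1)
      exact le_trans (by exact_mod_cast hs) (le_trans le_add_self hle))
  exact ⟨v, hv, hZC (projPoint_mem hZ.isClosed hv hvI), hvF⟩

theorem HasChain.exists_mem_of_linear [IsAlgClosed K] {C : Set (ProjSpace K n)} {s : ℕ}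
    (h : HasChain s C) (a : Fin s → Fin n → K) : ∃ x ∈ C, ∀ j, a j ⬝ᵥ x.coords = 0 := by
  classical
  obtain ⟨v, hv, hvC, hF⟩ := h.exists_common_zero (Finset.univ.image fun j => linForm (a j))
    (by simp [linForm]) (Finset.card_image_le.trans (by simp))
  obtain ⟨c, -, hc⟩ := exists_coords_projPoint v hv
  refine ⟨_, hvC, fun j => ?_⟩
  rw [hc, dotProduct_smul]
  have := hF (linForm (a j)) (by simp)
  rw [aeval_linForm] at this
  rw [this, smul_zero]

theorem exists_linear_of_not_hasChain [Infinite K] {ι : Type*} [Finite ι]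
    {C : ι → Set (ProjSpace K n)} (hC : ∀ i, IsClosed (C i)) {s : ℕ}
    (h : ∀ i, ¬ HasChain s (C i)) :
    ∃ a : Fin s → Fin n → K, ∀ i, ∀ x ∈ C i, ¬ ∀ j, a j ⬝ᵥ x.coords = 0 := by
  obtain ⟨a, ha⟩ := exists_hyperplanes continuous_id s C hC
  refine ⟨a, fun i x hx hax => h i ?_⟩
  have := ha i 0 ((hasChain_zero_iff ?_).2 ⟨x, hx, hax⟩)
  · simpa using this
  · refine (hC i).inter ?_
    simp only [id, Set.ofPred_forall]
    exact isClosed_iInter fun j => isClosed_hyperplane (a j)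

/-- Dimension at least `s` becomes a statement about meeting all linear subspaces cut out by `s`
equations; in this form it can be eliminated. -/
theorem hasChain_iff_forall_linear [IsAlgClosed K] {C : Set (ProjSpace K n)} (hC : IsClosed C)
    {s : ℕ} : HasChain s C ↔ ∀ a : Fin s → Fin n → K, ∃ x ∈ C, ∀ j, a j ⬝ᵥ x.coords = 0 := by
  have : Infinite K := IsAlgClosed.instInfinite
  refine ⟨fun h => h.exists_mem_of_linear, fun h => ?_⟩
  by_contra hcon
  obtain ⟨a, ha⟩ := exists_linear_of_not_hasChain (ι := Unit) (C := fun _ => C) (fun _ => hC)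
    (fun _ => hcon)
  obtain ⟨x, hx, hx'⟩ := h a
  exact ha () x hx hx'

theorem not_hasChain_n [IsAlgClosed K] (C : Set (ProjSpace K n)) : ¬ HasChain n C := by
  intro h
  obtain ⟨x, -, hx⟩ := h.exists_mem_of_linear fun j => Pi.single j 1
  exact x.coords_ne_zero (funext fun j => by simpa using hx j)

/-- A closed subset of the product of dimension at least `n - 1` meets the diagonal. -/
theorem HasChain.exists_mem_diagonal [IsAlgClosed K] {C : Set (BiProjSpace K n)} {s : ℕ}
    (h : HasChain s C) (hs : n ≤ s + 1) : ∃ x : ProjSpace K n, (⟨x, x⟩ : BiProjSpace K n) ∈ C := by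
  classical
  have : Infinite K := IsAlgClosed.instInfinite
  obtain ⟨Z, hZC, hZ⟩ := h
  set I := coneIdeal (biBlock n) (BiProjSpace.coords (K := K)) Z with hI
  obtain ⟨z, hz, hle⟩ := isConeCoords_biProj.relHeight_chain hZ (I := I) le_rfl
  have hxI : I ≤ orbitIdeal (biBlock n) z.coords := iInf₂_le z hz
  obtain ⟨i, hi⟩ : ∃ i, z.fst.coords i ≠ 0 := Function.ne_iff.1 z.fst.coords_ne_zero
  obtain ⟨j, hj⟩ : ∃ j, z.snd.coords j ≠ 0 := Function.ne_iff.1 z.snd.coords_ne_zero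
  have hlt : orbitIdeal (biBlock n) z.coords <
      orbitIdeal (biBlock n) (Sum.elim 0 z.snd.coords : Fin n ⊕ Fin n → K) :=
    orbitIdeal_lt_of_scale (t := fun c => if c then 1 else 0) (i := Sum.inl i)
      (by rintro (i | i) <;> simp [biBlock, BiProjSpace.coords]) hi rfl
  have hlt' : orbitIdeal (biBlock n) (Sum.elim 0 z.snd.coords : Fin n ⊕ Fin n → K) <
      orbitIdeal (biBlock n) (0 : Fin n ⊕ Fin n → K) :=
    orbitIdeal_lt_of_scale (t := 0) (i := Sum.inr j) (by simp) hj rfl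
  -- Contracting the first block and then the second adds two steps, so the vertex has height at
  -- least `s + 2 > n` over `I`.
  have h1 := relHeight_add_one_le hxI hlt
  have h2 := relHeight_add_one_le (hxI.trans hlt.le) hlt'
  obtain ⟨v, hv, hvI, hvF⟩ := ProjGeom.exists_common_zero (b := biBlock n)
    ((hxI.trans hlt.le).trans hlt'.le)
    (Finset.univ.image fun i : Fin n => (X (Sum.inl i) - X (Sum.inr i)))
    (by
      intro f hf
      obtain ⟨i, -, rfl⟩ := Finset.mem_image.1 hf
      rw [mem_orbitIdeal_zero]
      simp) (by
      refine lt_of_lt_of_le ?_ h2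
      refine (ENat.add_one_le_iff (ENat.natCast_ne_top _)).1 (add_le_add_left ?_ 1)
      refine le_trans ?_ (le_trans (add_le_add_left (le_trans le_add_self hle) 1) h1)
      refine le_trans (Nat.cast_le.2 Finset.card_image_le) ?_
      rw [Finset.card_fin]
      exact_mod_cast hs)
  have hvv : ∀ i, v (Sum.inr i) = v (Sum.inl i) := by
    intro i
    have := hvF (X (Sum.inl i) - X (Sum.inr i)) (by simp)
    simp only [map_sub, aeval_X] at this
    exact (sub_eq_zero.1 this).symm
  -- The two halves of `v` agree, so neither can vanish alone; this excludes zeros that define no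
  -- point of the product.
  have hw : (fun i => v (Sum.inl i)) ≠ 0 := by
    intro h0
    apply hv
    ext i
    rcases i with i | i
    · exact congrFun h0 i
    · rw [hvv]
      exact congrFun h0 i
  obtain ⟨a, -, ha⟩ := exists_coords_projPoint _ hw
  refine ⟨projPoint _ hw, hZC (isConeCoords_biProj.mem_of_le hZ.isClosed
    ((coneIdeal_le_orbitIdeal hvI).trans ?_))⟩
  have : BiProjSpace.coords (⟨projPoint _ hw, projPoint _ hw⟩ : BiProjSpace K n) =
      fun i => (fun _ => a) (biBlock n i) * v i := by
    ext i
    rcases i with i | i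
    · simp [BiProjSpace.coords, ha]
    · simp [BiProjSpace.coords, ha, hvv]
  rw [this]
  exact orbitIdeal_le_scale (biBlock n) v fun _ => a

theorem ProjSpace.isClosed_singleton (x : ProjSpace K n) : IsClosed ({x} : Set (ProjSpace K n)) := by
  rw [isClosed_iff_isClosedOver]
  refine ⟨{f | ∃ a : Fin n → K, a ⬝ᵥ x.coords = 0 ∧ f = linForm a}, ?_, ?_⟩
  · rintro _ ⟨a, -, rfl⟩
    exact ⟨1, isHomogeneous_linForm a⟩
  · ext y
    simp only [Set.mem_singleton_iff, Set.mem_ofPred_eq]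
    constructor
    · rintro rfl _ ⟨a, ha, rfl⟩
      simpa using ha
    · intro h
      obtain ⟨i, hi⟩ : ∃ i, x.coords i ≠ 0 := Function.ne_iff.1 x.coords_ne_zero
      refine ProjSpace.eq_of_coords (a := y.coords i * (x.coords i)⁻¹) ?_
      ext j
      have := h _ ⟨Pi.single j (x.coords i) - Pi.single i (x.coords j), ?_, rfl⟩
      · rw [aeval_linForm, sub_dotProduct, single_dotProduct, single_dotProduct, sub_eq_zero] at this
        rw [Pi.smul_apply, smul_eq_mul]
        field_simp
        linear_combination this
      · rw [sub_dotProduct, single_dotProduct, single_dotProduct]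
        ring

end Sections

/-! ### Rank conditions as minors, and elimination theory -/

section Elimination

theorem exists_det_ne_zero_of_span_eq_top {K ι : Type*} [Field K] [Fintype ι] [DecidableEq ι]
    {s : Set (ι → K)} (hs : Submodule.span K s = ⊤) :
    ∃ u : ι → ι → K, (∀ i, u i ∈ s) ∧ (Matrix.of u).det ≠ 0 := by
  obtain ⟨b, hbs, hspan, hli⟩ := exists_linearIndependent K s
  let B := Module.Basis.mk hli (by simp [hspan, hs])
  let e := (Pi.basisFun K ι).indexEquiv B
  refine ⟨fun i => e i, fun i => hbs (e i).2, ?_⟩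
  have : LinearIndependent K fun i => ((e i : b) : ι → K) := hli.comp _ e.injective
  have h2 := Matrix.linearIndependent_rows_iff_isUnit.1
    (show LinearIndependent K (Matrix.of fun i => ((e i : b) : ι → K)).row from this)
  exact ((Matrix.isUnit_iff_isUnit_det _).1 h2).ne_zero

theorem rank_lt_iff_forall_det {K : Type*} [Field K] {r n : ℕ}
    (M : Matrix (Fin r) (Fin n) K) :
    M.rank < r ↔ ∀ e : Fin r → Fin n, (M.submatrix id e).det = 0 := by
  constructor
  · intro h e
    by_contra hne
    have h1 : (M.submatrix id e).rank = r := by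
      rw [Matrix.rank_of_isUnit _ ((Matrix.isUnit_iff_isUnit_det _).2 (isUnit_iff_ne_zero.2 hne)),
        Fintype.card_fin]
    have h2 : (M.submatrix id e).rank ≤ M.rank := M.rank_submatrix_le id e
    omega
  · intro h
    by_contra hr
    have hspan : Submodule.span K (Set.range M.col) = ⊤ := by
      apply Submodule.eq_top_of_finrank_eq
      rw [← Matrix.rank_eq_finrank_span_cols, Module.finrank_fin_fun]
      exact le_antisymm (M.rank_le_height) (not_lt.1 hr)
    obtain ⟨u, hu, hdet⟩ := exists_det_ne_zero_of_span_eq_top hspan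
    choose e he using hu
    apply hdet
    rw [← Matrix.det_transpose, ← h e]
    congr 1
    ext i j
    simp [← he, Matrix.col]

variable {A K : Type*} [CommRing A] [Field K] {n : ℕ}

/-- Scalars that multiply all monomials of some degree into the ideal generated by `F`. -/
def eliminants (F : Set (MvPolynomial (Fin n) A)) : Set A :=
  {b | ∃ N, ∀ d : Fin n →₀ ℕ, d.degree = N → monomial d b ∈ Ideal.span F}

theorem eval₂_eliminant {F : Set (MvPolynomial (Fin n) A)} (φ : A →+* K) {v : Fin n → K}
    (hv : v ≠ 0) (hF : ∀ f ∈ F, eval₂ φ v f = 0) {b : A} (hb : b ∈ eliminants F) : φ b = 0 := by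
  obtain ⟨N, hN⟩ := hb
  obtain ⟨i, hi⟩ : ∃ i, v i ≠ 0 := Function.ne_iff.1 hv
  have h1 := hN (Finsupp.single i N) (by simp)
  have h2 : Ideal.span F ≤ RingHom.ker (eval₂Hom φ v) := Ideal.span_le.2 fun f hf => hF f hf
  have h3 : eval₂Hom φ v (monomial (Finsupp.single i N) b) = 0 := h2 h1
  rw [coe_eval₂Hom, eval₂_monomial, Finsupp.prod_single_index (by simp)] at h3
  exact (mul_eq_zero.1 h3).resolve_right (pow_ne_zero _ hi)

theorem monomial_mem_of_pow_mem {I : Ideal (MvPolynomial (Fin n) A)} {M : ℕ}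
    (h : ∀ i, X i ^ M ∈ I) {d : Fin n →₀ ℕ} (hd : n * M < d.degree) (r : A) :
    monomial d r ∈ I := by
  obtain ⟨i, hi⟩ : ∃ i, M ≤ d i := by
    by_contra! hlt
    have : d.degree ≤ n * M := by
      rw [Finsupp.degree_eq_sum]
      calc ∑ i, d i ≤ ∑ _i : Fin n, M := Finset.sum_le_sum fun i _ => (hlt i).le
        _ = n * M := by simp
    omega
  have : monomial d r = monomial (d - Finsupp.single i M) r * X i ^ M := by
    rw [X_pow_eq_monomial, monomial_mul, mul_one, tsub_add_cancel_of_le]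
    simpa using hi
  rw [this]
  exact I.mul_mem_left _ (h i)

theorem exists_pow_mem_of_no_zeros {K : Type*} [Field K] [IsAlgClosed K]
    {I : Ideal (MvPolynomial (Fin n) K)}
    (h : ∀ v : Fin n → K, (∀ f ∈ I, aeval v f = 0) → v = 0) :
    ∃ M, ∀ i, X i ^ M ∈ I := by
  have h1 : ∀ i : Fin n, ∃ M, (X i : MvPolynomial (Fin n) K) ^ M ∈ I := by
    intro i
    have : (X i : MvPolynomial (Fin n) K) ∈ I.radical := by
      rw [← vanishingIdeal_zeroLocus_eq_radical (K := K)]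
      intro v hv
      rw [h v hv]
      simp
    exact this
  choose M hM using h1
  refine ⟨∑ i, M i, fun i => ?_⟩
  rw [← Nat.add_sub_of_le (Finset.single_le_sum (f := M) (fun _ _ => Nat.zero_le _)
    (Finset.mem_univ i)), pow_add]
  exact I.mul_mem_right _ (hM i)

/-- The **main theorem of elimination theory**. -/
theorem exists_zero_iff_eliminants [IsAlgClosed K] {F : Set (MvPolynomial (Fin n) A)}
    (hF : ∀ f ∈ F, ∃ m, f.IsHomogeneous m) (φ : A →+* K) :
    (∃ v : Fin n → K, v ≠ 0 ∧ ∀ f ∈ F, eval₂ φ v f = 0) ↔ ∀ b ∈ eliminants F, φ b = 0 := by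
  classical
  refine ⟨fun ⟨v, hv, h⟩ b hb => eval₂_eliminant φ hv h hb, fun h => ?_⟩
  by_contra! hcon
  set J := Ideal.span F with hJ
  set J' : Ideal (MvPolynomial (Fin n) K) := Ideal.span (MvPolynomial.map φ '' F) with hJ'
  obtain ⟨M, hM⟩ := exists_pow_mem_of_no_zeros (I := J') (by
    intro v hv
    by_contra hv0
    obtain ⟨f, hf, hne⟩ := hcon v hv0
    apply hne
    have := hv _ (Ideal.subset_span ⟨f, hf, rfl⟩)
    rwa [MvPolynomial.aeval_eq_eval, eval_map] at this)
  -- In this degree every monomial is divisible by some `X i ^ M`, hence lies in the specialized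
  -- ideal `J'`.
  set N := n * M + 1 with hN
  let ι := {d : Fin n →₀ ℕ // d.degree = N}
  have : Finite ι := by
    have : {d : Fin n →₀ ℕ | d.degree = N}.Finite :=
      (Finsupp.finite_of_degree_le N).subset fun d hd => le_of_eq hd
    exact this.to_subtype
  have := Fintype.ofFinite ι
  let ψ : (ι → A) →ₗ[A] MvPolynomial (Fin n) A :=
    Fintype.linearCombination A fun d : ι => monomial d.1 (1 : A)
  let cf : MvPolynomial (Fin n) K →ₗ[K] (ι → K) := LinearMap.pi fun d => lcoeff K d.1
  -- The specialized coefficient vectors of the forms of degree `N` that lie in `J` before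
  -- specialization.
  let U : Set (ι → K) := {w | ∃ u : ι → A, ψ u ∈ J ∧ w = fun d => φ (u d)}
  have key : ∀ p ∈ J', ∀ q : MvPolynomial (Fin n) K, cf (q * p) ∈ Submodule.span K U := by
    intro p hp
    refine Submodule.span_induction ?_ ?_ ?_ ?_ hp
    · rintro _ ⟨f, hf, rfl⟩ q
      obtain ⟨m, hm⟩ := hF f hf
      induction q using MvPolynomial.induction_on' with
      | add q₁ q₂ h₁ h₂ =>
        rw [add_mul, map_add]
        exact Submodule.add_mem _ h₁ h₂
      | monomial e c =>
        have h1 : monomial e c * MvPolynomial.map φ f =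
            c • MvPolynomial.map φ (monomial e 1 * f) := by
          rw [map_mul, map_monomial, map_one, ← smul_mul_assoc, smul_monomial, smul_eq_mul, mul_one]
        rw [h1, map_smul]
        refine Submodule.smul_mem _ _ ?_
        have h2 : (monomial e 1 * f : MvPolynomial (Fin n) A).IsHomogeneous (e.degree + m) :=
          (isHomogeneous_monomial _ rfl).mul hm
        by_cases heq : e.degree + m = N
        · refine Submodule.subset_span ⟨fun d => coeff d.1 (monomial e 1 * f), ?_, ?_⟩
          · have : ψ (fun d => coeff d.1 (monomial e 1 * f)) = monomial e 1 * f := by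
              ext d
              simp only [ψ, Fintype.linearCombination_apply, smul_monomial, smul_eq_mul, mul_one,
                coeff_sum, coeff_monomial]
              by_cases hd : d.degree = N
              · rw [Finset.sum_eq_single (⟨d, hd⟩ : ι)]
                · simp
                · intro d' _ hne
                  rw [if_neg fun h => hne (Subtype.ext h)]
                · simp
              · rw [h2.coeff_eq_zero (by rwa [heq])]
                refine Finset.sum_eq_zero fun d' _ => if_neg fun h => hd ?_
                rw [← h, d'.2]
            rw [this]
            exact J.mul_mem_left _ (Ideal.subset_span hf)
          · ext d
            exact coeff_map φ _ d.1
        · convert Submodule.zero_mem _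
          ext d
          simp only [cf, LinearMap.pi_apply, lcoeff_apply, coeff_map, Pi.zero_apply]
          rw [h2.coeff_eq_zero (by rw [d.2]; exact fun h => heq h.symm), map_zero]
    · intro q
      rw [mul_zero, map_zero]
      exact Submodule.zero_mem _
    · intro x y _ _ hx hy q
      rw [mul_add, map_add]
      exact Submodule.add_mem _ (hx q) (hy q)
    · intro a x _ hx q
      rw [smul_eq_mul, ← mul_assoc]
      exact hx _
  -- All monomials of degree `N` lie in `J'`, and the degree `N` part of `J'` is spanned by
  -- specializations because the generators are homogeneous.
  have hspan : Submodule.span K U = ⊤ := by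
    rw [eq_top_iff, ← (Pi.basisFun K ι).span_eq, Submodule.span_le]
    rintro _ ⟨d, rfl⟩
    have h1 := key _ (monomial_mem_of_pow_mem hM (d := d.1) (by rw [d.2]; omega) 1) 1
    have h2 : Pi.basisFun K ι d = cf (1 * monomial d.1 1) := by
      ext d'
      simp only [Pi.basisFun_apply, one_mul, cf, LinearMap.pi_apply, lcoeff_apply, coeff_monomial,
        Pi.single_apply, Subtype.coe_inj, eq_comm]
    rw [h2]
    exact h1
  obtain ⟨w, hw, hdet⟩ := exists_det_ne_zero_of_span_eq_top hspan
  choose u hu hwu using hw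
  have hdet' : φ (Matrix.of u).det ≠ 0 := by
    rw [RingHom.map_det]
    convert hdet
    ext i j
    simp [hwu]
  -- The determinant of a family `u` that stays a basis after specialization is an eliminant: by
  -- Cramer's rule it multiplies every monomial of degree `N` into `J`.
  refine hdet' (h _ ⟨N, fun d hd => ?_⟩)
  have h1 : ψ (Pi.single ⟨d, hd⟩ (Matrix.of u).det) = monomial d (Matrix.of u).det := by
    simp [ψ, Fintype.linearCombination_apply_single, smul_monomial]
  have h2 : (Pi.single ⟨d, hd⟩ (Matrix.of u).det : ι → A) =
      ∑ i, (Matrix.of u).adjugate ⟨d, hd⟩ i • u i := by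
    have := congrFun (Matrix.adjugate_mul (Matrix.of u)) (⟨d, hd⟩ : ι)
    ext j
    have hj := congrFun this j
    rw [Matrix.mul_apply] at hj
    simp only [Matrix.of_apply, Matrix.smul_apply, smul_eq_mul] at hj
    simp only [Finset.sum_apply, Pi.smul_apply, smul_eq_mul, hj, Matrix.one_apply, Pi.single_apply,
      mul_ite, mul_one, mul_zero, eq_comm]
  rw [← h1, h2, map_sum]
  refine Submodule.sum_mem _ fun i _ => ?_
  rw [map_smul, MvPolynomial.smul_eq_C_mul]
  exact J.mul_mem_left _ (hu i)

end Elimination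

/-! ### The projection of the product to a factor is closed -/

section Projection

variable {K : Type*} [Field K] {n : ℕ}

/-- The product with all scaling parameters vanishes identically, and they are nonzero in a domain.
So only invertible scalings need to be checked, for which geometric conditions are invariant. -/
theorem blockExpand_eq_zero_of_units {σ τ : Type*} [Finite τ] [Infinite K] {k : Type*} [CommRing k]
    [Algebra k K] {b : σ → τ} {v : σ → K} {f : MvPolynomial σ k}
    (h : ∀ t : τ → K, (∀ j, t j ≠ 0) → aeval (fun i => t (b i) * v i) f = 0) :
    blockExpand k b v f = 0 := by
  have := Fintype.ofFinite τ
  have h1 : blockExpand k b v f * ∏ j, X j = 0 := by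
    refine MvPolynomial.funext fun t => ?_
    rw [map_mul, eval_blockExpand, map_zero, map_prod]
    by_cases ht : ∀ j, t j ≠ 0
    · rw [h t ht, zero_mul]
    · push Not at ht
      obtain ⟨j, hj⟩ := ht
      rw [Finset.prod_eq_zero (Finset.mem_univ j) (by simpa using hj), mul_zero]
  exact (mul_eq_zero.1 h1).resolve_right (Finset.prod_ne_zero_iff.2 fun j _ => X_ne_zero j)

/-- The homogeneous components of the members of `F`. -/
def homParts {A : Type*} [CommRing A] (F : Set (MvPolynomial (Fin n) A)) :
    Set (MvPolynomial (Fin n) A) :=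
  {g | ∃ f ∈ F, ∃ m, g = homogeneousComponent m f}

theorem eval₂_homParts_iff [Infinite K] {A : Type*} [CommRing A]
    (F : Set (MvPolynomial (Fin n) A)) (φ : A →+* K) (v : Fin n → K) :
    (∀ g ∈ homParts F, eval₂ φ v g = 0) ↔ ∀ f ∈ F, ∀ t : K, t ≠ 0 → eval₂ φ (t • v) f = 0 := by
  classical
  have hcomp : ∀ (f : MvPolynomial (Fin n) A) (e : Unit →₀ ℕ),
      blockComponent K (projBlock n) e (MvPolynomial.map φ f) =
        MvPolynomial.map φ (homogeneousComponent (e ()) f) := by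
    intro f e
    ext d
    rw [blockComponent, coeff_weightedHomogeneousComponent, weight_projBlock, coeff_map,
      coeff_map, coeff_homogeneousComponent]
    have : Finsupp.single () d.degree = e ↔ d.degree = e () := by
      rw [Finsupp.ext_iff]
      simp only [Finsupp.single_apply, Unique.forall_iff]
      rfl
    simp only [this]
    split_ifs <;> simp
  have key : ∀ f : MvPolynomial (Fin n) A,
      (∀ m, eval₂ φ v (homogeneousComponent m f) = 0) ↔
        ∀ t : K, t ≠ 0 → eval₂ φ (t • v) f = 0 := by
    intro f
    have h1 : (∀ m, eval₂ φ v (homogeneousComponent m f) = 0) ↔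
        blockExpand K (projBlock n) v (MvPolynomial.map φ f) = 0 := by
      rw [blockExpand_eq_zero_iff_component]
      simp only [hcomp, MvPolynomial.aeval_eq_eval, eval_map]
      exact ⟨fun h e => h _, fun h m => by simpa using h (Finsupp.single () m)⟩
    rw [h1]
    constructor
    · intro h t _
      rw [blockExpand_eq_zero_iff] at h
      have := h fun _ => t
      rwa [MvPolynomial.aeval_eq_eval, eval_map] at this
    · intro h
      refine blockExpand_eq_zero_of_units fun t ht => ?_
      have := h (t ()) (ht ())
      rwa [← eval_map] at this
  constructor
  · intro h f hf
    exact (key f).1 fun m => h _ ⟨f, hf, m, rfl⟩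
  · rintro h _ ⟨f, hf, m, rfl⟩
    exact (key f).2 (h f hf) m

theorem exists_zero_iff_eliminants_homParts [IsAlgClosed K] {A : Type*} [CommRing A]
    (F : Set (MvPolynomial (Fin n) A)) (φ : A →+* K) :
    (∃ v : Fin n → K, v ≠ 0 ∧ ∀ f ∈ F, ∀ t : K, t ≠ 0 → eval₂ φ (t • v) f = 0) ↔
      ∀ b ∈ eliminants (homParts F), φ b = 0 := by
  have : Infinite K := IsAlgClosed.instInfinite
  rw [← exists_zero_iff_eliminants]
  · simp only [eval₂_homParts_iff]
  · rintro _ ⟨f, hf, m, rfl⟩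
    exact ⟨m, homogeneousComponent_isHomogeneous m f⟩

/-- The variables of `y` are moved into the coefficient ring and those of `x` are eliminated; the
eliminants are polynomials in `y` whose zeros form the image. -/
theorem isClosedMap_snd [IsAlgClosed K] : IsClosedMap (BiProjSpace.snd (K := K) (n := n)) := by
  have : Infinite K := IsAlgClosed.instInfinite
  intro T hT
  set I := coneIdeal (biBlock n) (BiProjSpace.coords (K := K)) T with hI
  let ρ : MvPolynomial (Fin n ⊕ Fin n) K →ₐ[K] MvPolynomial (Fin n) (MvPolynomial (Fin n) K) :=
    aeval (Sum.elim X fun i => C (X i))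
  let F : Set (MvPolynomial (Fin n) (MvPolynomial (Fin n) K)) := ρ '' I
  have heval : ∀ (v w : Fin n → K) (f : MvPolynomial (Fin n ⊕ Fin n) K),
      eval₂ (aeval w : MvPolynomial (Fin n) K →ₐ[K] K).toRingHom v (ρ f) =
        aeval (Sum.elim v w) f := by
    intro v w f
    have : (eval₂Hom (aeval w : MvPolynomial (Fin n) K →ₐ[K] K).toRingHom v).comp
        ρ.toRingHom = (aeval (Sum.elim v w)).toRingHom := by
      ext i
      · simp [ρ, MvPolynomial.algebraMap_apply]
      · rcases i with i | i <;> simp [ρ]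
    exact DFunLike.congr_fun this f
  have hmem : ∀ y : ProjSpace K n, y ∈ BiProjSpace.snd '' T ↔
      ∃ v : Fin n → K, v ≠ 0 ∧ ∀ f ∈ I, ∀ t : Bool → K,
        aeval (fun i => t (biBlock n i) * (Sum.elim v y.coords : Fin n ⊕ Fin n → K) i) f = 0 := by
    intro y
    constructor
    · rintro ⟨z, hz, rfl⟩
      refine ⟨z.fst.coords, z.fst.coords_ne_zero, fun f hf => ?_⟩
      rw [← blockExpand_eq_zero_iff]
      exact mem_coneIdeal.1 hf z hz
    · rintro ⟨v, hv, h⟩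
      obtain ⟨a, ha, hav⟩ := exists_coords_projPoint v hv
      refine ⟨⟨projPoint v hv, y⟩, isConeCoords_biProj.mem_of_le hT fun f hf => ?_, rfl⟩
      rw [mem_orbitIdeal, blockExpand_scale_eq_zero_iff (v := Sum.elim v y.coords)
        (t := fun c => if c then 1 else a), blockExpand_eq_zero_iff]
      · exact h f hf
      · intro c; cases c <;> simp [ha]
      · rintro (i | i) <;> simp [BiProjSpace.coords, biBlock, hav]
  rw [isClosed_iff_isClosedOver]
  convert isClosedOver_blockExpand (K := K) (n := n) (eliminants (homParts F)) using 1
  ext y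
  rw [hmem, Set.mem_ofPred_eq]
  constructor
  · rintro ⟨v, hv, h⟩ b hb
    refine blockExpand_eq_zero_of_units fun u hu => ?_
    refine (exists_zero_iff_eliminants_homParts F
      (aeval (u () • y.coords) : MvPolynomial (Fin n) K →ₐ[K] K).toRingHom).1 ⟨v, hv, ?_⟩ b hb
    rintro _ ⟨f, hf, rfl⟩ t -
    rw [heval, ← h f hf fun c => if c then u () else t]
    congr 2
    ext i
    rcases i with i | i <;> simp [biBlock]
  · intro h
    obtain ⟨v, hv, hvF⟩ := (exists_zero_iff_eliminants_homParts F
      (aeval y.coords : MvPolynomial (Fin n) K →ₐ[K] K).toRingHom).2 fun b hb => by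
        have := (blockExpand_eq_zero_iff _ _ _).1 (h b hb) fun _ => 1
        simpa using this
    refine ⟨v, hv, fun f hf => ?_⟩
    rw [← blockExpand_eq_zero_iff]
    refine coneIdeal_le_orbitIdeal (fun g hg => ?_) hf
    have := hvF _ ⟨g, hg, rfl⟩ 1 one_ne_zero
    rwa [one_smul, heval] at this

end Projection

/-! ### Hilbert functions of point sets -/

section Hilbert

variable {K : Type*} [Field K] {n : ℕ}

/-- Restriction of forms of degree `N` to the set `Y`. -/
def restrictForms (Y : Set (ProjSpace K n)) (N : ℕ) :
    homogeneousSubmodule (Fin n) K N →ₗ[K] (Y → K) :=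
  (LinearMap.pi fun x : Y => (aeval x.1.coords).toLinearMap) ∘ₗ Submodule.subtype _

/-- The Hilbert function of `Y`. -/
def hilbert (Y : Set (ProjSpace K n)) (N : ℕ) : ℕ :=
  Module.finrank K (LinearMap.range (restrictForms Y N))

instance (N : ℕ) : Module.Finite K (homogeneousSubmodule (Fin n) K N) :=
  Module.Finite.iff_fg.2 (homogeneousSubmodule_fg _ _ N)

theorem finrank_range_le_of_ker_le {V W₁ W₂ : Type*} [AddCommGroup V] [Module K V]
    [Module.Finite K V] [AddCommGroup W₁] [Module K W₁] [AddCommGroup W₂] [Module K W₂]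
    {f : V →ₗ[K] W₁} {g : V →ₗ[K] W₂} (h : LinearMap.ker f ≤ LinearMap.ker g) :
    Module.finrank K (LinearMap.range g) ≤ Module.finrank K (LinearMap.range f) := by
  have h1 := f.finrank_range_add_finrank_ker
  have h2 := g.finrank_range_add_finrank_ker
  have h3 := Submodule.finrank_mono h
  omega

theorem hilbert_mono {Y Y' : Set (ProjSpace K n)} (h : Y' ⊆ Y) (N : ℕ) :
    hilbert Y' N ≤ hilbert Y N := by
  refine finrank_range_le_of_ker_le fun f hf => ?_
  rw [LinearMap.mem_ker] at hf ⊢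
  ext x
  exact congrFun hf ⟨x.1, h x.2⟩

/-- Multiplication by a form `g` that vanishes on `Y'`. -/
theorem hilbert_add_le {Y Y' Z : Set (ProjSpace K n)} (hY : Y' ⊆ Y) {g : MvPolynomial (Fin n) K}
    {e : ℕ} (hg : g.IsHomogeneous e) (hgY : ∀ x ∈ Y', aeval x.coords g = 0) (N : ℕ)
    (hZ : ∀ f : MvPolynomial (Fin n) K, f.IsHomogeneous N →
      (∀ x ∈ Y, aeval x.coords g * aeval x.coords f = 0) → ∀ x ∈ Z, aeval x.coords f = 0) :
    hilbert Y' (N + e) + hilbert Z N ≤ hilbert Y (N + e) := by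
  set A := restrictForms Y (N + e)
  set B := restrictForms Y' (N + e)
  have hAB : LinearMap.ker A ≤ LinearMap.ker B := by
    intro f hf
    rw [LinearMap.mem_ker] at hf ⊢
    ext x
    exact congrFun hf ⟨x.1, hY x.2⟩
  let μ : homogeneousSubmodule (Fin n) K N →ₗ[K] homogeneousSubmodule (Fin n) K (N + e) :=
    (LinearMap.mulRight K g).restrict fun f hf => IsHomogeneous.mul hf hg
  have h1 : Module.finrank K (LinearMap.range (restrictForms Z N)) ≤
      Module.finrank K (LinearMap.range (A ∘ₗ μ)) := by
    refine finrank_range_le_of_ker_le fun f hf => ?_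
    rw [LinearMap.mem_ker] at hf ⊢
    ext x
    refine hZ f.1 f.2 (fun y hy => ?_) x.1 x.2
    have h2 : aeval y.coords (f.1 * g) = 0 := congrFun hf ⟨y, hy⟩
    rwa [map_mul, mul_comm] at h2
  -- Multiples of `g` restrict to zero on `Y'`, and the forms on `Y` with this property make up a
  -- space of dimension `hilbert Y - hilbert Y'`.
  have h2 : LinearMap.range (A ∘ₗ μ) ≤ LinearMap.range (A.domRestrict (LinearMap.ker B)) := by
    rintro _ ⟨f, rfl⟩
    refine ⟨⟨μ f, ?_⟩, rfl⟩
    rw [LinearMap.mem_ker]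
    ext x
    change aeval x.1.coords (f.1 * g) = 0
    rw [map_mul, hgY x.1 x.2, mul_zero]
  have h3 := Submodule.finrank_mono h2
  have h4 := LinearMap.finrank_range_add_finrank_ker (K := K) (V := LinearMap.ker B)
    (V₂ := Y → K) (A.domRestrict (LinearMap.ker B))
  rw [LinearMap.ker_domRestrict, (Submodule.comapSubtypeEquivOfLe hAB).finrank_eq] at h4
  have h5 := A.finrank_range_add_finrank_ker
  have h6 := B.finrank_range_add_finrank_ker
  change Module.finrank K (LinearMap.range B) +
    Module.finrank K (LinearMap.range (restrictForms Z N)) ≤ Module.finrank K (LinearMap.range A)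
  omega

theorem natCard_degree_eq_le (m N : ℕ) :
    Nat.card {d : Fin (m + 1) →₀ ℕ // d.degree = N} ≤ (N + 1) ^ m := by
  have hcard : Nat.card (Fin m → Fin (N + 1)) = (N + 1) ^ m := by simp
  rw [← hcard]
  have hle : ∀ (d : Fin (m + 1) →₀ ℕ), d.degree = N → ∀ i, d i < N + 1 := by
    intro d hd i
    rw [Nat.lt_succ_iff, ← hd]
    exact Finsupp.le_degree i d
  refine Nat.card_le_card_of_injective
    (fun d i => (⟨d.1 (Fin.succ i), hle d.1 d.2 _⟩ : Fin (N + 1))) ?_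
  rintro ⟨d, hd⟩ ⟨d', hd'⟩ h
  have h1 : ∀ i : Fin m, d i.succ = d' i.succ := fun i => congrArg Fin.val (congrFun h i)
  have h2 : d 0 = d' 0 := by
    rw [Finsupp.degree_eq_sum, Fin.sum_univ_succ] at hd hd'
    simp only [h1] at hd
    omega
  refine Subtype.ext (Finsupp.ext fun i => ?_)
  induction i using Fin.cases with
  | zero => exact h2
  | succ i => exact h1 i

theorem hilbert_le_pow (hn : 1 ≤ n) (Y : Set (ProjSpace K n)) (N : ℕ) :
    hilbert Y N ≤ (N + 1) ^ (n - 1) := by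
  obtain ⟨m, rfl⟩ : ∃ m, n = m + 1 := ⟨n - 1, by omega⟩
  refine le_trans ?_ (natCard_degree_eq_le m N)
  have hfin : {d : Fin (m + 1) →₀ ℕ | d.degree = N}.Finite :=
    (Finsupp.finite_of_degree_le N).subset fun d hd => le_of_eq hd
  have : Finite {d : Fin (m + 1) →₀ ℕ // d.degree = N} := hfin.to_subtype
  have h1 : hilbert Y N ≤ Module.finrank K (homogeneousSubmodule (Fin (m + 1)) K N) :=
    LinearMap.finrank_range_le _
  refine h1.trans ?_
  have h2 : homogeneousSubmodule (Fin (m + 1)) K N = Submodule.span K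
      (Set.range fun d : {d : Fin (m + 1) →₀ ℕ // d.degree = N} => monomial d.1 (1 : K)) := by
    apply le_antisymm
    · intro f hf
      rw [f.as_sum]
      refine Submodule.sum_mem _ fun d hd => ?_
      have : monomial d (coeff d f) = coeff d f • monomial d (1 : K) := by
        rw [smul_monomial, smul_eq_mul, mul_one]
      rw [this]
      refine Submodule.smul_mem _ _ (Submodule.subset_span ⟨⟨d, ?_⟩, rfl⟩)
      by_contra hne
      exact mem_support_iff.1 hd (IsHomogeneous.coeff_eq_zero hf hne)
    · rw [Submodule.span_le]
      rintro _ ⟨d, rfl⟩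
      exact isHomogeneous_monomial _ d.2
  have := Fintype.ofFinite {d : Fin (m + 1) →₀ ℕ // d.degree = N}
  rw [h2, Nat.card_eq_fintype_card]
  exact finrank_range_le_card _

/-- Adding up `M` steps gives `M * h' N ≤ h (N + M * D)`. The choice `M = N + 1` keeps the argument
of `h` linear in `N`, and dividing by `N + 1` saves one power. -/
theorem growth_step {h h' : ℕ → ℕ} {D c e : ℕ} (hmono : ∀ N, h' N ≤ h' (N + 1))
    (hstep : ∀ N, h' (N + D) + h N ≤ h (N + D)) (hbound : ∀ N, h N ≤ c * (N + 1) ^ (e + 1))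
    (N : ℕ) : h' N ≤ c * (D + 1) ^ (e + 1) * (N + 1) ^ e := by
  have hm : Monotone h' := monotone_nat_of_le_succ hmono
  have h1 : ∀ M, M * h' N ≤ h (N + M * D) := by
    intro M
    induction M with
    | zero => simp
    | succ M ih =>
      have h2 := hstep (N + M * D)
      have h3 : h' N ≤ h' (N + M * D + D) := hm (by omega)
      have h4 : N + (M + 1) * D = N + M * D + D := by ring
      rw [h4, add_mul, one_mul]
      omega
  have h2 : (N + 1) * h' N ≤ (N + 1) * (c * (D + 1) ^ (e + 1) * (N + 1) ^ e) := by
    refine (h1 (N + 1)).trans ((hbound _).trans ?_)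
    have : N + (N + 1) * D + 1 = (N + 1) * (D + 1) := by ring
    rw [this, mul_pow]
    apply le_of_eq
    ring
  exact Nat.le_of_mul_le_mul_left h2 (Nat.succ_pos N)

theorem forall_aeval_eq_zero_of_mul {Z : Set (ProjSpace K n)} (hZ : IsIrreducible Z)
    {f g : MvPolynomial (Fin n) K} {a b : ℕ} (hf : f.IsHomogeneous a) (hg : g.IsHomogeneous b)
    (h : ∀ x ∈ Z, aeval x.coords g * aeval x.coords f = 0) (hgZ : ∃ x ∈ Z, aeval x.coords g ≠ 0) :
    ∀ x ∈ Z, aeval x.coords f = 0 := by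
  rcases isPreirreducible_iff_isClosed_union_isClosed.1 hZ.2 _ _
    (isClosed_zeros_of_isHomogeneous hg) (isClosed_zeros_of_isHomogeneous hf)
    (fun x hx => mul_eq_zero.1 (h x hx)) with h1 | h1
  · obtain ⟨x, hx, hne⟩ := hgZ
    exact absurd (h1 hx) hne
  · exact fun x hx => h1 hx

end Hilbert

/-! ### Dimension of the components of a set given by few equations -/

section Purity

variable {K : Type*} [Field K] {n : ℕ}

theorem aeval_smul_eq_zero_iff [Infinite K] {f : MvPolynomial (Fin n) K} {m : ℕ}
    (hf : f.IsHomogeneous m) {a : K} (ha : a ≠ 0) (v : Fin n → K) :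
    aeval (a • v) f = 0 ↔ aeval v f = 0 := by
  have h := isWeightedHomogeneous_projBlock.2 hf
  rw [← blockExpand_eq_zero_iff_of_homogeneous h, ← blockExpand_eq_zero_iff_of_homogeneous h]
  exact blockExpand_scale_eq_zero_iff (t := fun _ => a) (fun _ => ha) (fun _ => rfl) f

/-- The line through `v` is enlarged one coordinate at a time: for a set `J` of freed coordinates,
the linear space where the others stay proportional to those of `v` is again an orbit closure, with
its own block for each member of `J`. Freeing `i` destroys the relation `v i₀ * X i = v i * X i₀`,
so the prime ideals strictly decrease. -/
theorem card_add_relHeight_le [Infinite K] {v : Fin n → K} {i₀ : Fin n} (hi₀ : v i₀ ≠ 0)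
    (J : Finset (Fin n)) (hJ : i₀ ∉ J) :
    (J.card : ℕ∞) ≤ relHeight ⊥ (orbitIdeal (projBlock n) v) := by
  classical
  let b : Finset (Fin n) → Fin n → Option (Fin n) := fun J i => if i ∈ J then some i else none
  let w : Finset (Fin n) → Fin n → K := fun J i => if i ∈ J then 1 else v i
  have hlt : ∀ (J : Finset (Fin n)) (i : Fin n), i ∉ J → i ≠ i₀ → i₀ ∉ J →
      orbitIdeal (b (insert i J)) (w (insert i J)) < orbitIdeal (b J) (w J) := by
    intro J i hi hne hJ
    refine lt_of_le_not_ge ?_ ?_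
    · intro f hf
      rw [mem_orbitIdeal, blockExpand_eq_zero_iff] at hf ⊢
      intro t
      have := hf fun j => j.elim (t none) fun l => if l = i then t none * v i else t (some l)
      refine (congrArg (fun u : Fin n → K => aeval u f) (funext fun j => ?_)).trans this
      by_cases hj : j = i
      · subst hj
        simp [b, w, hi]
      · by_cases hjJ : j ∈ J <;> simp [b, w, hj, hjJ]
    · intro hle
      have h1 : C (v i₀) * X i - C (v i) * X i₀ ∈ orbitIdeal (b J) (w J) := by
        rw [mem_orbitIdeal, blockExpand_eq_zero_iff]
        intro t
        simp [b, w, hi, hJ]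
        ring
      have h2 := hle h1
      rw [mem_orbitIdeal, blockExpand_eq_zero_iff] at h2
      have h3 := h2 fun j => j.elim 0 fun _ => 1
      simp [b, w, hJ, hne.symm, hi₀] at h3
  have hind : ∀ J : Finset (Fin n), i₀ ∉ J →
      relHeight ⊥ (orbitIdeal (b J) (w J)) + J.card ≤ relHeight ⊥ (orbitIdeal (b ∅) (w ∅)) := by
    intro J
    induction J using Finset.induction_on with
    | empty => simp
    | insert i J hi ih =>
      intro hJ
      rw [Finset.mem_insert, not_or] at hJ
      refine le_trans ?_ (ih hJ.2)
      rw [Finset.card_insert_of_notMem hi, Nat.cast_add, Nat.cast_one, add_comm (J.card : ℕ∞) 1,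
        ← add_assoc]
      exact add_le_add_left (relHeight_add_one_le bot_le (hlt J i hi (Ne.symm hJ.1) hJ.2)) _
  have h0 : orbitIdeal (b ∅) (w ∅) ≤ orbitIdeal (projBlock n) v := by
    intro f hf
    rw [mem_orbitIdeal, blockExpand_eq_zero_iff] at hf ⊢
    intro t
    simpa [b, w] using hf fun _ => t ()
  exact (le_add_self.trans (hind J hJ)).trans (relHeight_mono h0)

/-- The common zeros of a set of polynomials. -/
def zeroSet (G : Set (MvPolynomial (Fin n) K)) : Set (ProjSpace K n) :=
  {x | ∀ g ∈ G, aeval x.coords g = 0}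

theorem isClosed_zeroSet {G : Set (MvPolynomial (Fin n) K)}
    (hG : ∀ g ∈ G, ∃ m, g.IsHomogeneous m) : IsClosed (zeroSet G) :=
  isClosed_iff_isClosedOver.2 ⟨G, hG, rfl⟩

/-- An isolated point of the zero set of `G` needs at least `n - 1` equations. -/
theorem le_card_of_isolated [IsAlgClosed K] (G : Finset (MvPolynomial (Fin n) K))
    (hG : ∀ g ∈ G, ∃ m, g.IsHomogeneous m) {x : ProjSpace K n}
    (hx : x ∈ zeroSet (G : Set (MvPolynomial (Fin n) K))) {E : Set (ProjSpace K n)}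
    (hE : IsClosed E) (hxE : x ∉ E)
    (hsub : zeroSet (G : Set (MvPolynomial (Fin n) K)) ⊆ {x} ∪ E) : n - 1 ≤ G.card := by
  classical
  have : Infinite K := IsAlgClosed.instInfinite
  obtain ⟨i₀, hi₀⟩ : ∃ i, x.coords i ≠ 0 := Function.ne_iff.1 x.coords_ne_zero
  have h1 := card_add_relHeight_le hi₀ (Finset.univ.erase i₀) (by simp)
  rw [Finset.card_erase_of_mem (Finset.mem_univ _), Finset.card_fin] at h1
  have h2 : relHeight ⊥ (orbitIdeal (projBlock n) x.coords) ≤ G.card := by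
    refine relHeight_le_card bot_le G ?_ ?_
    · intro f hf
      obtain ⟨m, hm⟩ := hG f hf
      rw [mem_orbitIdeal,
        blockExpand_eq_zero_iff_of_homogeneous (isWeightedHomogeneous_projBlock.2 hm)]
      exact hx f hf
    · intro Q hQ _ hGQ hQx l hl
      -- Let `e` vanish on `E` but not at `x`. Then `e * l` vanishes at every zero of the prime `Q`,
      -- and `e ∉ Q`, so `l ∈ Q`; thus the ideal of the line through `x` is minimal over `G`.
      obtain ⟨e, he, hex⟩ := isConeCoords_proj.exists_separating E hE x hxE
      have hmul : e * l ∈ Q := by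
        rw [← IsPrime.vanishingIdeal_zeroLocus (K := K) Q]
        intro v hv
        rw [map_mul]
        by_cases hv0 : v = 0
        · subst hv0
          have : aeval (0 : Fin n → K) l = 0 :=
            mem_orbitIdeal_zero.1 (orbitIdeal_lt_of_scale (b := projBlock n) (w := 0) (t := 0)
              (by simp) hi₀ rfl |>.le hl)
          rw [this, mul_zero]
        · obtain ⟨a, ha, hav⟩ := exists_coords_projPoint v hv0
          have hva : v = fun i => a⁻¹ * (projPoint v hv0).coords i := by
            rw [hav]
            ext i
            simp [ha]
          have hmem : projPoint v hv0 ∈ zeroSet (G : Set (MvPolynomial (Fin n) K)) := by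
            intro g hg
            obtain ⟨m, hm⟩ := hG g hg
            rw [hav, aeval_smul_eq_zero_iff hm ha]
            exact hv g (hGQ g hg)
          rcases hsub hmem with h | h
          · rw [Set.mem_singleton_iff] at h
            rw [h] at hva
            have := (blockExpand_eq_zero_iff _ _ _).1 (mem_orbitIdeal.1 hl) fun _ => a⁻¹
            rw [hva, this, mul_zero]
          · have := (blockExpand_eq_zero_iff _ _ _).1 (mem_coneIdeal.1 he _ h) fun _ => a⁻¹
            rw [hva, this, zero_mul]
      exact (hQ.mem_or_mem hmul).resolve_left fun h => hex (hQx h)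
  exact_mod_cast h1.trans h2

/-- `X` is an irreducible component of `V`. -/
def IsComponent {P : Type*} [TopologicalSpace P] (X V : Set P) : Prop :=
  IsIrreducible X ∧ X ⊆ V ∧ ∀ Y, IsIrreducible Y → Y ⊆ V → X ⊆ Y → Y = X

theorem IsComponent.isClosed {P : Type*} [TopologicalSpace P] {X V : Set P}
    (h : IsComponent X V) (hV : IsClosed V) : IsClosed X := by
  rw [← h.2.2 (closure X) (isIrreducible_iff_closure.2 h.1) (closure_minimal h.2.1 hV)
    subset_closure]
  exact isClosed_closure

theorem finite_isComponent {P : Type*} [TopologicalSpace P] [TopologicalSpace.NoetherianSpace P]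
    {V : Set P} (hV : IsClosed V) : {X | IsComponent X V}.Finite := by
  obtain ⟨S, hfin, -, hirr, hsub, hsup⟩ := exists_irreducible_superset hV
  refine hfin.subset fun X hX => ?_
  obtain ⟨Z, hZ, hXZ⟩ := hsup X hX.1 hX.2.1
  rwa [← hX.2.2 Z (hirr Z hZ) (hsub Z hZ) hXZ]

theorem exists_isComponent_superset {P : Type*} [TopologicalSpace P]
    [TopologicalSpace.NoetherianSpace P] {V : Set P} (hV : IsClosed V) {Y : Set P}
    (hY : IsIrreducible Y) (hYV : Y ⊆ V) : ∃ X, IsComponent X V ∧ Y ⊆ X := by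
  obtain ⟨S, hfin, -, hirr, hsub, hsup⟩ := exists_irreducible_superset hV
  obtain ⟨Z, hZ, hYZ⟩ := hsup Y hY hYV
  obtain ⟨M, hZM, hM⟩ := hfin.exists_le_maximal hZ
  refine ⟨M, ⟨hirr M hM.1, hsub M hM.1, fun W hW hWV hMW => ?_⟩, hYZ.trans hZM⟩
  obtain ⟨Z', hZ', hWZ'⟩ := hsup W hW hWV
  exact (hWZ'.trans (hM.2 hZ' (hMW.trans hWZ'))).antisymm hMW

theorem isClosed_biUnion_components {P : Type*} [TopologicalSpace P]
    [TopologicalSpace.NoetherianSpace P] {V : Set P} (hV : IsClosed V) (p : Set P → Prop) :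
    IsClosed (⋃₀ {X | IsComponent X V ∧ p X}) := by
  rw [Set.sUnion_eq_biUnion]
  exact ((finite_isComponent hV).subset fun X hX => hX.1).isClosed_biUnion
    fun X hX => hX.1.isClosed hV

/-- A component of a set given by `i` equations has codimension at most `i`. -/
theorem IsComponent.isChainTop [IsAlgClosed K] {G : Finset (MvPolynomial (Fin n) K)}
    (hG : ∀ g ∈ G, ∃ m, g.IsHomogeneous m) {X : Set (ProjSpace K n)}
    (hX : IsComponent X (zeroSet (G : Set (MvPolynomial (Fin n) K)))) :
    IsChainTop (n - 1 - G.card) X := by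
  classical
  have : Infinite K := IsAlgClosed.instInfinite
  set V := zeroSet (G : Set (MvPolynomial (Fin n) K)) with hVdef
  have hV : IsClosed V := isClosed_zeroSet hG
  have hXc := hX.isClosed hV
  obtain ⟨k, hk, hk'⟩ : ∃ k, IsChainTop k X ∧ ¬ IsChainTop (k + 1) X := by
    by_contra! h
    have : ∀ k, IsChainTop k X := fun k => by
      induction k with
      | zero => exact ⟨hX.1, hXc⟩
      | succ k ih => exact h k ih
    exact not_hasChain_n X ⟨X, subset_rfl, this n⟩
  refine hk.of_le ?_
  set E := ⋃₀ {Y | IsComponent Y V ∧ Y ≠ X}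
  have hE : IsClosed E := isClosed_biUnion_components hV _
  have hXE : ¬ X ⊆ E := by
    intro h
    have hfin := (finite_isComponent hV).subset
      (fun Y hY => hY.1 : {Y | IsComponent Y V ∧ Y ≠ X} ⊆ _)
    obtain ⟨S, hS⟩ := hfin.exists_finset_coe
    obtain ⟨Y, hY, hXY⟩ := isIrreducible_iff_sUnion_isClosed.1 hX.1 S
      (fun Y hY => (hS.subset hY).1.isClosed hV) (by rwa [hS])
    have := hS.subset hY
    exact this.2 (hX.2.2 Y this.1.1 this.1.2.1 hXY)
  have hVXE : V ⊆ X ∪ E := by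
    intro y hy
    obtain ⟨Y, hY, hyY⟩ := exists_isComponent_superset hV (isIrreducible_singleton (x := y))
      (by simpa using hy)
    by_cases h : Y = X
    · exact Or.inl (h ▸ hyY rfl)
    · exact Or.inr ⟨Y, ⟨hY, h⟩, hyY rfl⟩
  have hchain : ∀ {Z s}, Z ⊂ X → IsChainTop s Z → IsChainTop (s + 1) X :=
    fun hZ h => ⟨hX.1, hXc, _, hZ, h⟩
  -- With `k = dim X`, cut by `k` hyperplanes general for both `X` and `X ∩ E`. The latter has
  -- smaller dimension and disappears, while the section of `X` is nonempty of dimension zero.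
  obtain ⟨a, ha⟩ := exists_hyperplanes (K := K) (n := n) continuous_id k
    (fun c : Bool => if c then X else X ∩ E)
    (fun c => by cases c; exacts [hXc.inter hE, hXc])
  set H := {z : ProjSpace K n | ∀ j, a j ⬝ᵥ z.coords = 0} with hHdef
  have hH : IsClosed H := by
    simp only [hHdef, Set.ofPred_forall]
    exact isClosed_iInter fun j => isClosed_hyperplane (a j)
  have h0 : X ∩ E ∩ H = ∅ := by
    by_contra hne
    have h1 := (hasChain_zero_iff ((hXc.inter hE).inter hH)).2 (Set.nonempty_iff_ne_empty.2 hne)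
    obtain ⟨Z, hZ, hs⟩ := ha false 0 (by simpa using h1)
    simp only [Bool.false_eq_true, if_false, zero_add] at hZ hs
    exact hk' (hchain ⟨fun z hz => (hZ hz).1, fun hle => hXE fun z hz => (hZ (hle hz)).2⟩ hs)
  have h1 : ¬ HasChain 1 (X ∩ H) := by
    intro h1
    obtain ⟨Z, hZ, hs⟩ := ha true 1 (by simpa using h1)
    simp only [if_true] at hZ hs
    rw [add_comm] at hs
    rcases hZ.eq_or_ssubset with h | h
    · exact hk' (h ▸ hs)
    · exact hk' ((hchain h hs).of_le (by omega))
  obtain ⟨x, hxX, hxH⟩ := HasChain.exists_mem_of_linear ⟨X, subset_rfl, hk⟩ a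
  -- Everything in `V ∩ H` except `x`. So `x` is isolated in a set given by `G.card + k` equations,
  -- which forces `n - 1 ≤ G.card + k`.
  set E' := E ∪ ⋃₀ {Z | IsComponent Z (X ∩ H) ∧ x ∉ Z}
  have hcard : (G ∪ Finset.univ.image fun j => linForm (a j)).card ≤ G.card + k :=
    (Finset.card_union_le _ _).trans (by simpa using Finset.card_image_le.trans (by simp))
  have hzero : ∀ y, y ∈ zeroSet (↑(G ∪ Finset.univ.image fun j => linForm (a j)) :
      Set (MvPolynomial (Fin n) K)) ↔ y ∈ V ∧ y ∈ H := by
    intro y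
    simp only [zeroSet, Finset.coe_union, Finset.coe_image, Finset.coe_univ, Set.image_univ,
      Set.mem_union, Set.mem_range, Set.mem_ofPred_eq, or_imp, forall_and, forall_exists_index,
      forall_apply_eq_imp_iff, aeval_linForm, hVdef, hHdef]
  have := le_card_of_isolated (G ∪ Finset.univ.image fun j => linForm (a j)) (x := x) (E := E')
    (by
      intro g hg
      rcases Finset.mem_union.1 hg with hg | hg
      · exact hG g hg
      · obtain ⟨j, -, rfl⟩ := Finset.mem_image.1 hg
        exact ⟨1, isHomogeneous_linForm _⟩)
    ((hzero x).2 ⟨hX.2.1 hxX, hxH⟩)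
    (hE.union (isClosed_biUnion_components (hXc.inter hH) _))
    (by
      rintro (h | ⟨Z, hZ, hxZ⟩)
      · exact Set.eq_empty_iff_forall_notMem.1 h0 x ⟨⟨hxX, h⟩, hxH⟩
      · exact hZ.2 hxZ)
    (by
      intro y hy
      obtain ⟨hyV, hyH⟩ := (hzero y).1 hy
      rcases hVXE hyV with hyX | hyE
      · obtain ⟨Z, hZ, hyZ⟩ := exists_isComponent_superset (hXc.inter hH)
          (isIrreducible_singleton (x := y)) (by simpa using ⟨hyX, hyH⟩)
        by_cases hxZ : x ∈ Z
        · refine Or.inl ?_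
          by_contra hne
          refine h1 ⟨Z, hZ.2.1, hZ.1, hZ.isClosed (hXc.inter hH), {x}, ⟨by simpa using hxZ, ?_⟩,
            isIrreducible_singleton, x.isClosed_singleton⟩
          exact fun hle => hne (hle (hyZ rfl))
        · exact Or.inr (Or.inr ⟨Z, ⟨hZ, hxZ⟩, hyZ rfl⟩)
      · exact Or.inr (Or.inl hyE))
  omega

end Purity

/-! ### Noether normalization by linear forms -/

section LowerBound

variable {K : Type*} [Field K] {n : ℕ}

theorem dual_apply_eq_dotProduct (f : Module.Dual K (Fin n → K)) (v : Fin n → K) :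
    f v = (fun j => f (Pi.single j 1)) ⬝ᵥ v := by
  conv_lhs => rw [← Finset.univ_sum_single v, map_sum]
  refine Finset.sum_congr rfl fun j _ => ?_
  have : (Pi.single j (v j) : Fin n → K) = v j • Pi.single j 1 := by
    rw [← Pi.single_smul, smul_eq_mul, mul_one]
  rw [this, map_smul, smul_eq_mul, mul_comm]

theorem exists_linear_equations (W : Submodule K (Fin n → K)) {k : ℕ}
    (hW : Module.finrank K W + k = n) :
    ∃ a : Fin k → Fin n → K, ∀ v, v ∈ W ↔ ∀ j, a j ⬝ᵥ v = 0 := by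
  have h1 : Module.finrank K ((Fin n → K) ⧸ W) = Module.finrank K (Fin k → K) := by
    have := W.finrank_quotient_add_finrank
    rw [Module.finrank_fin_fun] at this ⊢
    omega
  let e := LinearEquiv.ofFinrankEq _ _ h1
  refine ⟨fun j i => (LinearMap.proj j ∘ₗ e.toLinearMap ∘ₗ W.mkQ : Module.Dual K (Fin n → K))
    (Pi.single i 1), fun v => ?_⟩
  simp only [← dual_apply_eq_dotProduct]
  rw [← Submodule.Quotient.mk_eq_zero, ← e.map_eq_zero_iff, funext_iff]
  rfl

theorem homogeneousComponent_mul_of_isHomogeneous {f g : MvPolynomial (Fin n) K} {m e : ℕ}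
    (hg : g.IsHomogeneous e) :
    homogeneousComponent (m + e) (f * g) = homogeneousComponent m f * g := by
  induction f using MvPolynomial.induction_on' with
  | add p q hp hq => rw [add_mul, map_add, hp, hq, map_add, add_mul]
  | monomial d r =>
    have h1 : (monomial d r).IsHomogeneous d.degree := isHomogeneous_monomial r rfl
    rw [homogeneousComponent_of_mem (h1.mul hg), homogeneousComponent_of_mem h1]
    by_cases h : m = d.degree
    · simp [h]
    · simp [h]

theorem homogeneousComponent_mem_coneIdeal {Z : Set (ProjSpace K n)} {f : MvPolynomial (Fin n) K}
    (hf : f ∈ coneIdeal (projBlock n) (ProjSpace.coords (K := K)) Z) (m : ℕ) :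
    homogeneousComponent m f ∈ coneIdeal (projBlock n) (ProjSpace.coords (K := K)) Z := by
  classical
  rw [mem_coneIdeal] at *
  intro x hx
  have h1 := (blockExpand_eq_zero_iff_component _ _ _).1 (hf x hx) (Finsupp.single () m)
  rw [blockExpand_eq_zero_iff_of_homogeneous (isWeightedHomogeneous_projBlock.2
    (homogeneousComponent_isHomogeneous m f)), ← h1]
  congr 1
  ext d
  rw [blockComponent, coeff_weightedHomogeneousComponent, weight_projBlock,
    coeff_homogeneousComponent]
  simp only [(Finsupp.single_injective ()).eq_iff]

/-- A graded Nakayama argument. -/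
theorem isIntegral_of_decomposition {B : Type*} [CommRing B] {π : MvPolynomial (Fin n) K →+* B}
    (hπ : Function.Surjective π) {k M : ℕ} {θ : MvPolynomial (Fin k) K →+* B}
    {ℓ : Fin k → MvPolynomial (Fin n) K} (hθC : ∀ c : K, θ (C c) = π (C c))
    (hθX : ∀ j, θ (X j) = π (ℓ j))
    (hdec : ∀ i : Fin n, ∃ h : Fin k → MvPolynomial (Fin n) K, (∀ j, (h j).IsHomogeneous M) ∧
      π (X i ^ (M + 1)) = ∑ j, π (h j * ℓ j)) : θ.IsIntegral := by
  let _ := θ.toAlgebra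
  -- A monomial of degree above `n * (M + 1)` contains some `X i ^ (M + 1)`. Replacing this power by
  -- the `h j * ℓ j` and absorbing `ℓ j` into the scalars lowers the degree by one, so these
  -- finitely many monomials generate.
  let S : Submodule (MvPolynomial (Fin k) K) (B) :=
    Submodule.span _ ((fun d : Fin n →₀ ℕ => π (monomial d 1)) ''
      {d : Fin n →₀ ℕ | d.degree ≤ n * (M + 1)})
  have hsmul : ∀ (q : MvPolynomial (Fin k) K) (z : B),
      q • z = θ q * z := fun q z => rfl
  have hS : ∀ D, ∀ f : MvPolynomial (Fin n) K, f.IsHomogeneous D → π f ∈ S := by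
    intro D
    induction D with
    | zero =>
      intro f hf
      rw [totalDegree_eq_zero_iff_eq_C.1 ((totalDegree_zero_iff_isHomogeneous _).2 hf), ← hθC, ← mul_one (θ _), ← hsmul]
      refine S.smul_mem _ (Submodule.subset_span ⟨0, by simp, ?_⟩)
      simp
    | succ D ih =>
      intro f hf
      rw [f.as_sum, map_sum]
      refine Submodule.sum_mem _ fun d hd => ?_
      have hdD : d.degree = D + 1 := by
        by_contra hne
        exact mem_support_iff.1 hd (hf.coeff_eq_zero hne)
      have hmon : π (monomial d (coeff d f)) =
          (C (coeff d f) : MvPolynomial (Fin k) K) • π (monomial d 1) := by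
        rw [hsmul, hθC, ← map_mul, C_mul_monomial, mul_one]
      rw [hmon]
      refine S.smul_mem _ ?_
      by_cases hle : d.degree ≤ n * (M + 1)
      · exact Submodule.subset_span ⟨d, hle, rfl⟩
      · obtain ⟨i, hi⟩ : ∃ i, M + 1 ≤ d i := by
          by_contra! hlt
          apply hle
          rw [Finsupp.degree_eq_sum]
          calc ∑ i, d i ≤ ∑ _i : Fin n, (M + 1) := Finset.sum_le_sum fun i _ => (hlt i).le
            _ = n * (M + 1) := by simp
        have hdi : d - Finsupp.single i (M + 1) + Finsupp.single i (M + 1) = d :=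
          tsub_add_cancel_of_le (Finsupp.single_le_iff.2 hi)
        have hdeg : (d - Finsupp.single i (M + 1)).degree + M = D := by
          have := congrArg Finsupp.degree hdi
          rw [map_add, Finsupp.degree_single, hdD] at this
          omega
        obtain ⟨h, hh, hX⟩ := hdec i
        have h1 : (monomial d 1 : MvPolynomial (Fin n) K) =
            monomial (d - Finsupp.single i (M + 1)) 1 * X i ^ (M + 1) := by
          rw [X_pow_eq_monomial, monomial_mul, mul_one, hdi]
        rw [h1, map_mul, hX, Finset.mul_sum]
        refine Submodule.sum_mem _ fun j _ => ?_
        rw [← map_mul, ← mul_assoc, mul_comm, map_mul, ← hθX, ← hsmul]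
        refine S.smul_mem _ (ih _ ?_)
        rw [← hdeg]
        exact (isHomogeneous_monomial _ rfl).mul (hh j)
  have htop : S = ⊤ := by
    rw [eq_top_iff]
    rintro z -
    obtain ⟨f, rfl⟩ := hπ z
    rw [← sum_homogeneousComponent f, map_sum]
    exact Submodule.sum_mem _ fun D _ => hS D _ (homogeneousComponent_isHomogeneous D f)
  have hfinite : Module.Finite (MvPolynomial (Fin k) K) (B) :=
    ⟨⟨((Finsupp.finite_of_degree_le (n * (M + 1))).image
      fun d : Fin n →₀ ℕ => π (monomial d 1)).toFinset, by simpa [S] using htop⟩⟩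
  exact RingHom.IsIntegral.of_finite (f := θ) hfinite

/-- The coordinate ring of `Z` is integral over the subring generated
by linear forms without common zeros on `Z`. -/
theorem isIntegral_of_no_zeros [IsAlgClosed K] {Z : Set (ProjSpace K n)} (hZ : IsClosed Z) {k : ℕ}
    (a : Fin k → Fin n → K) (ha : ∀ x ∈ Z, ¬ ∀ j, a j ⬝ᵥ x.coords = 0) :
    ((Ideal.Quotient.mk (coneIdeal (projBlock n) (ProjSpace.coords (K := K)) Z)).comp
      (aeval fun j => linForm (a j) :
        MvPolynomial (Fin k) K →ₐ[K] MvPolynomial (Fin n) K).toRingHom).IsIntegral := by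
  have : Infinite K := IsAlgClosed.instInfinite
  set I := coneIdeal (projBlock n) (ProjSpace.coords (K := K)) Z with hI
  set θ := (Ideal.Quotient.mk I).comp (aeval fun j => linForm (a j) :
        MvPolynomial (Fin k) K →ₐ[K] MvPolynomial (Fin n) K).toRingHom with hθ
  have hθC : ∀ c : K, θ (C c) = Ideal.Quotient.mk I (C c) := by
    intro c
    simp [hθ, MvPolynomial.algebraMap_eq]
  have hθX : ∀ j, θ (X j) = Ideal.Quotient.mk I (linForm (a j)) := by
    intro j
    simp [hθ]
  obtain ⟨M, hM⟩ := exists_pow_mem_of_no_zeros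
    (I := I ⊔ Ideal.span (Set.range fun j => linForm (a j))) (by
      intro v hv
      by_contra hv0
      refine ha _ (projPoint_mem hZ hv0 fun f hf => hv f (Ideal.mem_sup_left hf)) fun j => ?_
      obtain ⟨c, -, hc⟩ := exists_coords_projPoint v hv0
      have := hv _ (Ideal.mem_sup_right (Ideal.subset_span ⟨j, rfl⟩))
      rw [aeval_linForm] at this
      rw [hc, dotProduct_smul, this, smul_zero])
  have hdec : ∀ i : Fin n, ∃ h : Fin k → MvPolynomial (Fin n) K, (∀ j, (h j).IsHomogeneous M) ∧
      Ideal.Quotient.mk I (X i ^ (M + 1)) = ∑ j, Ideal.Quotient.mk I (h j * linForm (a j)) := by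
    intro i
    have h1 : (X i : MvPolynomial (Fin n) K) ^ (M + 1) ∈
        I ⊔ Ideal.span (Set.range fun j => linForm (a j)) := by
      rw [pow_succ]
      exact Ideal.mul_mem_right _ _ (hM i)
    obtain ⟨z, hz, y, hy, hzy⟩ := Submodule.mem_sup.1 h1
    obtain ⟨h, rfl⟩ := Ideal.mem_span_range_iff_exists_fun.1 hy
    refine ⟨fun j => homogeneousComponent M (h j),
      fun j => homogeneousComponent_isHomogeneous M _, ?_⟩
    -- Comparing parts of degree `M + 1` makes the cofactors homogeneous of degree `M`; the ideal
    -- `I` is homogeneous, so the correction term stays in it.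
    have h2 := congrArg (homogeneousComponent (M + 1)) hzy
    rw [map_add, map_sum, homogeneousComponent_eq_self (isHomogeneous_X_pow i (M + 1))] at h2
    simp only [homogeneousComponent_mul_of_isHomogeneous (isHomogeneous_linForm _)] at h2
    rw [← h2, map_add, Ideal.Quotient.eq_zero_iff_mem.2 (homogeneousComponent_mem_coneIdeal hz _),
      zero_add, map_sum]
  exact isIntegral_of_decomposition Ideal.Quotient.mk_surjective hθC hθX hdec

end LowerBound

/-! ### The degree bounds the Hilbert function from below -/

section DegreeBound

variable {K : Type*} [Field K] {n : ℕ}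

/-- An element that takes `m` distinct values over one point of an integrally closed base
satisfies no relation of degree less than `m`. -/
theorem eq_zero_of_integral_relation {A B : Type*} [CommRing A] [IsDomain A]
    [IsIntegrallyClosed A] [CommRing B] [IsDomain B] {θ : A →+* B} (hint : θ.IsIntegral)
    (hinj : Function.Injective θ) {m : ℕ} (ψ : A →+* K) (φ : Fin m → B →+* K)
    (hφ : ∀ i a, φ i (θ a) = ψ a) (b : B) (hb : Function.Injective fun i => φ i b)
    (f : Fin m → A) (hf : ∑ i, θ (f i) * b ^ (i : ℕ) = 0) : f = 0 := by
  classical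
  let _ := θ.toAlgebra
  have hAB : algebraMap A B = θ := rfl
  have : FaithfulSMul A B := (faithfulSMul_iff_algebraMap_injective A B).2 hinj
  have hbint : IsIntegral A b := hint b
  set P : Polynomial A := ∑ i, Polynomial.C (f i) * Polynomial.X ^ (i : ℕ) with hP
  have hPb : Polynomial.aeval b P = 0 := by
    simpa [hP, hAB] using hf
  have hPdeg : P.degree < m := Polynomial.degree_sum_fin_lt f
  have hP0 : P = 0 := by
    by_contra hne
    have hdeg := (minpoly.IsIntegrallyClosed.degree_le_of_ne_zero hne hPb).trans_lt hPdeg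
    have hmon := minpoly.monic hbint
    -- Over an integrally closed base the minimal polynomial has degree at most that of any nonzero
    -- relation, hence less than `m`. Its specialization has the `m` distinct roots `φ i b`,
    -- impossible for a monic polynomial.
    have hq : ((minpoly A b).map ψ) = 0 := by
      refine Polynomial.eq_zero_of_degree_lt_of_eval_finset_eq_zero
        (Finset.univ.image fun i => φ i b) ?_ ?_
      · rw [Finset.card_image_of_injective _ hb, Finset.card_univ, Fintype.card_fin,
          hmon.degree_map]
        exact hdeg
      · intro z hz
        obtain ⟨i, -, rfl⟩ := Finset.mem_image.1 hz
        have hψ : ψ = (φ i).comp (algebraMap A B) := RingHom.ext fun a => (hφ i a).symm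
        rw [Polynomial.eval_map, hψ, ← Polynomial.hom_eval₂, ← Polynomial.aeval_def,
          minpoly.aeval, map_zero]
    exact (hmon.map ψ).ne_zero hq
  funext i
  have := congrArg (fun q : Polynomial A => q.coeff i) hP0
  simpa [hP, Polynomial.finsetSum_coeff, Polynomial.coeff_C_mul, Polynomial.coeff_X_pow,
    Fin.val_inj] using this

theorem aeval_smul_eq_zero_of_mem_coneIdeal [Infinite K] {Z : Set (ProjSpace K n)}
    {f : MvPolynomial (Fin n) K}
    (hf : f ∈ coneIdeal (projBlock n) (ProjSpace.coords (K := K)) Z) {x : ProjSpace K n}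
    (hx : x ∈ Z) (c : K) : aeval (c • x.coords) f = 0 :=
  (blockExpand_eq_zero_iff _ _ _).1 (mem_coneIdeal.1 hf x hx) fun _ => c

/-- The forms map the cone over `Z` onto `K ^ (k + 1)`: the `k` equations of the line through `u`
pull back to linear forms with a common zero on `Z`, whose image is a nonzero point of that line. A
polynomial relation between the forms therefore vanishes everywhere. -/
theorem injective_of_no_zeros [IsAlgClosed K] {Z : Set (ProjSpace K n)} {k : ℕ}
    (hZ : HasChain k Z) (a : Fin (k + 1) → Fin n → K)
    (ha : ∀ x ∈ Z, ¬ ∀ j, a j ⬝ᵥ x.coords = 0) :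
    Function.Injective ((Ideal.Quotient.mk
      (coneIdeal (projBlock n) (ProjSpace.coords (K := K)) Z)).comp
      (aeval fun j => linForm (a j) :
        MvPolynomial (Fin (k + 1)) K →ₐ[K] MvPolynomial (Fin n) K).toRingHom) := by
  have : Infinite K := IsAlgClosed.instInfinite
  rw [injective_iff_map_eq_zero]
  intro f hf
  have hf' := Ideal.Quotient.eq_zero_iff_mem.1 hf
  have key : ∀ u : Fin (k + 1) → K, ∃ x ∈ Z, ∃ c : K, u = fun j => c * a j ⬝ᵥ x.coords := by
    intro u
    by_cases hu : u = 0
    · obtain ⟨x, hx, -⟩ := hZ.exists_mem_of_linear 0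
      exact ⟨x, hx, 0, by ext; simp [hu]⟩
    · obtain ⟨e, he⟩ := exists_linear_equations (K ∙ u) (k := k)
        (by rw [finrank_span_singleton hu, add_comm])
      obtain ⟨x, hx, hx'⟩ := hZ.exists_mem_of_linear fun i => ∑ j, e i j • a j
      have h1 : (fun j => a j ⬝ᵥ x.coords) ∈ (K ∙ u) := by
        rw [he]
        intro i
        rw [← hx' i, sum_dotProduct]
        simp [dotProduct, Finset.mul_sum, mul_assoc]
      obtain ⟨c, hc⟩ := Submodule.mem_span_singleton.1 h1
      have hc0 : c ≠ 0 := by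
        rintro rfl
        refine ha x hx fun j => ?_
        simpa using (congrFun hc j).symm
      refine ⟨x, hx, c⁻¹, funext fun j => ?_⟩
      rw [← congrFun hc j]
      simp [hc0]
  refine MvPolynomial.funext fun u => ?_
  obtain ⟨x, hx, c, rfl⟩ := key u
  have h1 := aeval_smul_eq_zero_of_mem_coneIdeal hf' hx c
  have h2 : aeval (c • x.coords) ((aeval fun j => linForm (a j) :
        MvPolynomial (Fin (k + 1)) K →ₐ[K] MvPolynomial (Fin n) K) f) =
      aeval (fun j => c * a j ⬝ᵥ x.coords) f := by
    rw [← AlgHom.comp_apply, comp_aeval]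
    simp
  rw [map_zero, ← coe_aeval_eq_eval]
  exact h2.symm.trans h1

/-- The exponents of `k` variables range freely up to `q`, and the first variable takes up the
remaining degree. -/
theorem pow_le_finrank_homogeneousSubmodule {k q N : ℕ} (h : k * q ≤ N) :
    (q + 1) ^ k ≤ Module.finrank K (homogeneousSubmodule (Fin (k + 1)) K N) := by
  have hsum : ∀ e : Fin k → Fin (q + 1), ∑ i, (e i : ℕ) ≤ N := fun e =>
    (Finset.sum_le_sum fun i _ => Nat.le_of_lt_succ (e i).2).trans (by simpa using h)
  let d : (Fin k → Fin (q + 1)) → Fin (k + 1) →₀ ℕ := fun e =>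
    Finsupp.equivFunOnFinite.symm (Fin.cons (N - ∑ i, (e i : ℕ)) fun i => (e i : ℕ))
  have hd : ∀ e, (d e).degree = N := by
    intro e
    have := hsum e
    simp [Finsupp.degree_eq_sum, Fin.sum_univ_succ, d]
    omega
  have hinj : Function.Injective d := by
    intro e e' hee
    funext i
    have := DFunLike.congr_fun hee i.succ
    simpa [d, Fin.val_inj] using this
  have hli : LinearIndependent K fun e => (⟨monomial (d e) 1, isHomogeneous_monomial _ (hd e)⟩ :
      homogeneousSubmodule (Fin (k + 1)) K N) := by
    refine LinearIndependent.of_comp (Submodule.subtype _) ?_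
    exact (basisMonomials (Fin (k + 1)) K).linearIndependent.comp d hinj
  simpa using hli.fintype_card_le_finrank

theorem isHomogeneous_aeval_linForm {k N : ℕ} (a : Fin k → Fin n → K)
    {f : MvPolynomial (Fin k) K} (hf : f.IsHomogeneous N) :
    (aeval (fun j => linForm (a j)) f : MvPolynomial (Fin n) K).IsHomogeneous N := by
  have := IsHomogeneous.aeval hf (fun j => linForm (a j)) fun j => isHomogeneous_linForm (a j)
  simpa using this

/-- The degree bounds the Hilbert function from below. -/
theorem card_mul_pow_le_hilbert [IsAlgClosed K] {Z : Set (ProjSpace K n)} (hZc : IsClosed Z)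
    (hZi : IsIrreducible Z) {k : ℕ} (hZ : HasChain k Z) {W : Submodule K (Fin n → K)}
    (hW : Module.finrank K W + k = n) {m : ℕ} (x : Fin m → ProjSpace K n)
    (hx : Function.Injective x) (hxW : Set.range x = linearSection Z W) {N q : ℕ}
    (hN : m + k * q ≤ N) : m * (q + 1) ^ k ≤ hilbert Z N := by
  have : Infinite K := IsAlgClosed.instInfinite
  rcases Nat.eq_zero_or_pos m with rfl | hm
  · simp
  obtain ⟨a, ha⟩ := exists_linear_equations W hW
  have hxZ : ∀ i, x i ∈ Z ∧ ∀ j, a j ⬝ᵥ (x i).coords = 0 := by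
    intro i
    have : x i ∈ linearSection Z W := hxW ▸ Set.mem_range_self i
    exact ⟨this.1, (ha _).1 this.2⟩
  obtain ⟨a₀, ha₀⟩ := exists_forall_dotProduct_ne_zero (fun i => (x i).coords)
    fun i => (x i).coords_ne_zero
  let α : Fin (k + 1) → Fin n → K := Fin.cons a₀ a
  have hα : ∀ y ∈ Z, ¬ ∀ j, α j ⬝ᵥ y.coords = 0 := by
    intro y hy hall
    have hyW : y ∈ Set.range x := by
      rw [hxW]
      exact ⟨hy, (ha _).2 fun j => hall j.succ⟩
    obtain ⟨i, rfl⟩ := hyW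
    exact ha₀ i (hall 0)
  -- Normalized by `a₀ = 1`, all `m` points of the section lie over the same point `(1, 0, …, 0)` of
  -- the base of the normalization; `b` is then chosen to separate them.
  let v : Fin m → Fin n → K := fun i => (a₀ ⬝ᵥ (x i).coords)⁻¹ • (x i).coords
  have hv : ∀ i j, i ≠ j → v i - v j ≠ 0 := by
    intro i j hij h0
    refine hij (hx (ProjSpace.eq_of_coords
      (a := (a₀ ⬝ᵥ (x i).coords) * (a₀ ⬝ᵥ (x j).coords)⁻¹) ?_))
    rw [sub_eq_zero] at h0
    have := congrArg ((a₀ ⬝ᵥ (x i).coords) • ·) h0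
    simp only [v, smul_smul, mul_inv_cancel₀ (ha₀ i), one_smul] at this
    exact this
  obtain ⟨b, hb⟩ := exists_forall_dotProduct_ne_zero
    (fun ij : {ij : Fin m × Fin m // ij.1 ≠ ij.2} => v ij.1.1 - v ij.1.2)
    fun ij => hv _ _ ij.2
  set I := coneIdeal (projBlock n) (ProjSpace.coords (K := K)) Z with hI
  have : I.IsPrime := isConeCoords_proj.isPrime_coneIdeal hZi
  have hrel := eq_zero_of_integral_relation (isIntegral_of_no_zeros hZc α hα)
    (injective_of_no_zeros hZ α hα) (m := m)
    (aeval (Pi.single 0 1 : Fin (k + 1) → K)).toRingHom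
    (fun i => Ideal.Quotient.lift I (aeval (v i)).toRingHom fun f hf =>
      aeval_smul_eq_zero_of_mem_coneIdeal hf (hxZ i).1 _) (by
      intro i f
      have h1 : (fun j => α j ⬝ᵥ v i) = Pi.single 0 1 := by
        funext j
        induction j using Fin.cases with
        | zero => simp [α, v, ha₀ i]
        | succ j => simp [α, v, (hxZ i).2 j]
      change aeval (v i) ((aeval fun j => linForm (α j) :
        MvPolynomial (Fin (k + 1)) K →ₐ[K] MvPolynomial (Fin n) K) f) = _
      rw [← AlgHom.comp_apply, comp_aeval]
      simp [h1]) (Ideal.Quotient.mk I (linForm b)) (by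
      intro i j hij
      by_contra hne
      refine hb ⟨(i, j), hne⟩ ?_
      have h1 : aeval (v i) (linForm b) = aeval (v j) (linForm b) := hij
      rw [aeval_linForm, aeval_linForm] at h1
      rw [dotProduct_sub, h1, sub_self])
  obtain ⟨N', rfl⟩ : ∃ N', N = N' + (m - 1) := ⟨N - (m - 1), by omega⟩
  let H := homogeneousSubmodule (Fin (k + 1)) K N'
  let A : MvPolynomial (Fin (k + 1)) K →ₐ[K] MvPolynomial (Fin n) K :=
    aeval fun j => linForm (α j)
  -- The elements `∑ fᵢ bⁱ` are homogenized by powers of the form `a₀`. They stay independent on `Z`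
  -- because `b` satisfies no relation of degree below `m`, so they contribute `m` copies of `H`.
  let Ψ₀ : (Fin m → H) →ₗ[K] MvPolynomial (Fin n) K :=
    ∑ i : Fin m, LinearMap.mulRight K (A (X 0) ^ (m - 1 - (i : ℕ)) * linForm b ^ (i : ℕ)) ∘ₗ
      A.toLinearMap ∘ₗ H.subtype ∘ₗ LinearMap.proj i
  have hΨ₀ : ∀ f, Ψ₀ f = ∑ i, A (f i).1 * (A (X 0) ^ (m - 1 - (i : ℕ)) * linForm b ^ (i : ℕ)) := by
    intro f
    simp [Ψ₀, LinearMap.sum_apply, mul_assoc]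
  have hhom : ∀ f, Ψ₀ f ∈ homogeneousSubmodule (Fin n) K (N' + (m - 1)) := by
    intro f
    rw [hΨ₀]
    refine Submodule.sum_mem _ fun i _ => ?_
    refine IsHomogeneous.mul (isHomogeneous_aeval_linForm α (f i).2) ?_
    have h1 := ((isHomogeneous_aeval_linForm α (isHomogeneous_X K 0)).pow (m - 1 - (i : ℕ))).mul
      ((isHomogeneous_linForm b).pow (i : ℕ))
    have h2 : 1 * (m - 1 - (i : ℕ)) + 1 * (i : ℕ) = m - 1 := by omega
    rwa [h2] at h1
  let Ψ : (Fin m → H) →ₗ[K] homogeneousSubmodule (Fin n) K (N' + (m - 1)) :=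
    Ψ₀.codRestrict _ hhom
  have hker : LinearMap.ker (restrictForms Z (N' + (m - 1)) ∘ₗ Ψ) = ⊥ := by
    rw [LinearMap.ker_eq_bot']
    intro f hf
    have hmem : Ψ₀ f ∈ I := by
      rw [mem_coneIdeal]
      intro y hy
      rw [blockExpand_eq_zero_iff_of_homogeneous (isWeightedHomogeneous_projBlock.2 (hhom f))]
      exact congrFun hf ⟨y, hy⟩
    have h1 := hrel (fun i => (f i).1 * X 0 ^ (m - 1 - (i : ℕ))) (by
      rw [← Ideal.Quotient.eq_zero_iff_mem, hΨ₀, map_sum] at hmem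
      rw [← hmem]
      refine Finset.sum_congr rfl fun i _ => ?_
      change Ideal.Quotient.mk I (A _) * _ = _
      simp only [map_mul, map_pow]
      ring)
    funext i
    have h2 := congrFun h1 i
    exact Subtype.ext ((mul_eq_zero.1 h2).resolve_right (pow_ne_zero _ (X_ne_zero _)))
  have h1 := LinearMap.finrank_range_of_inj (LinearMap.ker_eq_bot.1 hker)
  have h2 := Submodule.finrank_mono (LinearMap.range_comp_le_range Ψ (restrictForms Z (N' + (m - 1))))
  rw [h1, Module.finrank_pi_fintype] at h2
  have h3 : (q + 1) ^ k ≤ Module.finrank K H := pow_le_finrank_homogeneousSubmodule (by omega)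
  calc m * (q + 1) ^ k ≤ m * Module.finrank K H := Nat.mul_le_mul_left _ h3
    _ ≤ hilbert Z (N' + (m - 1)) := by simpa [hilbert] using h2

end DegreeBound

/-! ### The Bezout bound for the degrees of the components -/

section Bezout

variable {K : Type*} [Field K] {n : ℕ}

/-- The Hilbert function of `Y` grows at least like that of `m` linear spaces of dimension `k`. -/
def HilbertGrowth (k m : ℕ) (Y : Set (ProjSpace K n)) : Prop :=
  ∃ E, ∀ N q, E + k * q ≤ N → m * (q + 1) ^ k ≤ hilbert Y N

theorem HilbertGrowth.of_le {k m m' : ℕ} {Y : Set (ProjSpace K n)} (h : HilbertGrowth k m Y)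
    (hm : m' ≤ m) : HilbertGrowth k m' Y := by
  obtain ⟨E, hE⟩ := h
  exact ⟨E, fun N q hN => (Nat.mul_le_mul_right _ hm).trans (hE N q hN)⟩

theorem HilbertGrowth.mono {k m : ℕ} {Y Y' : Set (ProjSpace K n)} (h : HilbertGrowth k m Y)
    (hY : Y ⊆ Y') : HilbertGrowth k m Y' := by
  obtain ⟨E, hE⟩ := h
  exact ⟨E, fun N q hN => (hE N q hN).trans (hilbert_mono hY N)⟩

/-- Evaluate at `q = E` and `N = E + k * E`, where `N + 1 ≤ (k + 1) * (E + 1)`, and cancel `(E + 1)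
^ k`. -/
theorem HilbertGrowth.le_of_forall_le {k m c : ℕ} {Y : Set (ProjSpace K n)}
    (h : HilbertGrowth k m Y) (hc : ∀ N, hilbert Y N ≤ c * (N + 1) ^ k) :
    m ≤ c * (k + 1) ^ k := by
  obtain ⟨E, hE⟩ := h
  have h1 := (hE (E + k * E) E le_rfl).trans (hc _)
  have h2 : E + k * E + 1 ≤ (k + 1) * (E + 1) := by nlinarith
  have h3 : m * (E + 1) ^ k ≤ c * (k + 1) ^ k * (E + 1) ^ k := by
    rw [mul_assoc, ← mul_pow]
    exact h1.trans (Nat.mul_le_mul_left _ (Nat.pow_le_pow_left h2 k))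
  exact Nat.le_of_mul_le_mul_right h3 (by positivity)

theorem exists_form_of_notMem {Y : Set (ProjSpace K n)} (hY : IsClosed Y) {x : ProjSpace K n}
    (hx : x ∉ Y) : ∃ (g : MvPolynomial (Fin n) K) (e : ℕ), g.IsHomogeneous e ∧
      (∀ y ∈ Y, aeval y.coords g = 0) ∧ aeval x.coords g ≠ 0 := by
  obtain ⟨A, hA, rfl⟩ := isClosed_iff_isClosedOver.1 hY
  simp only [Set.mem_ofPred_eq, not_forall] at hx
  obtain ⟨g, hg, hgx⟩ := hx
  obtain ⟨e, he⟩ := hA g hg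
  exact ⟨g, e, he, fun y hy => hy g hg, hgx⟩

/-- By irreducibility a new member `Z` is not covered by the others. Multiplying by a form that
vanishes on them but not on all of `Z` adds the Hilbert function of `Z`, shifted by a constant that
`E` absorbs. -/
theorem HilbertGrowth.sUnion {k : ℕ} (F : Finset (Set (ProjSpace K n)))
    (hcl : ∀ X ∈ F, IsClosed X) (hirr : ∀ X ∈ F, IsIrreducible X)
    (hanti : ∀ X ∈ F, ∀ Y ∈ F, X ⊆ Y → X = Y) (m : Set (ProjSpace K n) → ℕ)
    (h : ∀ X ∈ F, HilbertGrowth k (m X) X) :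
    HilbertGrowth k (∑ X ∈ F, m X) (⋃₀ (F : Set (Set (ProjSpace K n)))) := by
  classical
  induction F using Finset.induction_on with
  | empty => exact ⟨0, by simp⟩
  | insert Z F hZF ih =>
    simp only [Finset.forall_mem_insert] at hcl hirr h
    obtain ⟨E, hE⟩ := ih hcl.2 hirr.2
      (fun X hX Y hY => hanti X (Finset.mem_insert_of_mem hX) Y (Finset.mem_insert_of_mem hY)) h.2
    obtain ⟨E', hE'⟩ := h.1
    have hFc : IsClosed (⋃₀ (F : Set (Set (ProjSpace K n)))) :=
      Set.sUnion_eq_biUnion (s := (F : Set (Set (ProjSpace K n)))) ▸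
        F.finite_toSet.isClosed_biUnion hcl.2
    have hnot : ¬ Z ⊆ ⋃₀ (F : Set (Set (ProjSpace K n))) := by
      intro hsub
      obtain ⟨X, hX, hZX⟩ := isIrreducible_iff_sUnion_isClosed.1 hirr.1 F hcl.2 hsub
      exact hZF (hanti Z (Finset.mem_insert_self _ _) X (Finset.mem_insert_of_mem hX) hZX ▸ hX)
    obtain ⟨x, hxZ, hx⟩ := Set.not_subset.1 hnot
    obtain ⟨g, e, hg, hgF, hgx⟩ := exists_form_of_notMem hFc hx
    rw [Finset.sum_insert hZF, Finset.coe_insert, Set.sUnion_insert]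
    refine ⟨E + E' + e, fun N q hN => ?_⟩
    obtain ⟨N', rfl⟩ : ∃ N', N = N' + e := ⟨N - e, by omega⟩
    have h1 := hE (N' + e) q (by omega)
    have h2 := hE' N' q (by omega)
    have h3 := hilbert_add_le (Y := Z ∪ ⋃₀ (F : Set (Set (ProjSpace K n)))) (Z := Z)
      Set.subset_union_right hg hgF N' fun f hf hfg =>
        forall_aeval_eq_zero_of_mul hirr.1 hf hg (fun y hy => hfg y (Or.inl hy)) ⟨x, hxZ, hgx⟩
    rw [add_mul]
    omega

/-- The union of the components of the zero set of `G` that contain a member of `F`. -/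
def selectedUnion (G : Finset (MvPolynomial (Fin n) K)) (F : Set (Set (ProjSpace K n))) :
    Set (ProjSpace K n) :=
  ⋃₀ {X | IsComponent X (zeroSet (G : Set (MvPolynomial (Fin n) K))) ∧ ∃ Z ∈ F, Z ⊆ X}

/-- Multiplication by a linear form that vanishes identically on none of the selected components is
injective on restrictions. -/
theorem hilbert_selectedUnion_le_succ [IsAlgClosed K] {G : Finset (MvPolynomial (Fin n) K)}
    (hG : ∀ g ∈ G, ∃ m, g.IsHomogeneous m) (F : Set (Set (ProjSpace K n))) (N : ℕ) :
    hilbert (selectedUnion G F) N ≤ hilbert (selectedUnion G F) (N + 1) := by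
  have : Infinite K := IsAlgClosed.instInfinite
  set S := {X | IsComponent X (zeroSet (G : Set (MvPolynomial (Fin n) K))) ∧ ∃ Z ∈ F, Z ⊆ X}
    with hS
  have : Finite S := ((finite_isComponent (isClosed_zeroSet hG)).subset fun X hX => hX.1).to_subtype
  choose x hx using fun X : S => X.2.1.1.1
  obtain ⟨a, ha⟩ := exists_forall_dotProduct_ne_zero (fun X : S => (x X).coords)
    fun X => (x X).coords_ne_zero
  have h1 := hilbert_add_le (Y := selectedUnion G F) (Z := selectedUnion G F) (Set.empty_subset _)
    (isHomogeneous_linForm a) (by simp) N (by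
      rintro f hf hfg y ⟨X, hX, hyX⟩
      exact forall_aeval_eq_zero_of_mul hX.1.1 hf (isHomogeneous_linForm a)
        (fun z hz => hfg z ⟨X, hX, hz⟩) ⟨x ⟨X, hX⟩, hx ⟨X, hX⟩, by simpa using ha ⟨X, hX⟩⟩ y hyX)
  omega

/-- Components of dimension `k` of a set defined in degree `D` lie in a set
with few components, cut out by at most `n - 1 - k` equations. -/
theorem exists_selectedUnion_bound [IsAlgClosed K] (hn : 1 ≤ n) {T : Set (ProjSpace K n)} {D k : ℕ}
    (hT : IsZeroSetOfDegree K D T) {F : Set (Set (ProjSpace K n))}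
    (hF : ∀ Z ∈ F, IsComponent Z T) (hk : ∀ Z ∈ F, ¬ IsChainTop (k + 1) Z) :
    ∀ i ≤ n - 1 - k, ∃ G : Finset (MvPolynomial (Fin n) K), G.card ≤ i ∧
      (∀ g ∈ G, g.IsHomogeneous D ∧ ∀ x ∈ T, aeval x.coords g = 0) ∧
      ∀ N, hilbert (selectedUnion G F) N ≤ (D + 1) ^ (n * i) * (N + 1) ^ (n - 1 - i) := by
  classical
  intro i
  induction i with
  | zero =>
    intro _
    exact ⟨∅, le_rfl, by simp, fun N => by simpa using hilbert_le_pow hn _ N⟩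
  | succ i ih =>
    intro hi
    obtain ⟨G, hcard, hG, hbound⟩ := ih (by omega)
    have hGh : ∀ g ∈ G, ∃ m, g.IsHomogeneous m := fun g hg => ⟨D, (hG g hg).1⟩
    set S := {X | IsComponent X (zeroSet (G : Set (MvPolynomial (Fin n) K))) ∧ ∃ Z ∈ F, Z ⊆ X}
      with hS
    have : Finite S :=
      ((finite_isComponent (isClosed_zeroSet hGh)).subset fun X hX => hX.1).to_subtype
    -- A selected component inside `T` would equal the member of `F` that it contains, but it is cut
    -- out by at most `i < n - 1 - k` equations and so has dimension above `k`.
    have hnot : ∀ X : S, ∃ x, x ∈ X.1 ∧ x ∉ T := by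
      rintro ⟨X, hX, Z, hZ, hZX⟩
      by_contra! hsub
      obtain rfl := (hF Z hZ).2.2 X hX.1 hsub hZX
      exact hk X hZ ((hX.isChainTop hGh).of_le (by omega))
    choose x hxX hxT using hnot
    obtain ⟨A, hA, hTA⟩ := hT
    let P : Submodule K (MvPolynomial (Fin n) K) :=
      homogeneousSubmodule (Fin n) K D ⊓ ⨅ y ∈ T, LinearMap.ker (aeval y.coords).toLinearMap
    have hP : ∀ g, g ∈ P ↔ g.IsHomogeneous D ∧ ∀ y ∈ T, aeval y.coords g = 0 := by
      intro g
      simp [P, Submodule.mem_iInf]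
    have : Infinite K := IsAlgClosed.instInfinite
    obtain ⟨g, hgP, hgx⟩ := Module.Dual.exists_forall_mem_ne_zero_of_forall_exists P
      (fun X : S => (aeval (x X).coords).toLinearMap) (by
        intro X
        have h1 := hxT X
        rw [hTA] at h1
        simp only [Set.mem_ofPred_eq, not_forall] at h1
        obtain ⟨f, hf, hfx⟩ := h1
        obtain ⟨m, hm, hfm⟩ := hA f hf
        obtain ⟨j, hj⟩ := Function.ne_iff.1 (x X).coords_ne_zero
        -- Padding by a power of a coordinate that is nonzero at the chosen point brings the
        -- equation to degree exactly `D`.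
        refine ⟨f * MvPolynomial.X j ^ (D - m), (hP _).2 ⟨?_, fun y hy => ?_⟩, ?_⟩
        · have := hfm.mul (isHomogeneous_X_pow (R := K) j (D - m))
          rwa [Nat.add_sub_cancel' hm] at this
        · rw [hTA] at hy
          rw [map_mul, hy f hf, zero_mul]
        · simpa using ⟨hfx, fun h => absurd h hj⟩)
    rw [hP] at hgP
    have hG' : ∀ g' ∈ insert g G, g'.IsHomogeneous D ∧ ∀ x ∈ T, aeval x.coords g' = 0 := by
      simpa using ⟨hgP, hG⟩
    refine ⟨insert g G, (Finset.card_insert_le _ _).trans (by omega), hG', fun N => ?_⟩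
    have hstep : ∀ N, hilbert (selectedUnion (insert g G) F) (N + D) +
        hilbert (selectedUnion G F) N ≤ hilbert (selectedUnion G F) (N + D) := by
      intro N
      refine hilbert_add_le ?_ hgP.1 ?_ N ?_
      · rintro y ⟨X', ⟨hX', Z, hZ, hZX'⟩, hy⟩
        obtain ⟨X, hX, hX'X⟩ := exists_isComponent_superset (isClosed_zeroSet hGh) hX'.1
          (hX'.2.1.trans fun z hz g' hg' => hz g' (by simpa using Or.inr hg'))
        exact ⟨X, ⟨hX, Z, hZ, hZX'.trans hX'X⟩, hX'X hy⟩
      · rintro y ⟨X', ⟨hX', -⟩, hy⟩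
        exact hX'.2.1 hy g (by simp)
      · rintro f hf hfg y ⟨X, hX, hyX⟩
        exact forall_aeval_eq_zero_of_mul hX.1.1 hf hgP.1
          (fun z hz => hfg z ⟨X, hX, hz⟩) ⟨x ⟨X, hX⟩, hxX ⟨X, hX⟩, hgx ⟨X, hX⟩⟩ y hyX
    have hexp : n - 1 - i = n - 1 - (i + 1) + 1 := by omega
    rw [hexp] at hbound
    refine (growth_step (hilbert_selectedUnion_le_succ (fun g' hg' => ⟨D, (hG' g' hg').1⟩) F)
      hstep hbound N).trans (Nat.mul_le_mul_right _ ?_)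
    -- The step costs a factor `(D + 1) ^ (n - 1 - i)`, absorbed in the extra `(D + 1) ^ n`.
    rw [← pow_add]
    exact Nat.pow_le_pow_right (Nat.succ_pos D) (by rw [mul_add, mul_one]; omega)

theorem sum_le_of_hilbertGrowth [IsAlgClosed K] (hn : 1 ≤ n) {T : Set (ProjSpace K n)} {D k : ℕ}
    (hkn : k ≤ n - 1) (hT : IsZeroSetOfDegree K D T) (F : Finset (Set (ProjSpace K n)))
    (hF : ∀ Z ∈ F, IsComponent Z T) (hk : ∀ Z ∈ F, ¬ IsChainTop (k + 1) Z)
    (m : Set (ProjSpace K n) → ℕ) (hm : ∀ Z ∈ F, HilbertGrowth k (m Z) Z) :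
    ∑ Z ∈ F, m Z ≤ (D + 1) ^ (n * n) * n ^ n := by
  obtain ⟨G, -, hG, hbound⟩ := exists_selectedUnion_bound hn hT hF hk (n - 1 - k) le_rfl
  have hGh : ∀ g ∈ G, ∃ m, g.IsHomogeneous m := fun g hg => ⟨D, (hG g hg).1⟩
  have hTc : IsClosed T := isClosed_iff_isClosedOver.2 hT.isClosedOver
  have hsub : ⋃₀ (F : Set (Set (ProjSpace K n))) ⊆ selectedUnion G F := by
    rintro y ⟨Z, hZ, hy⟩
    obtain ⟨X, hX, hZX⟩ := exists_isComponent_superset (isClosed_zeroSet hGh) (hF Z hZ).1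
      ((hF Z hZ).2.1.trans fun z hz g hg => (hG g hg).2 z hz)
    exact ⟨X, ⟨hX, Z, hZ, hZX⟩, hZX hy⟩
  have h1 := (HilbertGrowth.sUnion F (fun X hX => (hF X hX).isClosed hTc) (fun X hX => (hF X hX).1)
    (fun X hX Y hY hXY => ((hF X hX).2.2 Y (hF Y hY).1 (hF Y hY).2.1 hXY).symm) m hm).mono hsub
  have hexp : n - 1 - (n - 1 - k) = k := by omega
  rw [hexp] at hbound
  refine (h1.le_of_forall_le hbound).trans (Nat.mul_le_mul
    (Nat.pow_le_pow_right (Nat.succ_pos D) (Nat.mul_le_mul_left _ (by omega))) ?_)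
  exact (Nat.pow_le_pow_left (by omega) k).trans (Nat.pow_le_pow_right (by omega) (by omega))

/-- The degree is a supremum not yet known to be finite, so a section with at least `m` points is
extracted for each finite `m` below it. -/
theorem hilbertGrowth_of_le_degree [IsAlgClosed K] {Z : Set (ProjSpace K n)} (hZc : IsClosed Z)
    (hZi : IsIrreducible Z) {k : ℕ} (hZ : HasChain k Z) (hZ' : ¬ HasChain (k + 1) Z) {m : ℕ}
    (hm : (m : ℕ∞) ≤ degree Z) : HilbertGrowth k m Z := by
  cases m with
  | zero => exact ⟨0, by simp⟩
  | succ m =>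
    have hlt : (m : ℕ∞) < degree Z := lt_of_lt_of_le (by exact_mod_cast Nat.lt_succ_self m) hm
    simp only [degree, lt_iSup_iff] at hlt
    obtain ⟨W, hW, hfin, hlt⟩ := hlt
    rw [dimension_eq_natCast hZc hZ hZ'] at hW
    have hW' : Module.finrank K W + k = n := by
      rw [add_comm]
      exact_mod_cast hW
    have := hfin.to_subtype
    have e := Finite.equivFin (linearSection Z W)
    rw [← hfin.cast_ncard_eq, Nat.cast_lt] at hlt
    refine HilbertGrowth.of_le (m := (linearSection Z W).ncard) ⟨(linearSection Z W).ncard,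
      fun N q hN => ?_⟩ hlt
    refine card_mul_pow_le_hilbert hZc hZi hZ hW' (fun i => (e.symm i).1)
      (Subtype.val_injective.comp e.symm.injective) ?_ hN
    rw [Set.range_comp', e.symm.range_eq_univ]
    simp

theorem sum_degree_le_of_dimension [IsAlgClosed K] (hn : 1 ≤ n) {T : Set (ProjSpace K n)} {D k : ℕ}
    (hT : IsZeroSetOfDegree K D T) (F : Finset (Set (ProjSpace K n)))
    (hF : ∀ Z ∈ F, IsComponent Z T) (hk : ∀ Z ∈ F, HasChain k Z ∧ ¬ HasChain (k + 1) Z) :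
    ∑ Z ∈ F, degree Z ≤ (((D + 1) ^ (n * n) * n ^ n : ℕ) : ℕ∞) := by
  have hTc : IsClosed T := isClosed_iff_isClosedOver.2 hT.isClosedOver
  rcases F.eq_empty_or_nonempty with rfl | ⟨Z₀, hZ₀⟩
  · simp
  have hkn : k ≤ n - 1 := by
    by_contra hlt
    exact not_hasChain_n Z₀ ((hk Z₀ hZ₀).1.of_le (by omega))
  have hchain : ∀ Z ∈ F, ¬ IsChainTop (k + 1) Z := fun Z hZ h => (hk Z hZ).2 ⟨Z, le_rfl, h⟩
  have hgrowth : ∀ Z ∈ F, ∀ m : ℕ, (m : ℕ∞) ≤ degree Z → HilbertGrowth k m Z := fun Z hZ m hm =>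
    hilbertGrowth_of_le_degree ((hF Z hZ).isClosed hTc) (hF Z hZ).1 (hk Z hZ).1 (hk Z hZ).2 hm
  have hfin : ∀ Z ∈ F, degree Z ≠ ⊤ := by
    -- An infinite degree would allow a growth constant beyond the bound already for the single
    -- component `Z`.
    intro Z hZ htop
    have := sum_le_of_hilbertGrowth hn hkn hT {Z} (by simpa using hF Z hZ)
      (by simpa using hchain Z hZ) (fun _ => (D + 1) ^ (n * n) * n ^ n + 1)
      (by simpa using hgrowth Z hZ _ (by simp [htop]))
    simp at this
  have h1 : ∑ Z ∈ F, degree Z = ((∑ Z ∈ F, (degree Z).toNat : ℕ) : ℕ∞) := by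
    rw [Nat.cast_sum]
    exact Finset.sum_congr rfl fun Z hZ => (ENat.natCast_toNat (hfin Z hZ)).symm
  rw [h1, Nat.cast_le]
  exact sum_le_of_hilbertGrowth hn hkn hT F hF hchain _ fun Z hZ =>
    hgrowth Z hZ _ (ENat.natCast_toNat (hfin Z hZ)).le

theorem isComponent_of_mem_components {P : Type*} [TopologicalSpace P] {T Z : Set P}
    (h : Z ∈ components T) : IsComponent Z T := by
  obtain ⟨Z', hZ', rfl⟩ := h
  refine ⟨hZ'.1.image _ continuous_subtype_val.continuousOn, by simp, fun Y hY hYT hZY => ?_⟩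
  have h2 : (Subtype.val ⁻¹' Y : Set T) ⊆ Z' := hZ'.2
    (isIrreducible_preimage_val hYT hY) fun z hz => hZY ⟨z, hz, rfl⟩
  refine Set.Subset.antisymm (fun y hy => ⟨⟨y, hYT hy⟩, h2 hy, rfl⟩) hZY

theorem finite_components {T : Set (ProjSpace K n)} (hT : IsClosed T) : (components T).Finite :=
  (finite_isComponent hT).subset fun _ hZ => isComponent_of_mem_components hZ

/-- The Bezout bound: the degrees of the components of a set defined in degree `D`. -/
theorem sum_degree_components_le [IsAlgClosed K] (hn : 1 ≤ n) {T : Set (ProjSpace K n)} {D : ℕ}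
    (hT : IsZeroSetOfDegree K D T) (hfin : (components T).Finite) :
    ∑ Z ∈ hfin.toFinset, degree Z ≤ ((n * ((D + 1) ^ (n * n) * n ^ n) : ℕ) : ℕ∞) := by
  classical
  have hTc : IsClosed T := isClosed_iff_isClosedOver.2 hT.isClosedOver
  have hcomp : ∀ Z ∈ hfin.toFinset, IsComponent Z T := fun Z hZ =>
    isComponent_of_mem_components (hfin.mem_toFinset.1 hZ)
  have hdim : ∀ Z ∈ hfin.toFinset, ∃ k < n, HasChain k Z ∧ ¬ HasChain (k + 1) Z := by
    intro Z hZ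
    have h0 : HasChain 0 Z :=
      (hasChain_zero_iff ((hcomp Z hZ).isClosed hTc)).2 (hcomp Z hZ).1.1
    have hex : ∃ k, ¬ HasChain k Z := ⟨n, not_hasChain_n Z⟩
    have h1 := Nat.find_spec hex
    have h2 : Nat.find hex ≤ n := Nat.find_min' hex (not_hasChain_n Z)
    have h3 : Nat.find hex ≠ 0 := fun h => h1 (h ▸ h0)
    refine ⟨Nat.find hex - 1, by omega, not_not.1 (Nat.find_min hex (by omega)), ?_⟩
    rwa [Nat.sub_add_cancel (by omega)]
  choose! δ hδn hδ using hdim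
  -- Components are grouped by dimension; the `n` possible values give the factor `n`.
  rw [← Finset.sum_fiberwise_of_maps_to (t := Finset.range n) (g := δ)
    fun Z hZ => Finset.mem_range.2 (hδn Z hZ)]
  refine (Finset.sum_le_card_nsmul _ _ (((D + 1) ^ (n * n) * n ^ n : ℕ) : ℕ∞) fun k _ => ?_).trans
    (by simp)
  refine sum_degree_le_of_dimension hn (k := k) hT _ (fun Z hZ => hcomp Z (Finset.mem_filter.1 hZ).1)
    fun Z hZ => ?_
  obtain ⟨hZ', rfl⟩ := Finset.mem_filter.1 hZ
  exact hδ Z hZ'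

end Bezout

/-! ### The degeneracy condition: equations, scaling and the diagonal -/

section Degenerate

variable {K : Type*} [Field K] {n r : ℕ}

/-- The equations in the point `x` (with values in any ring) that say that
`(x, y)` is degenerate. -/
def degeneracyForms {B : Type*} [CommRing B] (G : Fin r → MvPolynomial (Fin n) B) (y : Fin n → B) :
    Set (MvPolynomial (Fin n) B) :=
  (Set.range fun i => ∑ j, C (y j) * pderiv j (G i)) ∪
    Set.range fun e : Fin r → Fin n =>
      (Matrix.of fun i l => ∑ j, C (y j) * pderiv j (pderiv (e l) (G i))).det

/-- Degeneracy in terms of coordinate vectors. -/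
def IsDegenerateAt (G : Fin r → MvPolynomial (Fin n) K) (x y : Fin n → K) : Prop :=
  (∀ i, ∑ j, y j * eval x (pderiv j (G i)) = 0) ∧
    ∀ e : Fin r → Fin n,
      (Matrix.of fun i l => ∑ j, y j * eval x (pderiv j (pderiv (e l) (G i)))).det = 0

theorem forall_degeneracyForms_iff {B : Type*} [CommRing B] (G : Fin r → MvPolynomial (Fin n) B)
    (y : Fin n → B) (φ : B →+* K) (x : Fin n → K) :
    (∀ f ∈ degeneracyForms G y, eval₂ φ x f = 0) ↔
      IsDegenerateAt (fun i => map φ (G i)) x (fun j => φ (y j)) := by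
  simp only [degeneracyForms, Set.mem_union, or_imp, forall_and, Set.forall_mem_range,
    IsDegenerateAt, pderiv_map, eval_map]
  refine and_congr (forall_congr' fun i => ?_) (forall_congr' fun e => ?_)
  · simp [eval₂_sum]
  · rw [← coe_eval₂Hom, RingHom.map_det]
    congr! 2
    ext i l
    simp

theorem isDegenerate_iff (G : Fin r → MvPolynomial (Fin n) ℤ) (x y : ProjSpace K n) :
    IsDegenerate G x y ↔
      IsDegenerateAt (fun i => map (Int.castRingHom K) (G i)) x.coords y.coords := by
  have h : ∀ (v : Fin n → K) (f : MvPolynomial (Fin n) ℤ),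
      aeval v f = eval v (map (Int.castRingHom K) f) := by
    intro v f
    rw [eval_map, aeval_def]
    rfl
  rw [IsDegenerate, IsDegenerateAt, rank_lt_iff_forall_det]
  simp only [pderiv_map, ← h]
  rfl

theorem eval_smul_of_isHomogeneous {f : MvPolynomial (Fin n) K} {m : ℕ} (hf : f.IsHomogeneous m)
    (c : K) (v : Fin n → K) : eval (c • v) f = c ^ m * eval v f := by
  rw [eval_eq, eval_eq, Finset.mul_sum]
  refine Finset.sum_congr rfl fun d hd => ?_
  have hdm : d.degree = m := by
    by_contra hne
    exact mem_support_iff.1 hd (hf.coeff_eq_zero hne)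
  simp only [Pi.smul_apply, smul_eq_mul, mul_pow, Finset.prod_mul_distrib]
  rw [Finset.prod_pow_eq_pow_sum, ← hdm, Finsupp.degree_apply]
  ring

/-- Scaling multiplies each gradient equation, and each row of every minor, by a nonzero constant
that may depend on `i`. -/
theorem isDegenerateAt_smul_iff {d : Fin r → ℕ} {G : Fin r → MvPolynomial (Fin n) K}
    (hG : ∀ i, (G i).IsHomogeneous (d i)) {s t : K} (hs : s ≠ 0) (ht : t ≠ 0) (x y : Fin n → K) :
    IsDegenerateAt G (s • x) (t • y) ↔ IsDegenerateAt G x y := by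
  refine and_congr (forall_congr' fun i => ?_) (forall_congr' fun e => ?_)
  · have h1 : ∑ j, (t • y) j * eval (s • x) (pderiv j (G i)) =
        (t * s ^ (d i - 1)) * ∑ j, y j * eval x (pderiv j (G i)) := by
      rw [Finset.mul_sum]
      refine Finset.sum_congr rfl fun j _ => ?_
      rw [eval_smul_of_isHomogeneous (hG i).pderiv, Pi.smul_apply, smul_eq_mul]
      ring
    rw [h1, mul_eq_zero, or_iff_right (mul_ne_zero ht (pow_ne_zero _ hs))]
  · have h1 : (Matrix.of fun i l => ∑ j, (t • y) j * eval (s • x) (pderiv j (pderiv (e l) (G i)))) =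
        Matrix.of fun i l => (t * s ^ (d i - 1 - 1)) *
          Matrix.of (fun i l => ∑ j, y j * eval x (pderiv j (pderiv (e l) (G i)))) i l := by
      ext i l
      simp only [Matrix.of_apply, Finset.mul_sum]
      refine Finset.sum_congr rfl fun j _ => ?_
      rw [eval_smul_of_isHomogeneous (hG i).pderiv.pderiv, Pi.smul_apply, smul_eq_mul]
      ring
    rw [h1, Matrix.det_mul_column, mul_eq_zero, or_iff_right]
    exact Finset.prod_ne_zero_iff.2 fun i _ => mul_ne_zero ht (pow_ne_zero _ hs)

/-- Scaling invariance replaces a check that the minors are bihomogeneous: their bihomogeneous parts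
define the same set. -/
theorem isBiClosedOver_locusS [Infinite K] {p : ℕ} [Algebra (ZMod p) K] {d : Fin r → ℕ}
    {G : Fin r → MvPolynomial (Fin n) ℤ} (hG : ∀ i, (G i).IsHomogeneous (d i)) :
    IsBiClosedOver (ZMod p) (locusS K G) := by
  let G' : Fin r → MvPolynomial (Fin n) (MvPolynomial (Fin n ⊕ Fin n) (ZMod p)) := fun i =>
    map C (map (Int.castRingHom (ZMod p)) (G i))
  convert isBiClosedOver_blockExpand (K := K) (n := n)
    (eval (fun i => (X (Sum.inl i) : MvPolynomial (Fin n ⊕ Fin n) (ZMod p))) ''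
      degeneracyForms G' fun j => X (Sum.inr j)) using 1
  ext z
  simp only [locusS, Set.mem_ofPred_eq, Set.forall_mem_image, isDegenerate_iff]
  have key : ∀ t : Bool → K, (∀ f ∈ degeneracyForms G' fun j => X (Sum.inr j),
      aeval (fun i => t (biBlock n i) * z.coords i)
        (eval (fun i => (X (Sum.inl i) : MvPolynomial (Fin n ⊕ Fin n) (ZMod p))) f) = 0) ↔
      IsDegenerateAt (fun i => map (Int.castRingHom K) (G i)) (t false • z.fst.coords)
        (t true • z.snd.coords) := by
    intro t
    set φ : MvPolynomial (Fin n ⊕ Fin n) (ZMod p) →+* K :=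
      (aeval (fun i => t (biBlock n i) * z.coords i) :
        MvPolynomial (Fin n ⊕ Fin n) (ZMod p) →ₐ[ZMod p] K).toRingHom with hφ
    have h1 := forall_degeneracyForms_iff G' (fun j => X (Sum.inr j)) φ (t false • z.fst.coords)
    have h2 : ∀ i, map φ (G' i) = map (Int.castRingHom K) (G i) := by
      intro i
      rw [map_map, map_map]
      exact congrArg (fun ψ => map ψ (G i)) (RingHom.ext_int _ _)
    have h3 : (fun j => φ (X (Sum.inr j))) = t true • z.snd.coords := by
      funext j
      simp [hφ, biBlock, BiProjSpace.coords]
    have h4 : ∀ f : MvPolynomial (Fin n) (MvPolynomial (Fin n ⊕ Fin n) (ZMod p)),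
        φ (eval (fun i => (X (Sum.inl i) : MvPolynomial (Fin n ⊕ Fin n) (ZMod p))) f) =
          eval₂ φ (t false • z.fst.coords) f := by
      intro f
      rw [eval, coe_eval₂Hom, eval₂_comp_left, RingHom.comp_id]
      congr 1
      funext j
      simp [hφ, biBlock, BiProjSpace.coords]
    simp only [h2, h3, ← h4] at h1
    exact h1
  have hG' : ∀ i, (map (Int.castRingHom K) (G i)).IsHomogeneous (d i) := fun i => (hG i).map _
  constructor
  · intro h f hf
    refine blockExpand_eq_zero_of_units fun t ht => ?_
    have h1 := (isDegenerateAt_smul_iff hG' (ht false) (ht true) z.fst.coords z.snd.coords).2 h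
    exact (key t).2 h1 f hf
  · intro h
    have h1 := (key fun _ => 1).1 (by
      intro f hf
      have h2 := h hf
      rw [blockExpand_eq_zero_iff] at h2
      exact h2 fun _ => 1)
    rwa [one_smul, one_smul] at h1

theorem isClosed_fibreS [Infinite K] {d : Fin r → ℕ}
    {G : Fin r → MvPolynomial (Fin n) ℤ} (hG : ∀ i, (G i).IsHomogeneous (d i))
    (y : ProjSpace K n) : IsClosed (fibreS G y) := by
  rw [isClosed_iff_isClosedOver]
  convert isClosedOver_blockExpand (K := K) (n := n)
    (degeneracyForms (fun i => map (Int.castRingHom K) (G i)) y.coords) using 1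
  ext x
  simp only [fibreS, Set.mem_ofPred_eq, isDegenerate_iff]
  have hG' : ∀ i, (map (Int.castRingHom K) (G i)).IsHomogeneous (d i) := fun i => (hG i).map _
  have key : ∀ v : Fin n → K, (∀ f ∈ degeneracyForms (fun i => map (Int.castRingHom K) (G i))
      y.coords, aeval v f = 0) ↔
      IsDegenerateAt (fun i => map (Int.castRingHom K) (G i)) v y.coords := by
    intro v
    have h1 := forall_degeneracyForms_iff (fun i => map (Int.castRingHom K) (G i)) y.coords
      (RingHom.id K) v
    simp only [map_id, RingHom.id_apply] at h1
    exact h1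
  constructor
  · intro h f hf
    refine blockExpand_eq_zero_of_units fun t ht => ?_
    refine (key _).2 ?_ f hf
    have := (isDegenerateAt_smul_iff hG' (ht ()) (one_ne_zero) x.coords y.coords).2 h
    rwa [one_smul] at this
  · intro h
    refine (key _).1 fun f hf => ?_
    simpa using (blockExpand_eq_zero_iff _ _ _).1 (h f hf) fun _ => 1

/-- On the diagonal, degeneracy is singularity. -/
theorem mem_singularLocus_of_isDegenerate {p : ℕ} [Fact p.Prime] [Algebra (ZMod p) K]
    {d : Fin r → ℕ} {G : Fin r → MvPolynomial (Fin n) ℤ} (hG : ∀ i, (G i).IsHomogeneous (d i))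
    (hd : ∀ i, ¬ p ∣ d i * (d i - 1)) {x : ProjSpace K n} (hx : IsDegenerate G x x) :
    x ∈ singularLocus K G := by
  have hchar : CharP K p := charP_of_injective_algebraMap (algebraMap (ZMod p) K).injective p
  have hd1 : ∀ i, (d i : K) ≠ 0 := fun i h =>
    hd i (dvd_mul_of_dvd_left ((CharP.cast_eq_zero_iff K p _).1 h) _)
  -- Truncated subtraction is harmless: for `d i = 0` the product is zero, which `hd` excludes.
  have hd2 : ∀ i, ((d i - 1 : ℕ) : K) ≠ 0 := fun i h =>
    hd i (dvd_mul_of_dvd_right ((CharP.cast_eq_zero_iff K p _).1 h) _)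
  have euler : ∀ {f : MvPolynomial (Fin n) ℤ} {m : ℕ}, f.IsHomogeneous m →
      ∑ j, x.coords j * aeval x.coords (pderiv j f) = m * aeval x.coords f := by
    intro f m hf
    have := congrArg (aeval x.coords) hf.sum_X_mul_pderiv
    simpa using this
  obtain ⟨h1, h2⟩ := hx
  refine ⟨fun i => ?_, ?_⟩
  · have h3 := h1 i
    rw [dotProduct] at h3
    simp only [gradient] at h3
    rw [euler (hG i)] at h3
    exact (mul_eq_zero.1 h3).resolve_left (hd1 i)
  · rw [rank_lt_iff_forall_det] at h2 ⊢
    intro e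
    -- Euler's identity for the partial derivatives: row `i` is `d i - 1` times the gradient of `G
    -- i`.
    have h3 : (Matrix.of fun i => Matrix.vecMul x.coords (hessian (G i) x.coords)).submatrix id e =
        Matrix.of fun i l => ((d i - 1 : ℕ) : K) *
          ((Matrix.of fun i => gradient (G i) x.coords).submatrix id e) i l := by
      ext i l
      simp only [Matrix.submatrix_apply, Matrix.of_apply, Matrix.vecMul, dotProduct, hessian,
        gradient, id]
      exact euler (hG i).pderiv
    have h4 := h2 e
    rw [h3, Matrix.det_mul_column, mul_eq_zero] at h4
    exact h4.resolve_left (Finset.prod_ne_zero_iff.2 fun i _ => hd2 i)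

end Degenerate

/-! ### Universal equations for `T_s` -/

section Elimination

/-- Indices of the coefficients of `r` polynomials in `n` variables, of degree at most `D`
in each variable. -/
abbrev CoeffIndex (n r D : ℕ) : Type := Fin r × (Fin n → Fin (D + 1))

/-- The exponent vector of a coefficient. -/
def exponent {n D : ℕ} (e : Fin n → Fin (D + 1)) : Fin n →₀ ℕ :=
  Finsupp.equivFunOnFinite.symm fun j => (e j : ℕ)

/-- The polynomial with indeterminate coefficients. -/
def genericPoly (n r D : ℕ) (i : Fin r) :
    MvPolynomial (Fin n) (MvPolynomial (CoeffIndex n r D) ℤ) :=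
  ∑ e, monomial (exponent e) (X (i, e))

/-- The specialization of the indeterminate coefficients to those of `G`. -/
def coeffHom {n r : ℕ} (D : ℕ) (R : Type*) [CommRing R] (G : Fin r → MvPolynomial (Fin n) ℤ) :
    MvPolynomial (CoeffIndex n r D) ℤ →+* R :=
  eval₂Hom (Int.castRingHom R) fun ie => ((coeff (exponent ie.2) (G ie.1) : ℤ) : R)

theorem map_coeffHom_genericPoly {n r D : ℕ} (R : Type*) [CommRing R]
    {G : Fin r → MvPolynomial (Fin n) ℤ} {d : Fin r → ℕ} (hG : ∀ i, (G i).IsHomogeneous (d i))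
    (hd : ∀ i, d i ≤ D) (i : Fin r) :
    map (coeffHom D R G) (genericPoly n r D i) = map (Int.castRingHom R) (G i) := by
  classical
  ext m
  simp only [genericPoly, map_sum, map_monomial, coeff_sum, coeff_monomial, coeff_map]
  have hinj : Function.Injective (exponent : (Fin n → Fin (D + 1)) → Fin n →₀ ℕ) := by
    intro e e' h
    funext j
    exact Fin.ext (DFunLike.congr_fun h j)
  by_cases hm : coeff m (G i) = 0
  · rw [hm, map_zero]
    refine Finset.sum_eq_zero fun e _ => ?_
    split_ifs with h
    · simp [coeffHom, h, hm]
    · rfl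
  · have hdeg : m.degree = d i := by
      by_contra hne
      exact hm ((hG i).coeff_eq_zero hne)
    obtain ⟨e, rfl⟩ : ∃ e : Fin n → Fin (D + 1), exponent e = m := by
      refine ⟨fun j => ⟨m j, Nat.lt_succ_of_le ?_⟩, by ext j; rfl⟩
      exact (Finsupp.le_degree j m).trans (hdeg.le.trans (hd i))
    simp only [hinj.eq_iff]
    simp [coeffHom]

/-- The ring of generic coefficients, of coordinates of `y` and of coefficients
of `s` linear forms. -/
abbrev EliminationRing (n r D s : ℕ) : Type :=
  MvPolynomial (Fin s × Fin n) (MvPolynomial (Fin n) (MvPolynomial (CoeffIndex n r D) ℤ))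

/-- The condition on `y` for the fibre over `y` to meet every
linear subspace of codimension `s` is given by universal equations. -/
theorem exists_elimination.{u} (n r D s : ℕ) :
    ∃ Q : Finset (MvPolynomial (Fin n) (MvPolynomial (CoeffIndex n r D) ℤ)),
      ∀ (K : Type u) [Field K] [IsAlgClosed K] (γ : MvPolynomial (CoeffIndex n r D) ℤ →+* K)
        (w : Fin n → K), (∀ c ∈ Q, eval₂ γ w c = 0) ↔
          ∀ a : Fin s → Fin n → K, ∃ v : Fin n → K, v ≠ 0 ∧ ∀ t : K, t ≠ 0 →
            IsDegenerateAt (fun i => map γ (genericPoly n r D i)) (t • v) w ∧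
              ∀ j, a j ⬝ᵥ (t • v) = 0 := by
  classical
  let ι : MvPolynomial (CoeffIndex n r D) ℤ →+* EliminationRing n r D s := C.comp C
  let F : Set (MvPolynomial (Fin n) (EliminationRing n r D s)) :=
    degeneracyForms (B := EliminationRing n r D s) (fun i => map ι (genericPoly n r D i)) (fun j => C (X j)) ∪
      Set.range fun j : Fin s => ∑ l, C (X (j, l)) * X l
  let E : Set (EliminationRing n r D s) := eliminants (homParts (A := EliminationRing n r D s) F)
  -- Hilbert's basis theorem over `ℤ` makes the list of eliminants finite before any prime or field
  -- is chosen; this is the source of uniformity in `p`.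
  obtain ⟨B, hB⟩ := (Ideal.span E).fg_of_isNoetherianRing
  have hker : ∀ {K : Type u} [Field K] (φ : EliminationRing n r D s →+* K),
      (∀ b ∈ E, φ b = 0) ↔ ∀ b ∈ B, φ b = 0 := by
    intro K _ φ
    have h1 : ∀ S : Set (EliminationRing n r D s), (∀ b ∈ S, φ b = 0) ↔ Ideal.span S ≤ RingHom.ker φ := by
      intro S
      rw [Ideal.span_le]
      rfl
    rw [h1, ← hB, ← h1]
    rfl
  -- Solvability for all linear forms means that the eliminants vanish identically in the
  -- coefficients of these forms. As `K` is infinite, this is the vanishing of their coefficients,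
  -- which are polynomials in `y`.
  refine ⟨B.biUnion fun b => b.support.image fun m => coeff m b, fun K _ _ γ w => ?_⟩
  have : Infinite K := IsAlgClosed.instInfinite
  have hQ : (∀ c ∈ B.biUnion fun b => b.support.image fun m => coeff m b, eval₂ γ w c = 0) ↔
      ∀ b ∈ B, map (eval₂Hom γ w) b = 0 := by
    simp only [Finset.mem_biUnion, Finset.mem_image, forall_exists_index, and_imp]
    constructor
    · intro h b hb
      ext m
      rw [coeff_map, coeff_zero]
      by_cases hm : m ∈ b.support
      · exact h _ b hb m hm rfl
      · rw [notMem_support_iff.1 hm, map_zero]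
    · rintro h _ b hb m - rfl
      have := congrArg (coeff m) (h b hb)
      rwa [coeff_map, coeff_zero] at this
  have hφ : ∀ (a : Fin s → Fin n → K),
      (∀ b ∈ B, eval (fun jl : Fin s × Fin n => a jl.1 jl.2) (map (eval₂Hom γ w) b) = 0) ↔
      ∃ v : Fin n → K, v ≠ 0 ∧ ∀ t : K, t ≠ 0 →
            IsDegenerateAt (fun i => map γ (genericPoly n r D i)) (t • v) w ∧
              ∀ j, a j ⬝ᵥ (t • v) = 0 := by
    intro a
    let φ : EliminationRing n r D s →+* K := eval₂Hom (eval₂Hom γ w) fun jl => a jl.1 jl.2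
    have h1 : ∀ b : EliminationRing n r D s, eval (fun jl : Fin s × Fin n => a jl.1 jl.2) (map (eval₂Hom γ w) b) =
        φ b := by
      intro b
      rw [eval_map]
      rfl
    have h2 : ∀ v : Fin n → K, (∀ f ∈ F, eval₂ φ v f = 0) ↔
        IsDegenerateAt (fun i => map γ (genericPoly n r D i)) v w ∧ ∀ j, a j ⬝ᵥ v = 0 := by
      intro v
      have h3 := forall_degeneracyForms_iff (B := EliminationRing n r D s) (fun i => map ι (genericPoly n r D i))
        (fun j => C (X j)) φ v
      have h4 : φ.comp ι = γ := by
        ext x <;> simp [φ, ι]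
      simp only [map_map, h4] at h3
      have h5 : (fun j => φ (C (X j))) = w := by
        funext j
        simp [φ]
      rw [h5] at h3
      simp only [F, Set.mem_union, or_imp, forall_and, Set.forall_mem_range]
      refine and_congr h3 (forall_congr' fun j => ?_)
      simp [eval₂_sum, φ, dotProduct]
    simp only [h1]
    rw [← hker φ, ← exists_zero_iff_eliminants_homParts]
    refine exists_congr fun v => and_congr_right fun _ => ?_
    simp only [← h2]
    exact ⟨fun h t ht f hf => h f hf t ht, fun h f hf t ht => h t ht f hf⟩
  rw [hQ]
  simp only [← hφ]
  constructor
  · intro h a b hb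
    rw [h b hb, map_zero]
  · intro h b hb
    refine MvPolynomial.funext fun u => ?_
    simpa using h (fun j l => u (j, l)) b hb

/-- The scalars `c` and `t` are kept free to match the orbit conditions of the elimination, which
involve no homogeneity of the universal equations. -/
theorem mem_locusT_iff {K : Type*} [Field K] [IsAlgClosed K] {n r s : ℕ} {d : Fin r → ℕ}
    {G : Fin r → MvPolynomial (Fin n) ℤ} (hG : ∀ i, (G i).IsHomogeneous (d i))
    (y : ProjSpace K n) {c : K} (hc : c ≠ 0) : y ∈ locusT K G s ↔
      ∀ a : Fin s → Fin n → K, ∃ v : Fin n → K, v ≠ 0 ∧ ∀ t : K, t ≠ 0 →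
        IsDegenerateAt (fun i => map (Int.castRingHom K) (G i)) (t • v) (c • y.coords) ∧
          ∀ j, a j ⬝ᵥ (t • v) = 0 := by
  have : Infinite K := IsAlgClosed.instInfinite
  have hG' : ∀ i, (map (Int.castRingHom K) (G i)).IsHomogeneous (d i) := fun i => (hG i).map _
  have h1 : y ∈ locusT K G s ↔ HasChain s (fibreS G y) :=
    natCast_le_dimension_iff (isClosed_fibreS hG y) s
  rw [h1, hasChain_iff_forall_linear (isClosed_fibreS hG y)]
  refine forall_congr' fun a => ⟨?_, ?_⟩
  · rintro ⟨x, hx, ha⟩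
    refine ⟨x.coords, x.coords_ne_zero, fun t ht => ⟨?_, fun j => ?_⟩⟩
    · exact (isDegenerateAt_smul_iff hG' ht hc _ _).2 ((isDegenerate_iff G x y).1 hx)
    · rw [dotProduct_smul, ha j, smul_zero]
  · rintro ⟨v, hv, h⟩
    obtain ⟨b, hb, hbv⟩ := exists_coords_projPoint v hv
    refine ⟨projPoint v hv, (isDegenerate_iff G _ y).2 ?_, fun j => ?_⟩
    · have h2 := (h b hb).1
      rw [← hbv] at h2
      refine (isDegenerateAt_smul_iff hG' one_ne_zero hc _ _).1 ?_
      rwa [one_smul]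
    · rw [hbv]
      exact (h b hb).2 j

/-- Specializing coefficients cannot raise the degree in `y`, so the largest total degree among the
universal equations serves for all `p`, `K` and `G`. -/
theorem exists_degree_locusT.{u} (n r s : ℕ) (d : Fin r → ℕ) :
    ∃ D : ℕ, ∀ (p : ℕ) (K : Type u) [Field K] [IsAlgClosed K] [Algebra (ZMod p) K]
      (G : Fin r → MvPolynomial (Fin n) ℤ), (∀ i, (G i).IsHomogeneous (d i)) →
        IsZeroSetOfDegree (ZMod p) D (locusT K G s) := by
  obtain ⟨Q, hQ⟩ := exists_elimination.{u} n r (Finset.univ.sup d) s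
  refine ⟨Q.sup totalDegree, fun p K _ _ _ G hG => ?_⟩
  have : Infinite K := IsAlgClosed.instInfinite
  have hd : ∀ i, d i ≤ Finset.univ.sup d := fun i => Finset.le_sup (Finset.mem_univ i)
  have key : ∀ (y : ProjSpace K n) (c : K), c ≠ 0 → (y ∈ locusT K G s ↔
      ∀ f ∈ map (coeffHom (Finset.univ.sup d) (ZMod p) G) '' (Q : Set (MvPolynomial (Fin n) _)),
        aeval (c • y.coords) f = 0) := by
    intro y c hc
    have hγ : (algebraMap (ZMod p) K).comp (coeffHom (Finset.univ.sup d) (ZMod p) G) =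
        coeffHom (Finset.univ.sup d) K G := by
      ext x <;> simp [coeffHom]
    rw [mem_locusT_iff hG y hc]
    have h1 := hQ K (coeffHom (Finset.univ.sup d) K G) (c • y.coords)
    simp only [map_coeffHom_genericPoly K hG hd] at h1
    rw [← h1, Set.forall_mem_image]
    simp only [aeval_def, eval₂_map, hγ]
    rfl
  convert isZeroSetOfDegree_blockExpand (K := K) (n := n) (D := Q.sup totalDegree)
    (map (coeffHom (Finset.univ.sup d) (ZMod p) G) '' (Q : Set (MvPolynomial (Fin n) _))) ?_ using 1
  · ext y
    constructor
    · intro hy f hf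
      exact blockExpand_eq_zero_of_units fun t ht => (key y (t ()) (ht ())).1 hy f hf
    · intro hy
      refine (key y 1 one_ne_zero).2 fun f hf => ?_
      have h1 := hy f hf
      rw [blockExpand_eq_zero_iff] at h1
      exact h1 fun _ => 1
  · rintro _ ⟨f, hf, rfl⟩
    exact (Finset.sup_mono (support_map_subset _ _)).trans (Finset.le_sup (f := totalDegree) hf)

end Elimination

/-! ### Dimension counts for `S` and `T_s` -/

section Main

theorem locusT_neg_one {K : Type*} [Field K] {n r : ℕ}
    (G : Fin r → MvPolynomial (Fin n) ℤ) : locusT K G (-1) = Set.univ :=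
  Set.eq_univ_of_forall fun _ => neg_one_le_dimension _

theorem IsZeroSetOfDegree.of_le {K : Type*} [Field K] {n : ℕ} {k : Type*}
    [CommRing k] [Algebra k K] {D D' : ℕ}
    {T : Set (ProjSpace K n)} (h : IsZeroSetOfDegree k D T) (hD : D ≤ D') :
    IsZeroSetOfDegree k D' T := by
  obtain ⟨A, hA, hT⟩ := h
  exact ⟨A, fun f hf => let ⟨m, hm, hfm⟩ := hA f hf; ⟨m, hm.trans hD, hfm⟩, hT⟩

theorem IsBiClosedOver.isClosed {K : Type*} [Field K] {n : ℕ} {k : Type*} [CommRing k]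
    [Algebra k K] {T : Set (BiProjSpace K n)} (h : IsBiClosedOver k T) : IsClosed T := by
  obtain ⟨A, hA, rfl⟩ := h
  have hmap : ∀ {w : Fin n ⊕ Fin n → ℕ} {f : MvPolynomial (Fin n ⊕ Fin n) k} {m : ℕ},
      IsWeightedHomogeneous w f m → IsWeightedHomogeneous w (map (algebraMap k K) f) m := by
    intro w f m hf d hd
    refine hf fun h0 => hd ?_
    rw [coeff_map, h0, map_zero]
  rw [isClosed_iff_isBiClosedOver]
  refine ⟨map (algebraMap k K) '' A, ?_, ?_⟩
  · rintro _ ⟨f, hf, rfl⟩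
    obtain ⟨a, b, h1, h2⟩ := hA f hf
    exact ⟨a, b, hmap h1, hmap h2⟩
  · ext z
    simp only [Set.mem_ofPred_eq, Set.forall_mem_image, aeval_map_algebraMap]

variable {K : Type*} [Field K] [IsAlgClosed K] {n r : ℕ}

/-- Fibre dimensions add up. -/
theorem HasChain.locusS_of_locusT {d : Fin r → ℕ} {G : Fin r → MvPolynomial (Fin n) ℤ}
    (hG : ∀ i, (G i).IsHomogeneous (d i)) (hS : IsClosed (locusS K G)) {m s : ℕ}
    (h : HasChain m (locusT K G s)) : HasChain (m + s) (locusS K G) := by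
  have : Infinite K := IsAlgClosed.instInfinite
  obtain ⟨Z, hZT, hZ⟩ := h
  have hC : IsClosed (locusS K G ∩ BiProjSpace.snd ⁻¹' Z) :=
    hS.inter (hZ.isClosed.preimage continuous_snd)
  -- The hyperplanes involve `x` only, so they cut each fibre by `s` linear equations; a fibre of
  -- dimension at least `s` survives, and the section still maps onto `Z`.
  obtain ⟨a, ha⟩ := exists_hyperplanes continuous_fst s
    (fun _ : Unit => locusS K G ∩ BiProjSpace.snd ⁻¹' Z) fun _ => hC
  refine (ha () m ?_).mono Set.inter_subset_left
  have hlin : IsClosed {z : BiProjSpace K n | ∀ j, a j ⬝ᵥ z.fst.coords = 0} := by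
    rw [Set.ofPred_forall]
    exact isClosed_iInter fun j => (isClosed_hyperplane (a j)).preimage continuous_fst
  obtain ⟨Y, hY, hYm, -⟩ := exists_chain_lift continuous_snd isClosedMap_snd hZ (hC.inter hlin) (by
    intro y hy
    obtain ⟨x, hx, hax⟩ := HasChain.exists_mem_of_linear
      ((natCast_le_dimension_iff (isClosed_fibreS hG y) s).1 (hZT hy)) a
    exact ⟨⟨x, y⟩, ⟨⟨hx, hy⟩, hax⟩, rfl⟩)
  exact ⟨Y, hY, hYm⟩

theorem not_hasChain_locusS (hn : 1 ≤ n) {p : ℕ} [Fact p.Prime] [Algebra (ZMod p) K]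
    {d : Fin r → ℕ} {G : Fin r → MvPolynomial (Fin n) ℤ} (hG : ∀ i, (G i).IsHomogeneous (d i))
    (hd : ∀ i, ¬ p ∣ d i * (d i - 1)) (hsing : singularLocus K G = ∅) :
    ¬ HasChain (n - 1) (locusS K G) := by
  intro h
  obtain ⟨x, hx⟩ := h.exists_mem_diagonal (by omega)
  have : x ∈ singularLocus K G := mem_singularLocus_of_isDegenerate hG hd hx
  rwa [hsing] at this

end Main

end

end ProjGeom

open ProjGeom in
theorem lemma2p1 (n r : ℕ) (hn : 1 ≤ n) (d : Fin r → ℕ) :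
    ∃ C : ℕ, ∀ (p : ℕ) [Fact p.Prime] (K : Type*) [Field K] [IsAlgClosed K] [Algebra (ZMod p) K]
      (G : Fin r → MvPolynomial (Fin n) ℤ),
      (∀ i, (G i).IsHomogeneous (d i)) →
      (∀ i, ¬ p ∣ d i * (d i - 1)) →
      HasCodim (variety K G) r →
      dimension (singularLocus K G) = (-1 : ℤ) →
        IsBiClosedOver (ZMod p) (locusS K G) ∧
        (∀ y : ProjSpace K n, IsClosed (fibreS G y)) ∧
        dimension (locusS K G) ≤ ((n : ℤ) - 2 : ℤ) ∧
        ∀ s : ℤ, -1 ≤ s → s ≤ (n : ℤ) - 1 →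
          IsClosedOver (ZMod p) (locusT K G s) ∧
          dimension (locusT K G s) ≤ ((n : ℤ) - s - 2 : ℤ) ∧
          ∃ hfin : (components (locusT K G s)).Finite,
            ∑ Z ∈ hfin.toFinset, degree Z ≤ (C : ℕ∞) := by
  choose D hD using fun s => exists_degree_locusT n r s d
  -- One degree for all `0 ≤ s ≤ n - 1`; the case `s = -1` is the whole space and needs no
  -- equations.
  let D' := (Finset.range n).sup D
  refine ⟨n * ((D' + 1) ^ (n * n) * n ^ n), fun p _ K _ _ _ G hG hd _ hsing => ?_⟩
  have : Infinite K := IsAlgClosed.instInfinite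
  have hSbi : IsBiClosedOver (ZMod p) (locusS K G) := isBiClosedOver_locusS hG
  have hScl : IsClosed (locusS K G) := hSbi.isClosed
  have hSn := not_hasChain_locusS hn hG hd (eq_empty_of_dimension_eq_neg_one hsing)
  have hT : ∀ s : ℤ, -1 ≤ s → s ≤ (n : ℤ) - 1 →
      IsZeroSetOfDegree (ZMod p) D' (locusT K G s) ∧
        dimension (locusT K G s) ≤ ((n : ℤ) - s - 2 : ℤ) := by
    intro s hs hsn
    rcases hs.eq_or_lt with rfl | hs
    · rw [locusT_neg_one]
      refine ⟨⟨∅, by simp, by simp⟩, ?_⟩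
      have h1 := (dimension_lt_natCast_iff (isClosed_univ (X := ProjSpace K n)) n).2
        (not_hasChain_n _)
      convert h1 using 2
      ring
    · lift s to ℕ using by omega
      have hz := (hD s p K G hG).of_le (D' := D')
        (Finset.le_sup (f := D) (Finset.mem_range.2 (by omega)))
      refine ⟨hz, ?_⟩
      have hcl : IsClosed (locusT K G s) := isClosed_iff_isClosedOver.2 hz.baseChange.isClosedOver
      -- A chain of length `n - 1 - s` in `T_s` would give one of length `n - 1` in `S`.
      have h1 := (dimension_lt_natCast_iff hcl (n - 1 - s)).2 fun h =>
        hSn ((h.locusS_of_locusT hG hScl).of_le (by omega))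
      convert h1 using 2
      omega
  refine ⟨hSbi, fun y => isClosed_fibreS hG y, ?_, fun s hs hsn => ?_⟩
  · have h1 := (dimension_lt_natCast_iff hScl (n - 1)).2 hSn
    convert h1 using 2
    omega
  · obtain ⟨hz, hdim⟩ := hT s hs hsn
    have hcl : IsClosed (locusT K G s) := isClosed_iff_isClosedOver.2 hz.baseChange.isClosedOver
    exact ⟨hz.isClosedOver, hdim, finite_components hcl,
      sum_degree_components_le hn hz.baseChange _⟩
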